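/- Let $m\ge 3$. Given a sequence of $n$ distinct keys, its $m$-ary search tree is empty if $n=0$, is a single node containing all keys if $1\le n<m$, and, if $n\ge m$, has a root containing the first $m-1$ keys, while the remaining keys are directed, in order of arrival, to $m$ subtrees corresponding to the $m$ intervals determined by the sorted root keys; the subtrees are built recursively in the same way. For the tree built from a uniformly random permutation of $n$ elements, let $S_n$ be the number of (nonempty) nodes, $K_n$ the sum over all keys of the distance from the root to the node holding the key, and $N_n$ the sum over all nodes of the distance from the root to the node. Let $\rho(X,Y)=\mathrm{Cov}(X,Y)/\sqrt{\mathbb V(X)\mathbb V(Y)}$. (i) If $3\le m\le 26$, then $\mathbb V(S_n),\mathbb V(N_n)>0$ for all large $n$, and $\rho(S_n,N_n)\to 0$ as $n\to\infty$. (ii) Let $m\ge 27$. Then $\mathbb V(S_n),\mathbb V(N_n),\mathbb V(K_n)>0$ for all large $n$. Among the zeros different from $2$ of $\Lambda(z)=z(z+1)\cdots(z+m-2)-m!$ there is exactly one, $\lambda=\alpha+i\beta$, that has maximal real part and satisfies $\beta>0$. Put $H_m=\sum_{j=1}^m j^{-1}$, $H^{(2)}_m=\sum_{j=1}^m j^{-2}$,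 $\phi=\frac1{2(H_m-1)}$, $$C_K=4\phi^2\Big(\frac{(m+1)H_m^{(2)}-2}{m-1}-\frac{\pi^2}{6}\Big),\qquad A=\frac1{\lambda(\lambda-1)\sum_{0\le j\le m-2}\frac1{j+\lambda}},$$ and, for real $z$, with $\gamma$ Euler's constant and $\psi=\Gamma'/\Gamma$, $$F_1(z)=2\frac{|A|^2}{|\Gamma(\lambda)|^2}\Big(-1+\frac{m!(m-1)|\Gamma(\lambda)|^2}{\Gamma(2\alpha+m-2)-m!\,\Gamma(2\alpha-1)}\Big)+2\Re\Big(\frac{A^2e^{2iz}}{\Gamma(\lambda)^2}\Big(-1+\frac{m!(m-1)\Gamma(\lambda)^2}{\Gamma(2\lambda+m-2)-m!\,\Gamma(2\lambda-1)}\Big)\Big),$$ $$F_2(z)=4\phi\,\Re\Big(\frac{(\lambda+m-1)A\,e^{iz}}{(m-1)\Gamma(\lambda)}\Big(\frac1{2\phi}-\frac{(\lambda+m-1)\psi(\lambda+m)-\lambda\psi(\lambda+1)-(m-1)(1-\gamma)}{\lambda+m-1}\Big)\Big).$$ Then $C_K>0$, $F_1(z)>0$ for all real $z$, and, as $n\to\infty$,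 $$\rho(S_n,N_n)=\rho(S_n,K_n)+o(1),\qquad \rho(S_n,K_n)=\frac{F_2(\beta\log n)}{\sqrt{C_K\,F_1(\beta\log n)}}+o(1).$$ -/

import Mathlib

open Filter Topology MeasureTheory ProbabilityTheory

/-- An `m`-ary tree whose nodes store finite sets of keys: it is either empty, or consists of a
root node together with an ordered `m`-tuple of subtrees. -/
inductive MTree (m : ℕ) : Type
  | empty : MTree m
  | node (keys : Finset ℕ) (children : Fin m → MTree m) : MTree m

namespace MTree

/-- The `m`-ary search tree (`m ≥ 2`) built from a sequence of distinct keys. A nonempty sequence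
of fewer than `m` keys is stored in a single node. Otherwise the first `m - 1` keys are stored in
the root and each remaining key `x` is directed, in the order of arrival, to the subtree number
`i ∈ {0, …, m - 1}`, where `i` is the number of root keys smaller than `x`; that is, the subtree
belonging to the `i`-th of the `m` intervals into which the sorted root keys divide the line.
(For `m < 2`, which is irrelevant, all keys are put in one node.) -/
def build (m : ℕ) (l : List ℕ) : MTree m :=
  if _hl : l = [] then empty
  else if _hm : l.length < m ∨ m < 2 then node l.toFinset (fun _ => empty)
  else node (l.take (m - 1)).toFinset (fun i =>
    build m ((l.drop (m - 1)).filter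
      (fun x => ((l.take (m - 1)).filter (fun y => y < x)).length = (i : ℕ))))
termination_by l.length
decreasing_by
  refine lt_of_le_of_lt (List.length_filter_le _ _) ?_
  rw [List.length_drop]
  have := List.length_pos_iff.mpr _hl
  omega

variable {m : ℕ}

/-- The number of nodes of a tree. -/
def numNodes : MTree m → ℕ
  | empty => 0
  | node _ c => 1 + ∑ i, numNodes (c i)

/-- The sum over all keys of (`d` plus the distance from the root to the node holding the key). -/
def keyDepthSum : MTree m → ℕ → ℕ
  | empty, _ => 0
  | node keys c, d => d * keys.card + ∑ i, keyDepthSum (c i) (d + 1)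

/-- The sum over all nodes of (`d` plus the distance from the root to the node). -/
def nodeDepthSum : MTree m → ℕ → ℕ
  | empty, _ => 0
  | node _ c, d => d + ∑ i, nodeDepthSum (c i) (d + 1)

end MTree

/-- Permutations of a finite set form a discrete measurable space. -/
instance permFinMeasurableSpace (n : ℕ) : MeasurableSpace (Equiv.Perm (Fin n)) := ⊤

/-- The uniform distribution on the `n!` permutations of `n` elements. -/
noncomputable def unifPerm (n : ℕ) : Measure (Equiv.Perm (Fin n)) :=
  (PMF.uniformOfFintype (Equiv.Perm (Fin n))).toMeasure

/-- The `m`-ary search tree built from the sequence `σ(0), σ(1), …, σ(n-1)`. -/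
def searchTree (m n : ℕ) (σ : Equiv.Perm (Fin n)) : MTree m :=
  MTree.build m (List.ofFn (fun i => (σ i : ℕ)))

/-- The space requirement `S_n`: the number of nodes. -/
def spaceReq (m n : ℕ) (σ : Equiv.Perm (Fin n)) : ℝ :=
  ((searchTree m n σ).numNodes : ℝ)

/-- The key path length `K_n`: the sum of the distances from the root to all keys. -/
def keyPathLength (m n : ℕ) (σ : Equiv.Perm (Fin n)) : ℝ :=
  ((searchTree m n σ).keyDepthSum 0 : ℝ)

/-- The node path length `N_n`: the sum of the distances from the root to all nodes. -/
def nodePathLength (m n : ℕ) (σ : Equiv.Perm (Fin n)) : ℝ :=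
  ((searchTree m n σ).nodeDepthSum 0 : ℝ)

/-- Pearson's correlation coefficient (meaningful when both variances are positive). -/
noncomputable def corrCoeff {Ω : Type*} [MeasurableSpace Ω] (μ : Measure Ω) (X Y : Ω → ℝ) : ℝ :=
  cov[X, Y; μ] / (√(Var[X; μ]) * √(Var[Y; μ]))

/-- The indicial function `Λ(z) = z (z + 1) ⋯ (z + m - 2) - m!`. -/
noncomputable def indicial (m : ℕ) (z : ℂ) : ℂ :=
  ∏ j ∈ Finset.range (m - 1), (z + (j : ℂ)) - (m.factorial : ℂ)

/-- `lam = α + iβ` with `β > 0` is the second largest zero of the indicial function with respect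
to real parts; the largest zero is `2`. -/
def IsSecondZero (m : ℕ) (lam : ℂ) : Prop :=
  indicial m lam = 0 ∧ lam ≠ 2 ∧ 0 < lam.im ∧
    ∀ w : ℂ, indicial m w = 0 → w ≠ 2 → w.re ≤ lam.re

/-- The generalized harmonic number `∑_{1 ≤ j ≤ m} j^{-r}`. -/
noncomputable def harm (r m : ℕ) : ℝ := ∑ j ∈ Finset.Icc 1 m, 1 / (j : ℝ) ^ r

/-- The occupancy constant `φ = 1 / (2 (H_m - 1))`. -/
noncomputable def occ (m : ℕ) : ℝ := 1 / (2 * (harm 1 m - 1))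

/-- The constant `C_K = 4 φ² (((m + 1) H_m^{(2)} - 2) / (m - 1) - π² / 6)`. -/
noncomputable def constK (m : ℕ) : ℝ :=
  4 * occ m ^ 2 * ((((m : ℝ) + 1) * harm 2 m - 2) / ((m : ℝ) - 1) - Real.pi ^ 2 / 6)

/-- The coefficient `A = 1 / (λ (λ - 1) ∑_{0 ≤ j ≤ m - 2} 1 / (j + λ))`. -/
noncomputable def coeffA (m : ℕ) (lam : ℂ) : ℂ :=
  1 / (lam * (lam - 1) * ∑ j ∈ Finset.range (m - 1), 1 / ((j : ℂ) + lam))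

/-- The `π`-periodic function `F₁`. -/
noncomputable def F1 (m : ℕ) (lam : ℂ) (z : ℝ) : ℝ :=
  2 * (‖coeffA m lam‖ ^ 2 / ‖Complex.Gamma lam‖ ^ 2) *
      (-1 + (m.factorial : ℝ) * ((m : ℝ) - 1) * ‖Complex.Gamma lam‖ ^ 2 /
        (Real.Gamma (2 * lam.re + m - 2) - (m.factorial : ℝ) * Real.Gamma (2 * lam.re - 1)))
  + 2 * (coeffA m lam ^ 2 * Complex.exp (2 * Complex.I * z) / Complex.Gamma lam ^ 2 *
      (-1 + (m.factorial : ℂ) * ((m : ℂ) - 1) * Complex.Gamma lam ^ 2 /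
        (Complex.Gamma (2 * lam + m - 2) -
          (m.factorial : ℂ) * Complex.Gamma (2 * lam - 1)))).re

/-- The `2π`-periodic function `F₂`; `γ` is Euler's constant and `ψ` the digamma function. -/
noncomputable def F2 (m : ℕ) (lam : ℂ) (z : ℝ) : ℝ :=
  4 * occ m * ((lam + m - 1) * coeffA m lam * Complex.exp (Complex.I * z) /
      (((m : ℂ) - 1) * Complex.Gamma lam) *
    (1 / (2 * (occ m : ℂ)) - 1 / (lam + m - 1) *
      ((lam + m - 1) * Complex.digamma (lam + m) - lam * Complex.digamma (lam + 1)
        - ((m : ℂ) - 1) * (1 - (Real.eulerMascheroniConstant : ℂ))))).re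

/-! Given the root keys, the subtree sizes form a uniformly random composition of `n - (m - 1)` into
`m` parts, and given the sizes the subtrees are independent and uniform (`permAvg_prod_part`). Means
and covariances of additive functionals therefore satisfy one linear recurrence x = L x + t with the
averaging operator L = `compMean`. For covariances the toll t is `tollCov`, the covariance, over the
random composition, of the sums of the subtree means (`permCov_rec`).

L is diagonalised by the coefficients `qseq s` of (1 - z)^(-s), with eigenvalue m!/(s(s+1)⋯(s+m-2))
(`risingProd_mul_compMean`). Hence the zeros of Λ give the homogeneous solutions. They are simple, 2
is one of them, and all others have real part below 2. The mean of S is, up to an additive constant,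
a combination of `qseq` at the zeros. The toll of K is resonant with the zero 2, so its mean
contains the derivative `dq 2` of `qseq s` in s, of order n log n. Since a composition has a fixed
sum, `tollCov` ignores affine functions: the linear parts of the means disappear, and the logarithm
can be subtracted before estimating. The remaining tolls are, to leading order, combinations of
`qseq u` with Re u > 2, with Gamma and digamma values as coefficients. Such a toll passes through
the recurrence by division by one minus its eigenvalue, whatever the initial values
(`tendsto_of_compMean_rec`). This yields Var K ~ C_K n², and for m ≥ 27 also Var S = n^(2α-2)(F₁(β
log n) + o(1)) and Cov(S, K) = n^α(F₂(β log n) + o(1)).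

The threshold 26/27 is the question whether a zero other than 2 has real part above 3/2. On Re s > 0
the modulus of the product increases in Re s and |Im s|, while its argument is a sum of arctangents;
comparing that sum with 2π on the level curve of modulus m! decides it (`re_lt_of_root`,
`exists_root_re_gt`). For m ≤ 26 the covariance of S and K is o(n^(3/2)), whereas Var S is at least
of linear order (`exists_permCov_sizeFun_lower`), so the correlation vanishes.

N enters through N - φK (`gapFun`): the terms of order n log n cancel in its mean and its variance
is o(n²) (`isLittleO_permCov_gapFun`), so N may be replaced by K in the correlation.

Strict positivity of F₁ comes from Cauchy–Schwarz: Var S dominates its own toll, hence the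
normalised squared toll covariance of S with the test sequences `qseq 3` and `qseq 4`. Letting β log
n approach any phase z, F₁(z) = 0 would force two independent real-linear functionals of a nonzero
complex number to vanish (`F1_pos`). -/

open Asymptotics

/-! ### Splitting a list of keys at the root. -/

section Parts

/-- The sublist of keys directed to the subtree number `i`. -/
def part {α : Type*} [LinearOrder α] (m i : ℕ) (l : List α) : List α :=
  (l.drop (m - 1)).filter
    (fun x => ((l.take (m - 1)).filter (fun y => y < x)).length = i)

variable {α β : Type*} [LinearOrder α] [LinearOrder β]

theorem part_sublist (m i : ℕ) (l : List α) : (part m i l).Sublist l :=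
  List.filter_sublist.trans (List.drop_sublist _ _)

theorem part_map (m i : ℕ) (l : List α) (g : α → β) (hg : StrictMonoOn g {x | x ∈ l}) :
    part m i (l.map g) = (part m i l).map g := by
  unfold part
  rw [← List.map_drop, ← List.map_take, List.filter_map]
  congr 1
  apply List.filter_congr
  intro x hx
  have hx' : x ∈ l := List.mem_of_mem_drop hx
  simp only [Function.comp, List.filter_map, List.length_map]
  congr 3
  apply List.filter_congr
  intro y hy
  have hy' : y ∈ l := List.mem_of_mem_take hy
  simp only [Function.comp, hg.lt_iff_lt hy' hx']

/-- A list of exactly `m - 1` keys is stored in one node, but this agrees with the recursive form,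
all parts being empty. Thus the recurrences start at `m - 1`, leaving `m - 1` initial values, as
many as the degree of the indicial polynomial. -/
theorem build_eq_node {m : ℕ} (hm : 2 ≤ m) (l : List ℕ) (hl : m - 1 ≤ l.length) :
    MTree.build m l = MTree.node (l.take (m - 1)).toFinset (fun i => MTree.build m (part m i l)) := by
  have hne : l ≠ [] := by rintro rfl; simp at hl; omega
  rw [MTree.build, dif_neg hne]
  split_ifs with h
  · have h1 : l.length = m - 1 := by omega
    have h2 : ∀ i, part m i l = [] := by
      intro i; unfold part; rw [List.drop_of_length_le h1.le]; rfl
    have h3 : l.take (m - 1) = l := List.take_of_length_le h1.le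
    simp only [h2, h3]
    congr
    funext i
    rw [MTree.build, dif_pos rfl]
  · rfl

theorem build_nil (m : ℕ) : MTree.build m [] = MTree.empty := by
  rw [MTree.build, dif_pos rfl]

theorem build_short {m : ℕ} (l : List ℕ) (h0 : l ≠ []) (hl : l.length < m) :
    MTree.build m l = MTree.node l.toFinset (fun _ => MTree.empty) := by
  rw [MTree.build, dif_neg h0, dif_pos (Or.inl hl)]

theorem part_length_lt {m : ℕ} (hm : 2 ≤ m) (i : ℕ) (l : List α) (hl : m - 1 ≤ l.length) :
    (part m i l).length < l.length := by
  refine lt_of_le_of_lt (List.length_filter_le _ _) ?_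
  rw [List.length_drop]
  omega

theorem sum_length_part {m : ℕ} (hm : 2 ≤ m) (l : List α) :
    ∑ i : Fin m, (part m i l).length = l.length - (m - 1) := by
  unfold part
  rw [← List.length_drop]
  generalize l.drop (m - 1) = t
  have hr : ∀ x, ((l.take (m - 1)).filter (fun y => y < x)).length < m := by
    intro x
    have := List.length_filter_le (fun y => decide (y < x)) (l.take (m - 1))
    have h2 := List.length_take_le (m - 1) l
    omega
  induction t with
  | nil => simp
  | cons a t ih =>
    have : ∀ i : Fin m, (List.filter (fun x => decide (((l.take (m - 1)).filter
        (fun y => y < x)).length = (i : ℕ))) (a :: t)).length =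
        (if (⟨_, hr a⟩ : Fin m) = i then 1 else 0) +
        (List.filter (fun x => decide (((l.take (m - 1)).filter
        (fun y => y < x)).length = (i : ℕ))) t).length := by
      intro i
      rw [List.filter_cons]
      by_cases h : ((l.take (m - 1)).filter (fun y => y < a)).length = (i : ℕ)
      · have h' : (⟨_, hr a⟩ : Fin m) = i := Fin.ext h
        simp [h, add_comm]
      · have h' : ¬ (⟨_, hr a⟩ : Fin m) = i := fun e => h (congrArg Fin.val e)
        simp [h, h']
    rw [Finset.sum_congr rfl (fun i _ => this i), Finset.sum_add_distrib, ih]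
    simp [add_comm]

end Parts

/-- A functional of lists depending only on the relative order of the entries. -/
def OrderInv {R : Type*} (f : List ℕ → R) : Prop :=
  ∀ (l : List ℕ) (g : ℕ → ℕ), StrictMonoOn g {x | x ∈ l} → f (l.map g) = f l

/-- The list of values of a permutation. -/
def valueList {n : ℕ} (σ : Equiv.Perm (Fin n)) : List ℕ := List.ofFn (fun i => (σ i : ℕ))

/-- The mean of a list functional over all permutations of `n` elements. -/
noncomputable def permAvg (n : ℕ) (f : List ℕ → ℝ) : ℝ :=
  (∑ σ : Equiv.Perm (Fin n), f (valueList σ)) / n.factorial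

/-! ### The law of the subtree sizes and the independence of the subtrees. -/

section Splitting

theorem valueList_eq {n : ℕ} (σ : Equiv.Perm (Fin n)) :
    valueList σ = (List.ofFn σ).map Fin.val := by
  rw [List.map_ofFn]; rfl

theorem part_valueList {n : ℕ} (m i : ℕ) (σ : Equiv.Perm (Fin n)) :
    part m i (valueList σ) = (part m i (List.ofFn σ)).map Fin.val := by
  rw [valueList_eq, part_map]
  exact (Fin.val_strictMono).strictMonoOn _

/-- Permuting only the entries of `t` runs through all orderings of its entries, and an
order-invariant functional sees just their relative ranks. -/
theorem sum_orderings {n : ℕ} (t : List (Fin n)) (ht : t.Nodup) (f : List ℕ → ℝ)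
    (hf : OrderInv f) :
    ∑ τ : {τ : Equiv.Perm (Fin n) // ∀ x, ¬ x ∈ t → τ x = x}, f ((t.map τ.1).map Fin.val) =
      ∑ π : Equiv.Perm (Fin t.length), f (valueList π) := by
  classical
  have hcard : t.toFinset.card = t.length := List.toFinset_card_of_nodup ht
  -- `e` sends a position to the entry there and `ι` a rank to the entry of that rank, so `E2` turns
  -- a permutation of the entries into the map from position to rank.
  let e : Fin t.length ≃ {x // x ∈ t} := ht.getEquiv t
  let ι0 := t.toFinset.orderIsoOfFin hcard
  let ι : Fin t.length ≃ {x // x ∈ t} := ι0.toEquiv.trans (Equiv.subtypeEquivRight (by simp))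
  let E1 := Equiv.Perm.subtypeEquivSubtypePerm (fun x => x ∈ t)
  let E2 : Equiv.Perm {x // x ∈ t} ≃ Equiv.Perm (Fin t.length) := e.symm.equivCongr ι.symm
  rw [← (E1.sum_comp (fun τ => f ((t.map τ.1).map Fin.val))), ← E2.symm.sum_comp]
  refine Finset.sum_congr rfl fun π _ => ?_
  let g : ℕ → ℕ := fun x => if h : x < t.length then ((ι ⟨x, h⟩).1 : ℕ) else 0
  have hg : StrictMonoOn g {x | x ∈ valueList π} := by
    intro a ha b hb hab
    have hlt : ∀ c ∈ valueList π, c < t.length := by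
      intro c hc
      simp only [valueList, List.mem_ofFn] at hc
      obtain ⟨i, rfl⟩ := hc
      exact (π i).2
    have h1 := hlt a ha
    have h2 := hlt b hb
    simp only [g, h1, h2, dif_pos]
    have : ι0 ⟨a, h1⟩ < ι0 ⟨b, h2⟩ := ι0.strictMono hab
    exact this
  rw [← hf _ g hg]
  congr 1
  apply List.ext_getElem
  · simp [valueList]
  · intro i h1 h2
    have hi : i < t.length := by simpa using h1
    have e1 : e ⟨i, hi⟩ = ⟨t[i], List.getElem_mem hi⟩ := rfl
    have : (E1 (E2.symm π)).1 t[i] = ((ι (π ⟨i, hi⟩)).1) := by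
      have := Equiv.Perm.subtypeEquivSubtypePerm_apply_of_mem (E2.symm π) (List.getElem_mem hi)
      rw [show (E1 (E2.symm π)).1 t[i] = _ from this, ← e1]
      simp [E2, Equiv.equivCongr]
    simp [valueList, g, this]

theorem mem_part_iff {α : Type*} [LinearOrder α] {m i : ℕ} {l : List α} {x : α} :
    x ∈ part m i l ↔ x ∈ l.drop (m - 1) ∧
      ((l.take (m - 1)).filter (fun y => y < x)).length = i := by
  simp [part]

/-- Such a `τ` moves keys only within one gap between the root keys, so the root keys and the gap of
every other key stay the same. -/
theorem part_map_perm {n : ℕ} (m i j : ℕ) (l : List (Fin n)) (hl : l.Nodup)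
    (τ : Equiv.Perm (Fin n)) (hτ : ∀ x, ¬ x ∈ part m i l → τ x = x) :
    part m j (l.map τ) = (part m j l).map τ := by
  have hτ' : ∀ x, x ∈ part m i l → τ x ∈ part m i l := by
    intro x hx
    by_contra h
    have h1 := hτ _ h
    rw [τ.injective h1] at h
    exact h hx
  have htake : (l.take (m - 1)).map τ = l.take (m - 1) := by
    conv_rhs => rw [← List.map_id (l.take (m - 1))]
    apply List.map_congr_left
    intro x hx
    apply hτ
    intro hx'
    have h2 := (mem_part_iff.1 hx').1
    exact (List.disjoint_take_drop hl le_rfl) hx h2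
  conv_lhs => unfold part
  rw [← List.map_take, htake, ← List.map_drop, List.filter_map]
  unfold part
  congr 1
  apply List.filter_congr
  intro x hx
  simp only [Function.comp]
  by_cases h : x ∈ part m i l
  · rw [(mem_part_iff.1 (hτ' x h)).2, (mem_part_iff.1 h).2]
  · rw [hτ x h]

theorem part_map_perm_of_ne {n : ℕ} (m i j : ℕ) (hij : j ≠ i) (l : List (Fin n)) (hl : l.Nodup)
    (τ : Equiv.Perm (Fin n)) (hτ : ∀ x, ¬ x ∈ part m i l → τ x = x) :
    part m j (l.map τ) = part m j l := by
  rw [part_map_perm m i j l hl τ hτ]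
  conv_rhs => rw [← List.map_id (part m j l)]
  apply List.map_congr_left
  intro x hx
  apply hτ
  intro hx'
  exact hij ((mem_part_iff.1 hx).2.symm.trans (mem_part_iff.1 hx').2)

theorem ofFn_mul {n : ℕ} (τ σ : Equiv.Perm (Fin n)) :
    List.ofFn (τ * σ : Equiv.Perm (Fin n)) = (List.ofFn σ).map τ := by
  rw [List.map_ofFn]; rfl

theorem ofFn_nodup {n : ℕ} (σ : Equiv.Perm (Fin n)) : (List.ofFn σ).Nodup :=
  List.nodup_ofFn.2 σ.injective

theorem mem_part_mul_iff {n : ℕ} (m i : ℕ) (σ τ : Equiv.Perm (Fin n))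
    (hτ : ∀ x, ¬ x ∈ part m i (List.ofFn σ) → τ x = x) (x : Fin n) :
    x ∈ part m i (List.ofFn (τ * σ : Equiv.Perm (Fin n))) ↔ x ∈ part m i (List.ofFn σ) := by
  rw [ofFn_mul, part_map_perm m i i _ (ofFn_nodup σ) τ hτ]
  have key : ∀ x, x ∈ part m i (List.ofFn σ) → τ x ∈ part m i (List.ofFn σ) := by
    intro x hx
    by_contra h
    have h1 := hτ _ h
    rw [τ.injective h1] at h
    exact h hx
  constructor
  · intro h
    obtain ⟨y, hy, rfl⟩ := List.mem_map.1 h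
    exact key y hy
  · intro h
    refine List.mem_map.2 ⟨τ.symm x, ?_, by simp⟩
    by_contra h'
    have h1 := hτ _ h'
    rw [Equiv.apply_symm_apply] at h1
    rw [← h1] at h'
    exact h' h

theorem permAvg_one (n : ℕ) : permAvg n (fun _ => 1) = 1 := by
  unfold permAvg
  have : (n.factorial : ℝ) ≠ 0 := by positivity
  simp [Fintype.card_perm, this]

/-- The permutations `τ` supported on the values of part `i` reshuffle that part uniformly while
keeping its size and `Φ`; averaging over them replaces `f` by its mean. -/
theorem sum_replace {n : ℕ} (m i : ℕ) (f : List ℕ → ℝ) (hf : OrderInv f)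
    (Φ : Equiv.Perm (Fin n) → ℝ)
    (hΦ : ∀ σ τ : Equiv.Perm (Fin n), (∀ x, ¬ x ∈ part m i (List.ofFn σ) → τ x = x) →
      Φ (τ * σ) = Φ σ) :
    ∑ σ : Equiv.Perm (Fin n), f (part m i (valueList σ)) * Φ σ =
      ∑ σ : Equiv.Perm (Fin n), permAvg (part m i (List.ofFn σ)).length f * Φ σ := by
  classical
  let k : Equiv.Perm (Fin n) → ℕ := fun σ => (part m i (List.ofFn σ)).length
  let St : Equiv.Perm (Fin n) → Equiv.Perm (Fin n) → Prop :=
    fun σ τ => ∀ x, ¬ x ∈ part m i (List.ofFn σ) → τ x = x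
  have hk : ∀ σ τ, St σ τ → k (τ * σ) = k σ := by
    intro σ τ h
    simp only [k]
    rw [ofFn_mul, part_map_perm m i i _ (ofFn_nodup σ) τ h, List.length_map]
  have hsum : ∀ (σ : Equiv.Perm (Fin n)) (g : List ℕ → ℝ), OrderInv g →
      ∑ τ : Equiv.Perm (Fin n), (if St σ τ then
        g (((part m i (List.ofFn σ)).map τ).map Fin.val) / (k σ).factorial else 0) =
      permAvg (k σ) g := by
    intro σ g hg
    unfold permAvg
    rw [← sum_orderings _ ((part_sublist m i _).nodup (ofFn_nodup σ)) g hg, Finset.sum_div,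
      ← Finset.sum_filter]
    exact (Finset.sum_subtype (p := St σ) (Finset.univ.filter (St σ)) (by simp)
      (fun τ => g (((part m i (List.ofFn σ)).map τ).map Fin.val) / (k σ).factorial))
  have h1 : ∀ σ, ∑ τ : Equiv.Perm (Fin n), (if St σ τ then
      (1 : ℝ) / (k σ).factorial else 0) = 1 := by
    intro σ
    rw [hsum σ (fun _ => 1) (fun _ _ _ => rfl), permAvg_one]
  calc ∑ σ : Equiv.Perm (Fin n), f (part m i (valueList σ)) * Φ σ
      = ∑ σ : Equiv.Perm (Fin n), ∑ τ : Equiv.Perm (Fin n), (if St σ τ then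
        f (part m i (valueList σ)) * Φ σ * (1 / (k σ).factorial) else 0) := by
        refine Finset.sum_congr rfl fun σ _ => ?_
        conv_lhs => rw [← mul_one (f (part m i (valueList σ)) * Φ σ), ← h1 σ, Finset.mul_sum]
        refine Finset.sum_congr rfl fun τ _ => ?_
        split_ifs <;> simp
    _ = ∑ σ : Equiv.Perm (Fin n), ∑ τ : Equiv.Perm (Fin n), (if St σ τ then
        f (part m i (valueList (τ * σ))) * Φ (τ * σ) * (1 / (k (τ * σ)).factorial) else 0) := by
        rw [← Finset.sum_product', ← Finset.sum_product', ← Finset.sum_filter,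
          ← Finset.sum_filter]
        -- The map (σ, τ) ↦ (τσ, τ⁻¹) is an involution of the admissible pairs, because σ and τσ
        -- have the same set of values in part `i`.
        have hinv : ∀ p : Equiv.Perm (Fin n) × Equiv.Perm (Fin n), St p.1 p.2 →
            St (p.2 * p.1) p.2⁻¹ := by
          intro p hp x hx
          rw [mem_part_mul_iff m i p.1 p.2 hp] at hx
          have := hp x hx
          rw [Equiv.Perm.inv_eq_iff_eq, this]
        refine Finset.sum_bij' (fun p _ => (p.2 * p.1, p.2⁻¹)) (fun p _ => (p.2 * p.1, p.2⁻¹))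
          ?_ ?_ ?_ ?_ ?_
        · intro p hp
          simp only [Finset.mem_filter, Finset.mem_product, Finset.mem_univ, true_and] at hp ⊢
          exact hinv p hp
        · intro p hp
          simp only [Finset.mem_filter, Finset.mem_product, Finset.mem_univ, true_and] at hp ⊢
          exact hinv p hp
        · intro p _; simp
        · intro p _; simp
        · intro p _; simp
    _ = ∑ σ : Equiv.Perm (Fin n), permAvg (k σ) f * Φ σ := by
        refine Finset.sum_congr rfl fun σ _ => ?_
        rw [← hsum σ f hf, Finset.sum_mul]
        refine Finset.sum_congr rfl fun τ _ => ?_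
        split_ifs with h
        · rw [hk σ τ h, hΦ σ τ h, part_valueList, ofFn_mul,
            part_map_perm m i i _ (ofFn_nodup σ) τ h]
          ring
        · simp

/-- Given the subtree sizes, the subtrees are independent and uniformly distributed. -/
theorem sum_prod_part {n : ℕ} (m : ℕ) (f : Fin m → List ℕ → ℝ) (hf : ∀ i, OrderInv (f i)) :
    ∑ σ : Equiv.Perm (Fin n), ∏ i, f i (part m i (valueList σ)) =
      ∑ σ : Equiv.Perm (Fin n), ∏ i : Fin m, permAvg (part m i (List.ofFn σ)).length (f i) := by
  classical
  -- The subtrees are averaged one at a time; `s` is the set of those already replaced by their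
  -- mean.
  have key : ∀ s : Finset (Fin m),
      ∑ σ : Equiv.Perm (Fin n), ∏ i, f i (part m i (valueList σ)) =
      ∑ σ : Equiv.Perm (Fin n), ∏ i, (if i ∈ s then permAvg (part m i (List.ofFn σ)).length (f i)
        else f i (part m i (valueList σ))) := by
    intro s
    induction s using Finset.induction_on with
    | empty => simp
    | insert a s ha ih =>
      rw [ih]
      have e1 : ∀ σ : Equiv.Perm (Fin n),
          ∏ i, (if i ∈ s then permAvg (part m i (List.ofFn σ)).length (f i)
            else f i (part m i (valueList σ))) =
          f a (part m a (valueList σ)) * ∏ i ∈ Finset.univ.erase a,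
            (if i ∈ s then permAvg (part m i (List.ofFn σ)).length (f i)
            else f i (part m i (valueList σ))) := by
        intro σ
        rw [← Finset.mul_prod_erase _ _ (Finset.mem_univ a), if_neg ha]
      have e2 : ∀ σ : Equiv.Perm (Fin n),
          ∏ i, (if i ∈ insert a s then permAvg (part m i (List.ofFn σ)).length (f i)
            else f i (part m i (valueList σ))) =
          permAvg (part m a (List.ofFn σ)).length (f a) * ∏ i ∈ Finset.univ.erase a,
            (if i ∈ s then permAvg (part m i (List.ofFn σ)).length (f i)
            else f i (part m i (valueList σ))) := by
        intro σ
        rw [← Finset.mul_prod_erase _ _ (Finset.mem_univ a), if_pos (Finset.mem_insert_self a s)]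
        congr 1
        refine Finset.prod_congr rfl fun i hi => ?_
        have hia : i ≠ a := Finset.ne_of_mem_erase hi
        simp [Finset.mem_insert, hia]
      simp only [e1, e2]
      apply sum_replace m a (f a) (hf a)
      intro σ τ hτ
      refine Finset.prod_congr rfl fun i hi => ?_
      have hia : (i : ℕ) ≠ a := fun h => Finset.ne_of_mem_erase hi (Fin.ext h)
      rw [part_valueList, part_valueList, ofFn_mul,
        part_map_perm_of_ne m a i hia _ (ofFn_nodup σ) τ hτ]
  rw [key Finset.univ]
  simp

/-- The set of root keys. -/
def rootSet {n : ℕ} (r : ℕ) (σ : Equiv.Perm (Fin n)) : Finset (Fin n) :=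
  ((List.ofFn σ).take r).toFinset

theorem card_rootSet {n r : ℕ} (hr : r ≤ n) (σ : Equiv.Perm (Fin n)) :
    (rootSet r σ).card = r := by
  rw [rootSet, List.toFinset_card_of_nodup ((List.take_sublist _ _).nodup (ofFn_nodup σ))]
  simp [hr]

theorem rootSet_mul {n r : ℕ} (τ σ : Equiv.Perm (Fin n)) :
    rootSet r (τ * σ) = (rootSet r σ).image τ := by
  ext x
  unfold rootSet
  rw [ofFn_mul, ← List.map_take]
  simp only [List.mem_toFinset, List.mem_map, Finset.mem_image]

/-- The number of elements outside of `R` lying above exactly `j` elements of `R`. -/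
def gapSize {n : ℕ} (R : Finset (Fin n)) (j : ℕ) : ℕ :=
  (Finset.univ.filter (fun x => x ∉ R ∧ (R.filter (fun y => y < x)).card = j)).card

theorem length_part_eq_gapSize {n : ℕ} (m j : ℕ) (σ : Equiv.Perm (Fin n)) :
    (part m j (List.ofFn σ)).length = gapSize (rootSet (m - 1) σ) j := by
  rw [← List.toFinset_card_of_nodup ((part_sublist m j _).nodup (ofFn_nodup σ)), gapSize]
  congr 1
  ext x
  have hnd := (List.take_sublist (m - 1) _).nodup (ofFn_nodup σ)
  have h1 : ((rootSet (m - 1) σ).filter (fun y => y < x)).card =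
      (((List.ofFn σ).take (m - 1)).filter (fun y => y < x)).length := by
    rw [← List.toFinset_card_of_nodup (hnd.filter _), rootSet, List.toFinset_filter]
    congr 1
    ext; simp
  have h2 : x ∈ (List.ofFn σ).drop (m - 1) ↔ x ∉ rootSet (m - 1) σ := by
    have hx : x ∈ (List.ofFn σ).take (m - 1) ++ (List.ofFn σ).drop (m - 1) := by
      rw [List.take_append_drop, List.mem_ofFn]
      exact ⟨σ.symm x, by simp⟩
    rw [rootSet, List.mem_toFinset]
    constructor
    · intro h h'
      exact (List.disjoint_take_drop (ofFn_nodup σ) le_rfl) h' h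
    · intro h
      exact (List.mem_append.1 hx).resolve_left h
  simp only [List.mem_toFinset, mem_part_iff, Finset.mem_filter, Finset.mem_univ, true_and,
    h1, h2]

/-- Left multiplication acts transitively on the `r`-subsets, so all fibres of `rootSet r` have the
same size and the root set is uniform. -/
theorem sum_rootSet {n r : ℕ} (hr : r ≤ n) (G : Finset (Fin n) → ℝ) :
    (∑ σ : Equiv.Perm (Fin n), G (rootSet r σ)) / n.factorial =
      (∑ R ∈ Finset.powersetCard r (Finset.univ : Finset (Fin n)), G R) / n.choose r := by
  classical
  have hmaps : ∀ σ ∈ (Finset.univ : Finset (Equiv.Perm (Fin n))),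
      rootSet r σ ∈ Finset.powersetCard r (Finset.univ : Finset (Fin n)) := by
    intro σ _
    rw [Finset.mem_powersetCard]
    exact ⟨Finset.subset_univ _, card_rootSet hr σ⟩
  let fib : Finset (Fin n) → Finset (Equiv.Perm (Fin n)) :=
    fun R => Finset.univ.filter (fun σ => rootSet r σ = R)
  let K := (fib (rootSet r 1)).card
  have hK : ∀ R ∈ Finset.powersetCard r (Finset.univ : Finset (Fin n)), (fib R).card = K := by
    intro R hR
    have hc : (rootSet r (1 : Equiv.Perm (Fin n))).card = R.card := by
      rw [card_rootSet hr, (Finset.mem_powersetCard.1 hR).2]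
    obtain ⟨τ, himg⟩ : ∃ τ : Equiv.Perm (Fin n),
        (rootSet r (1 : Equiv.Perm (Fin n))).image τ = R := by
      let e : {x // x ∈ rootSet r (1 : Equiv.Perm (Fin n))} ≃ {x // x ∈ R} :=
        Finset.equivOfCardEq hc
      refine ⟨e.extendSubtype, ?_⟩
      apply Finset.eq_of_subset_of_card_le
      · intro x hx
        obtain ⟨y, hy, rfl⟩ := Finset.mem_image.1 hx
        exact e.extendSubtype_mem y hy
      · rw [Finset.card_image_of_injective _ (Equiv.injective _), hc]
    symm
    apply Finset.card_bij' (fun σ _ => τ * σ) (fun σ _ => τ⁻¹ * σ)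
    · intro σ hσ
      simp only [fib, Finset.mem_filter, Finset.mem_univ, true_and] at hσ ⊢
      rw [rootSet_mul, hσ, himg]
    · intro σ hσ
      simp only [fib, Finset.mem_filter, Finset.mem_univ, true_and] at hσ ⊢
      rw [rootSet_mul, hσ, ← himg, Finset.image_image]
      rw [show (τ⁻¹ : Equiv.Perm (Fin n)) ∘ τ = id by ext x; simp, Finset.image_id]
    · intro σ _; simp
    · intro σ _; simp
  have hsum : ∀ H : Finset (Fin n) → ℝ, ∑ σ : Equiv.Perm (Fin n), H (rootSet r σ) =
      K * ∑ R ∈ Finset.powersetCard r (Finset.univ : Finset (Fin n)), H R := by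
    intro H
    rw [← Finset.sum_fiberwise_of_maps_to hmaps, Finset.mul_sum]
    refine Finset.sum_congr rfl fun R hR => ?_
    rw [Finset.sum_congr rfl (g := fun _ => H R)
      (fun σ hσ => by rw [(Finset.mem_filter.1 hσ).2])]
    rw [Finset.sum_const, nsmul_eq_mul, ← hK R hR]
  have h1 := hsum (fun _ => 1)
  simp only [Finset.sum_const, Finset.card_univ, Fintype.card_perm, Fintype.card_fin,
    nsmul_eq_mul, mul_one, Finset.card_powersetCard] at h1
  have hpos : (n.factorial : ℝ) ≠ 0 := by positivity
  have hch : (n.choose r : ℝ) ≠ 0 := by exact_mod_cast (Nat.choose_pos hr).ne'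
  rw [hsum G, div_eq_div_iff hpos hch, h1]
  ring

theorem sum_gapSize {n m : ℕ} (hm : 2 ≤ m) (R : Finset (Fin n)) (hR : R.card = m - 1) :
    ∑ j : Fin m, gapSize R j = n - (m - 1) := by
  classical
  unfold gapSize
  have hlt : ∀ x, (R.filter (fun y => y < x)).card < m := by
    intro x
    have := Finset.card_filter_le R (fun y => y < x)
    omega
  have h1 : Rᶜ.card = n - (m - 1) := by rw [Finset.card_compl, hR, Fintype.card_fin]
  rw [← h1, Finset.card_eq_sum_card_fiberwise (s := Rᶜ) (t := Finset.univ)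
    (f := fun x => (⟨_, hlt x⟩ : Fin m)) (fun _ _ => Finset.mem_univ _)]
  refine Finset.sum_congr rfl fun j _ => ?_
  congr 1
  ext x
  simp [Fin.ext_iff]

/-- The root key of rank `k` has below it `k` root keys and the elements of the gaps `0, …, k`.
Hence a subset can be recovered from its gap sizes. -/
theorem mem_iff_gapSize {n m : ℕ} (R : Finset (Fin n)) (hR : R.card = m - 1) (x : Fin n) :
    x ∈ R ↔ ∃ k < m - 1, (x : ℕ) = k + ∑ j ∈ Finset.range (k + 1), gapSize R j := by
  classical
  have key : ∀ z ∈ R, (z : ℕ) = (R.filter (fun y => y < z)).card +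
      ∑ j ∈ Finset.range ((R.filter (fun y => y < z)).card + 1), gapSize R j := by
    intro z hz
    set k := (R.filter (fun y => y < z)).card with hk
    have h1 : (Finset.Iio z).card = (z : ℕ) := by simp
    have h2 : Finset.Iio z = R.filter (fun y => y < z) ∪
        Finset.univ.filter (fun y => y ∉ R ∧ (R.filter (fun w => w < y)).card < k + 1) := by
      ext y
      simp only [Finset.mem_Iio, Finset.mem_union, Finset.mem_filter, Finset.mem_univ, true_and]
      constructor
      · intro hy
        by_cases hyR : y ∈ R
        · exact Or.inl ⟨hyR, hy⟩
        · refine Or.inr ⟨hyR, Nat.lt_succ_of_le ?_⟩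
          apply Finset.card_le_card
          intro w hw
          rw [Finset.mem_filter] at hw ⊢
          exact ⟨hw.1, hw.2.trans hy⟩
      · rintro (⟨_, hy⟩ | ⟨hyR, hy⟩)
        · exact hy
        · by_contra hzy
          have hzy' : z < y := lt_of_le_of_ne (not_lt.1 hzy) (fun e => hyR (e ▸ hz))
          have : k + 1 ≤ (R.filter (fun w => w < y)).card := by
            rw [hk, ← Finset.card_insert_of_notMem
              (show z ∉ R.filter (fun y => y < z) by simp)]
            apply Finset.card_le_card
            intro w hw
            rw [Finset.mem_insert, Finset.mem_filter] at hw
            rw [Finset.mem_filter]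
            rcases hw with rfl | hw
            · exact ⟨hz, hzy'⟩
            · exact ⟨hw.1, hw.2.trans hzy'⟩
          omega
    have h3 : (Finset.univ.filter (fun y => y ∉ R ∧
        (R.filter (fun w => w < y)).card < k + 1)).card =
        ∑ j ∈ Finset.range (k + 1), gapSize R j := by
      rw [Finset.card_eq_sum_card_fiberwise (t := Finset.range (k + 1))
        (f := fun y => (R.filter (fun w => w < y)).card)]
      · refine Finset.sum_congr rfl fun j hj => ?_
        unfold gapSize
        congr 1
        ext y
        simp only [Finset.mem_filter, Finset.mem_univ, true_and, Finset.mem_range] at hj ⊢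
        constructor
        · rintro ⟨⟨a, _⟩, c⟩; exact ⟨a, c⟩
        · rintro ⟨a, c⟩; exact ⟨⟨a, c ▸ hj⟩, c⟩
      · intro y hy
        simpa using (Finset.mem_filter.1 hy).2.2
    rw [← h1, h2, Finset.card_union_of_disjoint, ← hk, h3]
    rw [Finset.disjoint_left]
    intro y hy hy'
    exact (Finset.mem_filter.1 hy').2.1 (Finset.mem_filter.1 hy).1
  have hrk : ∀ z ∈ R, (R.filter (fun y => y < z)).card < m - 1 := by
    intro z hz
    rw [← hR]
    apply Finset.card_lt_card
    rw [Finset.ssubset_iff_of_subset (Finset.filter_subset _ _)]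
    exact ⟨z, hz, by simp⟩
  constructor
  · intro hx
    exact ⟨_, hrk x hx, key x hx⟩
  · rintro ⟨k, hk, hxk⟩
    let z := R.orderEmbOfFin hR ⟨k, hk⟩
    have hz : z ∈ R := Finset.orderEmbOfFin_mem _ _ _
    have hcard : (R.filter (fun y => y < z)).card = k := by
      have : R.filter (fun y => y < z) =
          (Finset.univ.filter (fun i : Fin (m - 1) => i < ⟨k, hk⟩)).map
            (R.orderEmbOfFin hR).toEmbedding := by
        ext y
        simp only [Finset.mem_filter, Finset.mem_map, Finset.mem_univ, true_and,
          RelEmbedding.coe_toEmbedding]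
        constructor
        · rintro ⟨hy, hyz⟩
          have : y ∈ Set.range (R.orderEmbOfFin hR) := by
            rw [Finset.range_orderEmbOfFin]; exact hy
          obtain ⟨i, rfl⟩ := this
          exact ⟨i, (R.orderEmbOfFin hR).lt_iff_lt.1 hyz, rfl⟩
        · rintro ⟨i, hi, rfl⟩
          exact ⟨Finset.orderEmbOfFin_mem _ _ _, (R.orderEmbOfFin hR).lt_iff_lt.2 hi⟩
      rw [this, Finset.card_map]
      have h4 : (Finset.univ.filter (fun i : Fin (m - 1) => i < ⟨k, hk⟩)) =
          Finset.Iio ⟨k, hk⟩ := by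
        ext i; simp only [Finset.mem_filter, Finset.mem_univ, true_and, Finset.mem_Iio]
      rw [h4, Fin.card_Iio]
    have := key z hz
    rw [hcard, ← hxk] at this
    rw [← Fin.ext this]
    exact hz

/-- The average over all compositions of `n - (m - 1)` into `m` nonnegative parts. -/
noncomputable def compAvg {𝕜 : Type*} [Field 𝕜] (m n : ℕ) (F : (Fin m → ℕ) → 𝕜) : 𝕜 :=
  (∑ c ∈ Finset.piAntidiag Finset.univ (n - (m - 1)), F c) / n.choose (m - 1)

theorem card_piAntidiag_univ (m k : ℕ) :
    (Finset.piAntidiag (Finset.univ : Finset (Fin m)) k).card = m.multichoose k := by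
  classical
  rw [← Finset.map_sym_eq_piAntidiag, Finset.card_map, Finset.sym_univ, Finset.card_univ,
    Sym.card_sym_fin_eq_multichoose]

theorem card_comp {m n : ℕ} (hm : 2 ≤ m) (hn : m - 1 ≤ n) :
    (Finset.piAntidiag (Finset.univ : Finset (Fin m)) (n - (m - 1))).card =
      n.choose (m - 1) := by
  rw [card_piAntidiag_univ, Nat.multichoose_eq, ← Nat.choose_symm hn]
  congr 1
  omega

/-- The gap sizes determine the root set, and there are as many compositions as root sets, so the
correspondence is bijective. -/
theorem sum_gapSize_eq {m n : ℕ} (hm : 2 ≤ m) (hn : m - 1 ≤ n) (F : (Fin m → ℕ) → ℝ) :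
    ∑ R ∈ Finset.powersetCard (m - 1) (Finset.univ : Finset (Fin n)), F (fun j => gapSize R j) =
      ∑ c ∈ Finset.piAntidiag Finset.univ (n - (m - 1)), F c := by
  classical
  have hinj : Set.InjOn (fun R : Finset (Fin n) => (fun j : Fin m => gapSize R j))
      (Finset.powersetCard (m - 1) (Finset.univ : Finset (Fin n))) := by
    intro R hR R' hR' h
    have h1 := (Finset.mem_powersetCard.1 hR).2
    have h2 := (Finset.mem_powersetCard.1 hR').2
    ext x
    rw [mem_iff_gapSize R h1, mem_iff_gapSize R' h2]
    have : ∀ k < m - 1, ∑ j ∈ Finset.range (k + 1), gapSize R j =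
        ∑ j ∈ Finset.range (k + 1), gapSize R' j := by
      intro k hk
      refine Finset.sum_congr rfl fun j hj => ?_
      have hj' : j < m := by have := Finset.mem_range.1 hj; omega
      exact congrFun h ⟨j, hj'⟩
    constructor
    · rintro ⟨k, hk, e⟩; exact ⟨k, hk, by rw [e, this k hk]⟩
    · rintro ⟨k, hk, e⟩; exact ⟨k, hk, by rw [e, this k hk]⟩
  have himg : (Finset.powersetCard (m - 1) (Finset.univ : Finset (Fin n))).image
      (fun R : Finset (Fin n) => (fun j : Fin m => gapSize R j)) =
      Finset.piAntidiag Finset.univ (n - (m - 1)) := by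
    apply Finset.eq_of_subset_of_card_le
    · intro c hc
      obtain ⟨R, hR, rfl⟩ := Finset.mem_image.1 hc
      rw [Finset.mem_piAntidiag]
      exact ⟨sum_gapSize hm R (Finset.mem_powersetCard.1 hR).2, by simp⟩
    · rw [Finset.card_image_of_injOn hinj, card_comp hm hn, Finset.card_powersetCard]
      simp
  rw [← himg, Finset.sum_image hinj]

/-- This is the only probabilistic input: every recurrence for means and covariances below is
obtained by choosing the factors. -/
theorem permAvg_prod_part {m n : ℕ} (hm : 2 ≤ m) (hn : m - 1 ≤ n) (f : Fin m → List ℕ → ℝ)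
    (hf : ∀ i, OrderInv (f i)) :
    permAvg n (fun l => ∏ i : Fin m, f i (part m i l)) =
      compAvg m n (fun c => ∏ i, permAvg (c i) (f i)) := by
  unfold permAvg compAvg
  rw [sum_prod_part m f hf]
  simp only [length_part_eq_gapSize]
  rw [sum_rootSet hn (fun R => ∏ i : Fin m, permAvg (gapSize R i) (f i)),
    sum_gapSize_eq hm hn (fun c => ∏ i, permAvg (c i) (f i))]
  rfl

end Splitting

/-! ### Recursions for the number of nodes and the two path lengths. -/

section Functionals

/-- The number of nodes of the tree built from a list. -/
noncomputable def sizeFun (m : ℕ) (l : List ℕ) : ℝ := ((MTree.build m l).numNodes : ℝ)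

/-- The key path length of the tree built from a list. -/
noncomputable def keyFun (m : ℕ) (l : List ℕ) : ℝ := ((MTree.build m l).keyDepthSum 0 : ℝ)

/-- The node path length of the tree built from a list. -/
noncomputable def nodeFun (m : ℕ) (l : List ℕ) : ℝ := ((MTree.build m l).nodeDepthSum 0 : ℝ)

theorem nodeDepthSum_eq {m : ℕ} (t : MTree m) (d : ℕ) :
    t.nodeDepthSum d = t.nodeDepthSum 0 + d * t.numNodes := by
  induction t generalizing d with
  | empty => simp [MTree.nodeDepthSum, MTree.numNodes]
  | node keys c ih =>
    simp only [MTree.nodeDepthSum, MTree.numNodes]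
    rw [Finset.sum_congr rfl (fun i _ => ih i (d + 1)),
      Finset.sum_congr rfl (fun i _ => ih i (0 + 1)), Finset.sum_add_distrib,
      Finset.sum_add_distrib, ← Finset.mul_sum, ← Finset.mul_sum]
    ring

/-- Distinctness matters because nodes store finite sets: only then does every list entry count as
one key. -/
theorem keyDepthSum_build {m : ℕ} (hm : 2 ≤ m) (l : List ℕ) (hl : l.Nodup) (d : ℕ) :
    (MTree.build m l).keyDepthSum d = (MTree.build m l).keyDepthSum 0 + d * l.length := by
  induction hn : l.length using Nat.strong_induction_on generalizing l d with
  | _ n ih =>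
    subst hn
    rcases Nat.lt_or_ge l.length (m - 1) with h | h
    · by_cases h0 : l = []
      · subst h0; simp [build_nil, MTree.keyDepthSum]
      · rw [build_short l h0 (by omega)]
        simp [MTree.keyDepthSum, List.toFinset_card_of_nodup hl]
    · rw [build_eq_node hm l h]
      simp only [MTree.keyDepthSum]
      have h1 : ∀ (i : Fin m) (e : ℕ), (MTree.build m (part m i l)).keyDepthSum (e + 1) =
          (MTree.build m (part m i l)).keyDepthSum 0 + (e + 1) * (part m i l).length :=
        fun i e => ih _ (part_length_lt hm i l h) _ ((part_sublist m i l).nodup hl) _ rfl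
      rw [Finset.sum_congr rfl (fun i _ => h1 i d), Finset.sum_congr rfl (fun i _ => h1 i 0),
        Finset.sum_add_distrib, Finset.sum_add_distrib, ← Finset.mul_sum, ← Finset.mul_sum,
        sum_length_part hm, List.toFinset_card_of_nodup ((List.take_sublist _ _).nodup hl),
        List.length_take, min_eq_left h]
      obtain ⟨k, hk⟩ := Nat.exists_eq_add_of_le h
      rw [hk, Nat.add_sub_cancel_left]
      ring

theorem orderInv_tree {m : ℕ} (hm : 2 ≤ m) (l : List ℕ) (g : ℕ → ℕ)
    (hg : StrictMonoOn g {x | x ∈ l}) (d : ℕ) :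
    (MTree.build m (l.map g)).numNodes = (MTree.build m l).numNodes ∧
    (MTree.build m (l.map g)).keyDepthSum d = (MTree.build m l).keyDepthSum d ∧
    (MTree.build m (l.map g)).nodeDepthSum d = (MTree.build m l).nodeDepthSum d := by
  have hcard : ∀ t : List ℕ, (∀ x ∈ t, x ∈ l) →
      (t.map g).toFinset.card = t.toFinset.card := by
    intro t ht
    have : (t.map g).toFinset = t.toFinset.image g := by ext; simp
    rw [this, Finset.card_image_of_injOn]
    intro a ha b hb
    exact hg.injOn (ht a (by simpa using ha)) (ht b (by simpa using hb))
  induction hn : l.length using Nat.strong_induction_on generalizing l d with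
  | _ n ih =>
    subst hn
    rcases Nat.lt_or_ge l.length (m - 1) with h | h
    · by_cases h0 : l = []
      · subst h0; simp
      · rw [build_short l h0 (by omega), build_short (l.map g) (by simpa using h0)
          (by rw [List.length_map]; omega)]
        simp [MTree.keyDepthSum, MTree.numNodes, MTree.nodeDepthSum, hcard l (fun _ h => h)]
    · rw [build_eq_node hm l h, build_eq_node hm (l.map g) (by rwa [List.length_map])]
      have hsub : ∀ i : Fin m, ∀ x ∈ part m i l, x ∈ l :=
        fun i x hx => (part_sublist m i l).subset hx
      have h1 : ∀ (i : Fin m) (e : ℕ), _ := fun i e =>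
        ih _ (part_length_lt hm i l h) (part m i l)
          (hg.mono (fun x hx => hsub i x hx)) e
          (fun t ht => hcard t (fun x hx => hsub i x (ht x hx))) rfl
      simp only [MTree.keyDepthSum, MTree.numNodes, MTree.nodeDepthSum, part_map m _ l g hg]
      refine ⟨?_, ?_, ?_⟩
      · rw [Finset.sum_congr rfl (fun i _ => (h1 i 0).1)]
      · rw [Finset.sum_congr rfl (fun i _ => (h1 i (d + 1)).2.1), ← List.map_take,
          hcard _ (fun x hx => List.mem_of_mem_take hx)]
      · rw [Finset.sum_congr rfl (fun i _ => (h1 i (d + 1)).2.2)]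

theorem orderInv_sizeFun {m : ℕ} (hm : 2 ≤ m) : OrderInv (sizeFun m) := fun l g hg => by
  unfold sizeFun; rw [(orderInv_tree hm l g hg 0).1]

theorem orderInv_keyFun {m : ℕ} (hm : 2 ≤ m) : OrderInv (keyFun m) := fun l g hg => by
  unfold keyFun; rw [(orderInv_tree hm l g hg 0).2.1]

theorem orderInv_nodeFun {m : ℕ} (hm : 2 ≤ m) : OrderInv (nodeFun m) := fun l g hg => by
  unfold nodeFun; rw [(orderInv_tree hm l g hg 0).2.2]

theorem orderInv_length : OrderInv (fun l => (l.length : ℝ)) := fun l g _ => by simp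

theorem OrderInv.comp₂ {R : Type*} {f g : List ℕ → R} (hf : OrderInv f) (hg : OrderInv g)
    (op : R → R → R) : OrderInv (fun l => op (f l) (g l)) := fun l e he => by
  simp only [hf l e he, hg l e he]

theorem sizeFun_nil (m : ℕ) : sizeFun m [] = 0 := by simp [sizeFun, build_nil, MTree.numNodes]

theorem sizeFun_short {m : ℕ} (l : List ℕ) (h0 : l ≠ []) (hl : l.length < m) :
    sizeFun m l = 1 := by
  simp [sizeFun, build_short l h0 hl, MTree.numNodes]

theorem sizeFun_rec {m : ℕ} (hm : 2 ≤ m) (l : List ℕ) (hl : m - 1 ≤ l.length) :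
    sizeFun m l = 1 + ∑ i : Fin m, sizeFun m (part m i l) := by
  simp [sizeFun, build_eq_node hm l hl, MTree.numNodes]

theorem keyFun_rec {m : ℕ} (hm : 2 ≤ m) (l : List ℕ) (hl : m - 1 ≤ l.length) (hd : l.Nodup) :
    keyFun m l = ((l.length - (m - 1) : ℕ) : ℝ) + ∑ i : Fin m, keyFun m (part m i l) := by
  unfold keyFun
  rw [build_eq_node hm l hl]
  simp only [MTree.keyDepthSum]
  rw [Finset.sum_congr rfl
    (fun (i : Fin m) _ => keyDepthSum_build hm (part m i l) ((part_sublist m i l).nodup hd) (0 + 1)),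
    Finset.sum_add_distrib, ← Finset.mul_sum, sum_length_part hm]
  push_cast
  ring

theorem nodeFun_rec {m : ℕ} (hm : 2 ≤ m) (l : List ℕ) (hl : m - 1 ≤ l.length) :
    nodeFun m l = ∑ i : Fin m, (nodeFun m (part m i l) + sizeFun m (part m i l)) := by
  unfold nodeFun sizeFun
  rw [build_eq_node hm l hl]
  simp only [MTree.nodeDepthSum]
  rw [Finset.sum_congr rfl (fun (i : Fin m) _ => nodeDepthSum_eq _ (0 + 1))]
  push_cast
  simp

end Functionals

/-! ### Means and covariances under a uniform permutation. -/

section Moments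

theorem permAvg_add (n : ℕ) (f g : List ℕ → ℝ) :
    permAvg n (fun l => f l + g l) = permAvg n f + permAvg n g := by
  simp [permAvg, Finset.sum_add_distrib, add_div]

theorem permAvg_const_mul (n : ℕ) (c : ℝ) (f : List ℕ → ℝ) :
    permAvg n (fun l => c * f l) = c * permAvg n f := by
  simp [permAvg, ← Finset.mul_sum, mul_div_assoc]

theorem permAvg_sub (n : ℕ) (f g : List ℕ → ℝ) :
    permAvg n (fun l => f l - g l) = permAvg n f - permAvg n g := by
  simp [permAvg, Finset.sum_sub_distrib, sub_div]

theorem permAvg_const (n : ℕ) (c : ℝ) : permAvg n (fun _ => c) = c := by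
  have h := permAvg_const_mul n c (fun _ => 1)
  simpa [permAvg_one] using h

theorem permAvg_sum {ι : Type*} (s : Finset ι) (n : ℕ) (f : ι → List ℕ → ℝ) :
    permAvg n (fun l => ∑ i ∈ s, f i l) = ∑ i ∈ s, permAvg n (f i) := by
  simp only [permAvg]
  rw [Finset.sum_comm, Finset.sum_div]

theorem permAvg_congr {n : ℕ} {f g : List ℕ → ℝ}
    (h : ∀ σ : Equiv.Perm (Fin n), f (valueList σ) = g (valueList σ)) :
    permAvg n f = permAvg n g := by
  unfold permAvg
  rw [Finset.sum_congr rfl (fun σ _ => h σ)]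

theorem valueList_length {n : ℕ} (σ : Equiv.Perm (Fin n)) : (valueList σ).length = n := by
  simp [valueList]

theorem valueList_nodup {n : ℕ} (σ : Equiv.Perm (Fin n)) : (valueList σ).Nodup := by
  rw [valueList_eq]
  exact (ofFn_nodup σ).map Fin.val_injective

theorem permAvg_length (n : ℕ) : permAvg n (fun l => (l.length : ℝ)) = n := by
  rw [permAvg_congr (g := fun _ => (n : ℝ)) (fun σ => by rw [valueList_length]), permAvg_const]

/-- Covariance of two list functionals under a uniform permutation of `n` elements. -/
noncomputable def permCov (n : ℕ) (f g : List ℕ → ℝ) : ℝ :=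
  permAvg n (fun l => f l * g l) - permAvg n f * permAvg n g

section CompAvg

variable {𝕜 : Type*} [Field 𝕜]

theorem compAvg_add (m n : ℕ) (F G : (Fin m → ℕ) → 𝕜) :
    compAvg m n (fun c => F c + G c) = compAvg m n F + compAvg m n G := by
  simp [compAvg, Finset.sum_add_distrib, add_div]

theorem compAvg_sub (m n : ℕ) (F G : (Fin m → ℕ) → 𝕜) :
    compAvg m n (fun c => F c - G c) = compAvg m n F - compAvg m n G := by
  simp [compAvg, Finset.sum_sub_distrib, sub_div]

theorem compAvg_const_mul (m n : ℕ) (a : 𝕜) (F : (Fin m → ℕ) → 𝕜) :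
    compAvg m n (fun c => a * F c) = a * compAvg m n F := by
  simp [compAvg, ← Finset.mul_sum, mul_div_assoc]

theorem compAvg_sum {ι : Type*} (s : Finset ι) (m n : ℕ) (F : ι → (Fin m → ℕ) → 𝕜) :
    compAvg m n (fun c => ∑ i ∈ s, F i c) = ∑ i ∈ s, compAvg m n (F i) := by
  simp only [compAvg]
  rw [Finset.sum_comm, Finset.sum_div]

theorem compAvg_const [CharZero 𝕜] {m n : ℕ} (hm : 2 ≤ m) (hn : m - 1 ≤ n) (a : 𝕜) :
    compAvg m n (fun _ => a) = a := by
  have : (n.choose (m - 1) : 𝕜) ≠ 0 := by exact_mod_cast (Nat.choose_pos hn).ne'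
  simp [compAvg, card_comp hm hn, this]

/-- The mean of `∑ j, x (c j)` over all compositions `c`. -/
noncomputable def compMean (m n : ℕ) (x : ℕ → 𝕜) : 𝕜 :=
  compAvg m n (fun c => ∑ i, x (c i))

/-- The covariance of `∑ j, x (c j)` and `∑ j, y (c j)` over all compositions `c`. -/
noncomputable def tollCov (m n : ℕ) (x y : ℕ → 𝕜) : 𝕜 :=
  compAvg m n (fun c => (∑ i, x (c i)) * ∑ i, y (c i)) - compMean m n x * compMean m n y

end CompAvg

theorem permAvg_part {m n : ℕ} (hm : 2 ≤ m) (hn : m - 1 ≤ n) (f : List ℕ → ℝ)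
    (hf : OrderInv f) (i : Fin m) :
    permAvg n (fun l => f (part m i l)) = compAvg m n (fun c => permAvg (c i) f) := by
  classical
  have := permAvg_prod_part hm hn (fun j => if j = i then f else fun _ => 1)
    (fun j => by by_cases h : j = i <;> simp [h, hf]; intro _ _ _; rfl)
  have e1 : ∀ l : List ℕ, ∏ j : Fin m, (if j = i then f else fun _ => 1) (part m j l) =
      f (part m i l) := by
    intro l
    rw [Finset.prod_eq_single i] <;> simp +contextual
  have e2 : ∀ c : Fin m → ℕ, ∏ j : Fin m, permAvg (c j) (if j = i then f else fun _ => 1) =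
      permAvg (c i) f := by
    intro c
    rw [Finset.prod_eq_single i] <;> simp +contextual [permAvg_one]
  simpa only [e1, e2] using this

theorem permAvg_part_mul {m n : ℕ} (hm : 2 ≤ m) (hn : m - 1 ≤ n) (f g : List ℕ → ℝ)
    (hf : OrderInv f) (hg : OrderInv g) (i j : Fin m) (hij : i ≠ j) :
    permAvg n (fun l => f (part m i l) * g (part m j l)) =
      compAvg m n (fun c => permAvg (c i) f * permAvg (c j) g) := by
  classical
  have hone : OrderInv (fun _ : List ℕ => (1 : ℝ)) := fun _ _ _ => rfl
  have := permAvg_prod_part hm hn (fun k => if k = i then f else if k = j then g else fun _ => 1)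
    (fun k => by
      by_cases h : k = i
      · simpa [h] using hf
      · by_cases h' : k = j
        · simpa [h, h', Ne.symm hij] using hg
        · simpa [h, h'] using hone)
  have e1 : ∀ l : List ℕ, ∏ k : Fin m, (if k = i then f else if k = j then g else fun _ => 1)
      (part m k l) = f (part m i l) * g (part m j l) := by
    intro l
    rw [Finset.prod_eq_mul i j hij] <;> simp +contextual [hij.symm]
  have e2 : ∀ c : Fin m → ℕ, ∏ k : Fin m, permAvg (c k)
      (if k = i then f else if k = j then g else fun _ => 1) =
      permAvg (c i) f * permAvg (c j) g := by
    intro c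
    rw [Finset.prod_eq_mul i j hij] <;> simp +contextual [hij.symm, permAvg_one]
  simpa only [e1, e2] using this

theorem permAvg_rec {m n : ℕ} (hm : 2 ≤ m) (hn : m - 1 ≤ n) (X X' : List ℕ → ℝ)
    (hX' : OrderInv X') (a : ℝ)
    (hX : ∀ σ : Equiv.Perm (Fin n), X (valueList σ) =
      a + ∑ i : Fin m, X' (part m i (valueList σ))) :
    permAvg n X = a + compMean m n (fun j => permAvg j X') := by
  rw [permAvg_congr (g := fun l => a + ∑ i : Fin m, X' (part m i l)) hX, permAvg_add,
    permAvg_const, permAvg_sum, compMean, compAvg_sum]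
  simp only [permAvg_part hm hn X' hX']

/-- Law of total covariance, conditioning on the subtree sizes: by independence the conditional
covariance is a sum over the subtrees, and the covariance of the conditional means is the toll. The
constants `a` and `b` drop out. -/
theorem permCov_rec {m n : ℕ} (hm : 2 ≤ m) (hn : m - 1 ≤ n) (X X' Y Y' : List ℕ → ℝ)
    (hX' : OrderInv X') (hY' : OrderInv Y') (a b : ℝ)
    (hX : ∀ σ : Equiv.Perm (Fin n), X (valueList σ) =
      a + ∑ i : Fin m, X' (part m i (valueList σ)))
    (hY : ∀ σ : Equiv.Perm (Fin n), Y (valueList σ) =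
      b + ∑ i : Fin m, Y' (part m i (valueList σ))) :
    permCov n X Y = compMean m n (fun j => permCov j X' Y') +
      tollCov m n (fun j => permAvg j X') (fun j => permAvg j Y') := by
  classical
  unfold permCov
  rw [permAvg_rec hm hn X X' hX' a hX, permAvg_rec hm hn Y Y' hY' b hY,
    permAvg_congr (g := fun l => a * b + a * (∑ i : Fin m, Y' (part m i l)) +
      b * (∑ i : Fin m, X' (part m i l)) +
      ∑ i : Fin m, ∑ j : Fin m, X' (part m i l) * Y' (part m j l))
      (fun σ => by rw [hX, hY, ← Finset.sum_mul_sum]; ring),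
    permAvg_add, permAvg_add, permAvg_add, permAvg_const, permAvg_const_mul, permAvg_const_mul,
    permAvg_sum, permAvg_sum, permAvg_sum]
  simp only [permAvg_sum]
  -- Off the diagonal the two factors are independent; on the diagonal the mean of the product is
  -- the covariance plus the product of the means.
  have key : ∑ i : Fin m, ∑ j : Fin m, permAvg n (fun l => X' (part m i l) * Y' (part m j l)) =
      compMean m n (fun j => permAvg j (fun l => X' l * Y' l) - permAvg j X' * permAvg j Y') +
      compAvg m n (fun c => (∑ i, permAvg (c i) X') * ∑ i, permAvg (c i) Y') := by
    have h1 : ∀ i j : Fin m, permAvg n (fun l => X' (part m i l) * Y' (part m j l)) =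
        compAvg m n (fun c => (if i = j then permAvg (c i) (fun l => X' l * Y' l) -
          permAvg (c i) X' * permAvg (c i) Y' else 0) + permAvg (c i) X' * permAvg (c j) Y') := by
      intro i j
      by_cases h : i = j
      · subst h
        rw [permAvg_part hm hn (fun l => X' l * Y' l) (hX'.comp₂ hY' (· * ·)) i]
        simp
      · rw [permAvg_part_mul hm hn X' Y' hX' hY' i j h]
        simp [h]
    simp only [h1]
    simp only [← compAvg_sum, compMean, ← compAvg_add]
    congr 1
    funext c
    rw [Finset.sum_mul_sum]
    simp [Finset.sum_add_distrib]
  rw [key]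
  simp only [permAvg_part hm hn X' hX', permAvg_part hm hn Y' hY', tollCov, compMean, compAvg_sum]
  ring

theorem integral_unifPerm (n : ℕ) (g : Equiv.Perm (Fin n) → ℝ) :
    ∫ σ, g σ ∂(unifPerm n) = (∑ σ, g σ) / n.factorial := by
  have : MeasurableSingletonClass (Equiv.Perm (Fin n)) := ⟨fun _ => trivial⟩
  unfold unifPerm
  rw [PMF.integral_eq_sum]
  simp [PMF.uniformOfFintype_apply, Fintype.card_perm, div_eq_inv_mul,
    Finset.mul_sum]

instance isProbabilityMeasure_unifPerm (n : ℕ) : IsProbabilityMeasure (unifPerm n) := by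
  unfold unifPerm; infer_instance

theorem memLp_unifPerm (n : ℕ) (g : Equiv.Perm (Fin n) → ℝ) : MemLp g 2 (unifPerm n) := by
  have : MeasurableSingletonClass (Equiv.Perm (Fin n)) := ⟨fun _ => trivial⟩
  have : DiscreteMeasurableSpace (Equiv.Perm (Fin n)) := ⟨fun _ => trivial⟩
  exact MemLp.of_discrete

theorem covariance_unifPerm (n : ℕ) (f g : List ℕ → ℝ) :
    cov[fun σ => f (valueList σ), fun σ => g (valueList σ); unifPerm n] = permCov n f g := by
  rw [covariance_eq_sub (memLp_unifPerm n _) (memLp_unifPerm n _)]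
  simp only [Pi.mul_apply, integral_unifPerm]
  rfl

theorem variance_unifPerm (n : ℕ) (f : List ℕ → ℝ) :
    Var[fun σ => f (valueList σ); unifPerm n] = permCov n f f := by
  rw [← covariance_unifPerm, covariance_self]
  exact (memLp_unifPerm n _).1.aemeasurable

end Moments

/-! ### Generating functions and the eigenfunctions of the averaging operator. -/

section RisingFactorials

/-- The coefficient of `z ^ n` in `(1 - z) ^ (-s)`. -/
noncomputable def qseq (s : ℂ) (n : ℕ) : ℂ := (∏ i ∈ Finset.range n, (s + i)) / n.factorial

/-- The rising factorial `s (s + 1) ⋯ (s + m - 2)`. -/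
noncomputable def risingProd (m : ℕ) (s : ℂ) : ℂ := ∏ j ∈ Finset.range (m - 1), (s + j)

theorem qseq_zero (s : ℂ) : qseq s 0 = 1 := by simp [qseq]

theorem qseq_succ (s : ℂ) (n : ℕ) : ((n : ℂ) + 1) * qseq s (n + 1) = (s + n) * qseq s n := by
  unfold qseq
  rw [Finset.prod_range_succ, Nat.factorial_succ]
  have : (n.factorial : ℂ) ≠ 0 := by exact_mod_cast n.factorial_ne_zero
  have h2 : (n : ℂ) + 1 ≠ 0 := by exact_mod_cast n.succ_ne_zero
  push_cast
  field_simp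

theorem qseq_zero_left (n : ℕ) (hn : n ≠ 0) : qseq 0 n = 0 := by
  unfold qseq
  rw [Finset.prod_eq_zero (Finset.mem_range.2 (Nat.pos_of_ne_zero hn))] <;> simp

theorem qseq_one (n : ℕ) : qseq 1 n = 1 := by
  induction n with
  | zero => simp [qseq]
  | succ n ih =>
    have h := qseq_succ 1 n
    rw [ih] at h
    have h2 : (n : ℂ) + 1 ≠ 0 := by exact_mod_cast n.succ_ne_zero
    apply mul_left_cancel₀ h2
    rw [h]; ring

theorem qseq_two (n : ℕ) : qseq 2 n = n + 1 := by
  induction n with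
  | zero => simp [qseq]
  | succ n ih =>
    have h := qseq_succ 2 n
    rw [ih] at h
    have h2 : (n : ℂ) + 1 ≠ 0 := by exact_mod_cast n.succ_ne_zero
    apply mul_left_cancel₀ h2
    rw [h]; push_cast; ring

theorem qseq_three (n : ℕ) : qseq 3 n = (n + 1) * (n + 2) / 2 := by
  induction n with
  | zero => simp [qseq]
  | succ n ih =>
    have h := qseq_succ 3 n
    rw [ih] at h
    have h2 : (n : ℂ) + 1 ≠ 0 := by exact_mod_cast n.succ_ne_zero
    apply mul_left_cancel₀ h2
    rw [h]; push_cast; ring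

theorem qseq_shift (s : ℂ) (n : ℕ) : s * qseq (s + 1) n = (s + n) * qseq s n := by
  unfold qseq
  have h : (∏ i ∈ Finset.range n, (s + i)) * (s + n) =
      s * ∏ i ∈ Finset.range n, (s + 1 + i) := by
    rw [← Finset.prod_range_succ, Finset.prod_range_succ']
    rw [mul_comm]
    congr 1
    · simp
    · refine Finset.prod_congr rfl fun i _ => ?_
      push_cast; ring
  rw [mul_div_assoc', ← h]
  ring

/-- Chu–Vandermonde. Multiplying by `n + 1` and splitting it as the sum of the two indices reduces
to the two-term recurrence of `qseq`. -/
theorem sum_antidiagonal_qseq (s t : ℂ) (n : ℕ) :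
    ∑ p ∈ Finset.HasAntidiagonal.antidiagonal n, qseq s p.1 * qseq t p.2 = qseq (s + t) n := by
  induction n with
  | zero => simp [qseq]
  | succ n ih =>
    have h2 : (n : ℂ) + 1 ≠ 0 := by exact_mod_cast n.succ_ne_zero
    apply mul_left_cancel₀ h2
    rw [qseq_succ, ← ih, Finset.mul_sum, Finset.mul_sum]
    have e1 : ∑ p ∈ Finset.HasAntidiagonal.antidiagonal (n + 1), ((n : ℂ) + 1) * (qseq s p.1 * qseq t p.2) =
        ∑ p ∈ Finset.HasAntidiagonal.antidiagonal (n + 1), (p.1 : ℂ) * qseq s p.1 * qseq t p.2 +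
        ∑ p ∈ Finset.HasAntidiagonal.antidiagonal (n + 1), qseq s p.1 * ((p.2 : ℂ) * qseq t p.2) := by
      rw [← Finset.sum_add_distrib]
      refine Finset.sum_congr rfl fun p hp => ?_
      have : (p.1 : ℂ) + p.2 = n + 1 := by exact_mod_cast Finset.HasAntidiagonal.mem_antidiagonal.1 hp
      rw [← this]; ring
    rw [e1, Finset.Nat.sum_antidiagonal_succ, Finset.Nat.sum_antidiagonal_succ']
    simp only [Nat.cast_zero, zero_mul, zero_add, mul_zero, Nat.cast_add, Nat.cast_one,
      qseq_succ]
    rw [← Finset.sum_add_distrib]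
    refine Finset.sum_congr rfl fun p hp => ?_
    have : (p.1 : ℂ) + p.2 = n := by exact_mod_cast Finset.HasAntidiagonal.mem_antidiagonal.1 hp
    rw [← this]; ring

/-- The power series of `(1 - z) ^ (-s)`. -/
noncomputable def qSeries (s : ℂ) : PowerSeries ℂ := PowerSeries.mk (qseq s)

theorem qSeries_mul (s t : ℂ) : qSeries s * qSeries t = qSeries (s + t) := by
  ext n
  rw [PowerSeries.coeff_mul]
  simp only [qSeries, PowerSeries.coeff_mk, sum_antidiagonal_qseq]

theorem qSeries_zero : qSeries 0 = 1 := by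
  ext n
  rw [PowerSeries.coeff_one, qSeries, PowerSeries.coeff_mk]
  split_ifs with h
  · rw [h, qseq_zero]
  · exact qseq_zero_left n h

theorem qSeries_one_pow (k : ℕ) : qSeries 1 ^ k = qSeries k := by
  induction k with
  | zero => simp [qSeries_zero]
  | succ k ih => rw [pow_succ, ih, qSeries_mul]; push_cast; rfl

/-- Sums over compositions become coefficients of products of power series. A coordinate that does
not enter contributes the factor 1/(1 - z), which is `qSeries 1`. -/
theorem sum_comp_prod (m N : ℕ) (x : Fin m → ℕ → ℂ) :
    ∑ c ∈ Finset.piAntidiag Finset.univ N, ∏ i, x i (c i) =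
      PowerSeries.coeff N (∏ i, PowerSeries.mk (x i)) := by
  classical
  rw [PowerSeries.coeff_prod]
  refine Finset.sum_bij' (fun c _ => Finsupp.equivFunOnFinite.symm c) (fun c _ => c) ?_ ?_ ?_ ?_ ?_
  · intro c hc
    rw [Finset.mem_piAntidiag] at hc
    rw [Finset.mem_finsuppAntidiag]
    exact ⟨by simpa using hc.1, Finset.subset_univ _⟩
  · intro c hc
    rw [Finset.mem_finsuppAntidiag] at hc
    rw [Finset.mem_piAntidiag]
    exact ⟨hc.1, by simp⟩
  · intro c _; rfl
  · intro c _; ext; rfl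
  · intro c _
    simp

variable {m n : ℕ}

theorem compAvg_single (i : Fin m) (x : ℕ → ℂ) :
    compAvg m n (fun c => x (c i)) =
      PowerSeries.coeff (n - (m - 1)) (PowerSeries.mk x * qSeries ((m - 1 : ℕ) : ℂ)) /
        n.choose (m - 1) := by
  classical
  unfold compAvg
  congr 1
  have h1 : ∀ c : Fin m → ℕ, x (c i) = ∏ j, (if j = i then x else fun _ => 1) (c j) := by
    intro c
    rw [Finset.prod_eq_single i] <;> simp +contextual
  simp only [h1]
  rw [sum_comp_prod, ← Finset.mul_prod_erase _ _ (Finset.mem_univ i)]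
  simp only [if_true]
  rw [Finset.prod_congr rfl (g := fun _ => qSeries 1)]
  · rw [Finset.prod_const, Finset.card_erase_of_mem (Finset.mem_univ i), Finset.card_univ,
      Fintype.card_fin, qSeries_one_pow]
  · intro j hj
    ext k
    simp [Finset.ne_of_mem_erase hj, qSeries, qseq_one]

theorem compAvg_pair (i j : Fin m) (hij : i ≠ j) (x y : ℕ → ℂ) :
    compAvg m n (fun c => x (c i) * y (c j)) =
      PowerSeries.coeff (n - (m - 1)) (PowerSeries.mk x * PowerSeries.mk y *
        qSeries ((m - 2 : ℕ) : ℂ)) / n.choose (m - 1) := by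
  classical
  unfold compAvg
  congr 1
  have h1 : ∀ c : Fin m → ℕ, x (c i) * y (c j) =
      ∏ k, (if k = i then x else if k = j then y else fun _ => 1) (c k) := by
    intro c
    rw [Finset.prod_eq_mul i j hij] <;> simp +contextual [hij.symm]
  simp only [h1]
  rw [sum_comp_prod, ← Finset.mul_prod_erase _ _ (Finset.mem_univ i),
    ← Finset.mul_prod_erase _ _ (Finset.mem_erase.2 ⟨hij.symm, Finset.mem_univ j⟩), ← mul_assoc]
  simp only [if_true, if_neg hij.symm]
  rw [Finset.prod_congr rfl (g := fun _ => qSeries 1)]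
  · rw [Finset.prod_const, Finset.card_erase_of_mem (Finset.mem_erase.2 ⟨hij.symm, Finset.mem_univ j⟩),
      Finset.card_erase_of_mem (Finset.mem_univ i), Finset.card_univ,
      Fintype.card_fin, qSeries_one_pow, Nat.sub_sub]
  · intro k hk
    ext l
    have h1 := Finset.ne_of_mem_erase hk
    have h2 := Finset.ne_of_mem_erase (Finset.mem_of_mem_erase hk)
    simp [h1, h2, qSeries, qseq_one]

theorem compMean_eq (x : ℕ → ℂ) :
    compMean m n x = m * (PowerSeries.coeff (n - (m - 1))
      (PowerSeries.mk x * qSeries ((m - 1 : ℕ) : ℂ)) / n.choose (m - 1)) := by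
  unfold compMean
  rw [compAvg_sum]
  simp [compAvg_single]

theorem risingProd_mul_qseq (hn : m - 1 ≤ n) (s : ℂ) :
    risingProd m s * (qseq (s + (m - 1 : ℕ)) (n - (m - 1)) / n.choose (m - 1)) =
      (m - 1).factorial * qseq s n := by
  obtain ⟨N, rfl⟩ := Nat.exists_eq_add_of_le hn
  rw [Nat.add_sub_cancel_left]
  unfold risingProd qseq
  rw [Finset.prod_range_add]
  have h1 : ((m - 1 + N).choose (m - 1) : ℂ) * (m - 1).factorial * N.factorial =
      (m - 1 + N).factorial := by
    have := Nat.add_choose_mul_factorial_mul_factorial (m - 1) N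
    rw [← Nat.choose_symm_add] at this
    exact_mod_cast this
  have h2 : ((m - 1).factorial : ℂ) ≠ 0 := by exact_mod_cast Nat.factorial_ne_zero _
  have h3 : (N.factorial : ℂ) ≠ 0 := by exact_mod_cast Nat.factorial_ne_zero _
  have h4 : ((m - 1 + N).choose (m - 1) : ℂ) ≠ 0 := by
    exact_mod_cast (Nat.choose_pos (Nat.le_add_right _ _)).ne'
  rw [← h1]
  have h5 : ∏ i ∈ Finset.range N, (s + ((m - 1 : ℕ) : ℂ) + i) =
      ∏ i ∈ Finset.range N, (s + ((m - 1 + i : ℕ) : ℂ)) := by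
    refine Finset.prod_congr rfl fun i _ => ?_
    push_cast; ring
  rw [h5]
  field_simp

/-- Eigenvalue equation of the averaging operator; the eigenvalue is 1 exactly at the zeros of Λ.
The undivided form holds for all `s`, so it can be differentiated in `s` everywhere. -/
theorem risingProd_mul_compMean (hm : 2 ≤ m) (hn : m - 1 ≤ n) (s : ℂ) :
    risingProd m s * compMean m n (qseq s) = m.factorial * qseq s n := by
  have h := risingProd_mul_qseq hn s
  have h2 : (m.factorial : ℂ) = m * (m - 1).factorial := by
    exact_mod_cast (Nat.mul_factorial_pred (by omega)).symm
  rw [compMean_eq, show PowerSeries.mk (qseq s) = qSeries s from rfl, qSeries_mul, h2, mul_assoc,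
    ← h]
  simp only [qSeries, PowerSeries.coeff_mk]
  ring

/-- The sum over pairs `i ≠ j` of the averages of `x (c i) * y (c j)`. -/
noncomputable def crossMean (m n : ℕ) (x y : ℕ → ℂ) : ℂ :=
  m * (m - 1) * (PowerSeries.coeff (n - (m - 1)) (PowerSeries.mk x * PowerSeries.mk y *
    qSeries ((m - 2 : ℕ) : ℂ)) / n.choose (m - 1))

theorem tollCov_eq (x y : ℕ → ℂ) :
    tollCov m n x y = compMean m n (fun i => x i * y i) + crossMean m n x y -
      compMean m n x * compMean m n y := by
  classical
  unfold tollCov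
  congr 1
  have h1 : (fun c : Fin m → ℕ => (∑ i, x (c i)) * ∑ i, y (c i)) =
      fun c => ∑ i, x (c i) * y (c i) + ∑ i, ∑ j ∈ Finset.univ.erase i, x (c i) * y (c j) := by
    funext c
    rw [Finset.sum_mul_sum, ← Finset.sum_add_distrib]
    refine Finset.sum_congr rfl fun i _ => ?_
    exact (Finset.add_sum_erase _ (fun j => x (c i) * y (c j)) (Finset.mem_univ i)).symm
  rw [h1, compAvg_add, compMean, crossMean]
  congr 1
  rw [compAvg_sum]
  have h2 : ∀ i : Fin m, compAvg m n
      (fun c : Fin m → ℕ => ∑ j ∈ Finset.univ.erase i, x (c i) * y (c j)) =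
      (m - 1) * (PowerSeries.coeff (n - (m - 1)) (PowerSeries.mk x * PowerSeries.mk y *
    qSeries ((m - 2 : ℕ) : ℂ)) / n.choose (m - 1)) := by
    intro i
    rw [compAvg_sum]
    rw [Finset.sum_congr rfl (fun j hj => compAvg_pair i j (Finset.ne_of_mem_erase hj).symm x y)]
    rw [Finset.sum_const, Finset.card_erase_of_mem (Finset.mem_univ i), Finset.card_univ,
      Fintype.card_fin, nsmul_eq_mul]
    have : 1 ≤ m := by have := i.2; omega
    push_cast [this]
    ring
  simp only [h2]
  simp
  ring

/-- Both sides are coefficients of the same power (1 - z)^(-(s+t+m-2)): two subtrees with parameters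
`s` and `t` act like one with parameter `s + t - 1`. -/
theorem crossMean_qseq (hm : 2 ≤ m) (s t : ℂ) :
    crossMean m n (qseq s) (qseq t) = (m - 1) * compMean m n (qseq (s + t - 1)) := by
  rw [crossMean, compMean_eq]
  simp only [show ∀ s, PowerSeries.mk (qseq s) = qSeries s from fun _ => rfl, qSeries_mul]
  have : s + t + ((m - 2 : ℕ) : ℂ) = s + t - 1 + ((m - 1 : ℕ) : ℂ) := by
    push_cast [hm, show 1 ≤ m by omega]; ring
  rw [this]
  ring

end RisingFactorials

/-! ### Gamma and digamma limits. -/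

section GammaLimits

theorem add_natCast_ne_zero {s : ℂ} (hs : 0 < s.re) (k : ℕ) : s + k ≠ 0 := by
  intro h
  have := congrArg Complex.re h
  simp at this
  have hk : (0 : ℝ) ≤ k := k.cast_nonneg
  linarith

theorem qseq_ne_zero {s : ℂ} (hs : 0 < s.re) (n : ℕ) : qseq s n ≠ 0 := by
  unfold qseq
  refine div_ne_zero (Finset.prod_ne_zero_iff.2 fun i _ => add_natCast_ne_zero hs i) ?_
  exact_mod_cast n.factorial_ne_zero

/-- This is Euler's limit for Gamma. `GammaSeq` has one more factor `s + n` in its denominator,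
compensated by n/(s + n) → 1. -/
theorem tendsto_qseq {s : ℂ} (hs : 0 < s.re) :
    Tendsto (fun n : ℕ => qseq s n / (n : ℂ) ^ (s - 1)) atTop (𝓝 (1 / Complex.Gamma s)) := by
  have hG := Complex.GammaSeq_tendsto_Gamma s
  have hG0 : Complex.Gamma s ≠ 0 := Complex.Gamma_ne_zero_of_re_pos hs
  have h1 : Tendsto (fun n : ℕ => (n : ℂ) / (s + n)) atTop (𝓝 1) := by
    have h2 : Tendsto (fun n : ℕ => s / (n : ℂ) + 1) atTop (𝓝 (0 + 1)) := by
      refine Tendsto.add_const 1 ?_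
      exact tendsto_const_div_atTop_nhds_zero_nat s
    have h3 := h2.inv₀ (by norm_num)
    rw [zero_add, inv_one] at h3
    refine h3.congr' ?_
    filter_upwards [eventually_gt_atTop 0] with n hn
    have hn' : (n : ℂ) ≠ 0 := by exact_mod_cast hn.ne'
    have := add_natCast_ne_zero hs n
    have h4 : s / n + 1 ≠ 0 := by
      rw [div_add_one hn']; exact div_ne_zero this hn'
    field_simp
  have h2 := h1.div hG hG0
  refine h2.congr' ?_
  filter_upwards [eventually_gt_atTop 0] with n hn
  have hn' : (n : ℂ) ≠ 0 := by exact_mod_cast hn.ne'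
  have hsn := add_natCast_ne_zero hs n
  have hp : (n : ℂ) ^ s ≠ 0 := by
    rw [Ne, Complex.cpow_eq_zero_iff]; tauto
  have hprod : ∏ i ∈ Finset.range n, (s + (i : ℂ)) ≠ 0 :=
    Finset.prod_ne_zero_iff.2 fun i _ => add_natCast_ne_zero hs i
  have hf : (n.factorial : ℂ) ≠ 0 := by exact_mod_cast n.factorial_ne_zero
  simp only [Pi.div_apply]
  rw [Complex.GammaSeq, Finset.prod_range_succ, Complex.cpow_sub _ _ hn', Complex.cpow_one, qseq]
  field_simp

/-- The logarithmic derivative of `qseq` in its first argument. -/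
noncomputable def ell (s : ℂ) (n : ℕ) : ℂ := ∑ i ∈ Finset.range n, 1 / (s + i)

theorem tendsto_succ_cpow_div (w : ℂ) :
    Tendsto (fun n : ℕ => ((n : ℂ) + 1) ^ w / (n : ℂ) ^ w) atTop (𝓝 1) := by
  have h1 : Tendsto (fun n : ℕ => (1 + 1 / (n : ℂ)) ^ w) atTop (𝓝 ((1 + 0) ^ w)) := by
    have h0 : Tendsto (fun n : ℕ => (1 : ℂ) + 1 / (n : ℂ)) atTop (𝓝 (1 + 0)) :=
      (tendsto_const_div_atTop_nhds_zero_nat (1 : ℂ)).const_add 1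
    exact h0.cpow tendsto_const_nhds (by simp)
  simp only [add_zero, Complex.one_cpow] at h1
  refine h1.congr' ?_
  filter_upwards [eventually_gt_atTop 0] with n hn
  have hn' : (n : ℂ) ≠ 0 := by exact_mod_cast hn.ne'
  have hp : (n : ℂ) ^ w ≠ 0 := by
    rw [Ne, Complex.cpow_eq_zero_iff]; tauto
  rw [eq_div_iff hp]
  have e1 : ((1 + 1 / (n : ℂ))) = ((1 + 1 / n : ℝ) : ℂ) := by push_cast; ring
  have e2 : (n : ℂ) = ((n : ℝ) : ℂ) := by push_cast; rfl
  rw [e1, e2, ← Complex.mul_cpow_ofReal_nonneg (by positivity) (by positivity)]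
  congr 1
  push_cast
  field_simp

/-- Up to a null sequence, the negated expression is the `n`-th partial sum of the series for the
logarithmic derivative of Γ at `s`. Termwise differentiation is justified by summable bounds on a
disc around `s`. -/
theorem tendsto_ell {s : ℂ} (hs : 0 < s.re) :
    Tendsto (fun n : ℕ => ell s n - Real.log n) atTop (𝓝 (-Complex.digamma s)) := by
  set ρ : ℝ := s.re / 2 with hρ
  have hρ0 : 0 < ρ := by positivity
  -- The logarithm of the `k`-th factor in a product for Γ(z)/Γ(s). The logarithmic differences
  -- telescope to (z - s) log(n + 1), which makes the product converge.
  let g : ℕ → ℂ → ℂ := fun k z => (z - s) * ((Real.log (k + 2) - Real.log (k + 1) : ℝ) : ℂ) -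
    (Complex.log (z + k) - Complex.log (s + k))
  let g' : ℕ → ℂ → ℂ := fun k z => ((Real.log (k + 2) - Real.log (k + 1) : ℝ) : ℂ) - 1 / (z + k)
  let t := Metric.ball s ρ
  have hre : ∀ z ∈ t, ρ < z.re := by
    intro z hz
    have h1 : ‖z - s‖ < ρ := by simpa [t, dist_eq_norm] using hz
    have h2 := (Complex.abs_re_le_norm (z - s)).trans_lt h1
    rw [Complex.sub_re, abs_lt] at h2
    linarith [h2.1]
  have hst : s ∈ t := Metric.mem_ball_self hρ0
  have hderiv : ∀ k z, z ∈ t → HasDerivAt (g k) (g' k z) z := by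
    intro k z hz
    have hz0 : 0 < z.re := hρ0.trans (hre z hz)
    have hsl : z + k ∈ Complex.slitPlane := by
      left; simp; positivity
    have h1 : HasDerivAt (fun z : ℂ => Complex.log (z + k)) (1 / (z + k)) z :=
      ((hasDerivAt_id z).add_const (k : ℂ)).clog hsl
    have h2 : HasDerivAt (fun z : ℂ => (z - s) *
        ((Real.log (k + 2) - Real.log (k + 1) : ℝ) : ℂ))
        (1 * ((Real.log (k + 2) - Real.log (k + 1) : ℝ) : ℂ)) z :=
      ((hasDerivAt_id z).sub_const s).mul_const _
    have h3 := h2.sub (h1.sub_const (Complex.log (s + k)))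
    rw [one_mul] at h3
    exact h3
  set M : ℝ := ‖s‖ + ρ + 1 with hM
  set δ : ℝ := min ρ 1 with hδ
  have hδ0 : 0 < δ := lt_min hρ0 one_pos
  have hbound : ∀ k z, z ∈ t → ‖g' k z‖ ≤ (1 + M / δ) * (1 / ((k : ℝ) + 1) ^ 2) := by
    intro k z hz
    have hk1 : (0 : ℝ) < (k : ℝ) + 1 := by positivity
    have hlog : Real.log (k + 2) - Real.log (k + 1) = Real.log (1 + 1 / ((k : ℝ) + 1)) := by
      rw [← Real.log_div (by positivity) (by positivity)]
      congr 1; field_simp; ring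
    have hl1 : |Real.log (1 + 1 / ((k : ℝ) + 1)) - 1 / ((k : ℝ) + 1)| ≤ 1 / ((k : ℝ) + 1) ^ 2 := by
      set u := 1 / ((k : ℝ) + 1) with hu
      have hu0 : 0 < u := by positivity
      have h1 := Real.log_le_sub_one_of_pos (show 0 < 1 + u by positivity)
      have h2 := Real.one_sub_inv_le_log_of_pos (show 0 < 1 + u by positivity)
      have h3 : u - u ^ 2 ≤ 1 - (1 + u)⁻¹ := by
        rw [← sub_nonneg]
        have : 1 - (1 + u)⁻¹ - (u - u ^ 2) = u ^ 3 / (1 + u) := by field_simp; ring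
        rw [this]; positivity
      have h4 : 1 / ((k : ℝ) + 1) ^ 2 = u ^ 2 := by rw [hu, div_pow, one_pow]
      rw [h4, abs_le]
      constructor <;> nlinarith
    have hzk : δ * (k + 1) ≤ ‖z + k‖ := by
      have h1 := Complex.re_le_norm (z + k)
      simp only [Complex.add_re, Complex.natCast_re] at h1
      have h2 := hre z hz
      have h3 : δ ≤ ρ := min_le_left _ _
      have h4 : δ ≤ 1 := min_le_right _ _
      have h5 : (0 : ℝ) ≤ k := k.cast_nonneg
      nlinarith
    have hzk0 : z + k ≠ 0 := add_natCast_ne_zero (hρ0.trans (hre z hz)) k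
    have hz1 : ‖z - 1‖ ≤ M := by
      have h1 : ‖z - s‖ < ρ := by simpa [t, dist_eq_norm] using hz
      calc ‖z - 1‖ = ‖(z - s) + s - 1‖ := by ring_nf
        _ ≤ ‖z - s‖ + ‖s‖ + ‖(1 : ℂ)‖ := (norm_sub_le _ _).trans (by gcongr; exact norm_add_le _ _)
        _ ≤ M := by rw [norm_one]; linarith
    have hk1c : (k : ℂ) + 1 ≠ 0 := by exact_mod_cast k.succ_ne_zero
    -- Comparing both terms with 1/(k + 1) leaves two pieces, each of order k⁻² uniformly on the
    -- disc.
    have hsplit : g' k z = ((Real.log (1 + 1 / ((k : ℝ) + 1)) - 1 / ((k : ℝ) + 1) : ℝ) : ℂ) +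
        (z - 1) / (((k : ℂ) + 1) * (z + k)) := by
      simp only [g', hlog]
      push_cast
      field_simp
      ring
    rw [hsplit]
    refine (norm_add_le _ _).trans ?_
    rw [Complex.norm_real, Real.norm_eq_abs, add_mul 1 (M / δ), one_mul]
    refine add_le_add hl1 ?_
    rw [norm_div, norm_mul]
    have hk1n : ‖(k : ℂ) + 1‖ = (k : ℝ) + 1 := by
      rw [show (k : ℂ) + 1 = ((k + 1 : ℕ) : ℂ) by push_cast; rfl, Complex.norm_natCast]
      push_cast; rfl
    rw [hk1n]
    calc ‖z - 1‖ / (((k : ℝ) + 1) * ‖z + k‖) ≤ M / (((k : ℝ) + 1) * (δ * (k + 1))) := by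
          have hM0 : 0 ≤ M := (norm_nonneg _).trans hz1
          gcongr
      _ = M / δ * (1 / ((k : ℝ) + 1) ^ 2) := by field_simp
  have hsum : Summable (fun k : ℕ => (1 + M / δ) * (1 / ((k : ℝ) + 1) ^ 2)) := by
    apply Summable.mul_left
    have := (summable_nat_add_iff 1).2 (Real.summable_one_div_nat_pow.2 (one_lt_two))
    simpa using this
  have hg0 : Summable (fun k => g k s) := by
    have : (fun k => g k s) = fun _ => 0 := by funext k; simp [g]
    rw [this]; exact summable_zero
  have hpre : IsPreconnected t := (convex_ball s ρ).isPreconnected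
  have hD := hasDerivAt_tsum_of_isPreconnected hsum Metric.isOpen_ball hpre hderiv hbound hst hg0 hst
  have hS : ∀ z ∈ t, Summable (fun k => g k z) := fun z hz =>
    summable_of_summable_hasDerivAt_of_isPreconnected hsum Metric.isOpen_ball hpre hderiv hbound
      hst hg0 hz
  have htele : ∀ n : ℕ, ∑ k ∈ Finset.range n,
      ((Real.log (k + 2) - Real.log (k + 1) : ℝ) : ℂ) = Real.log (n + 1) := by
    intro n
    induction n with
    | zero => simp
    | succ n ih =>
      rw [Finset.sum_range_succ, ih]
      push_cast
      ring_nf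
  have hexp : ∀ z ∈ t, Complex.exp (∑' k, g k z) = Complex.Gamma z / Complex.Gamma s := by
    intro z hz
    have hz0 : 0 < z.re := hρ0.trans (hre z hz)
    have h1 := ((hS z hz).hasSum.tendsto_sum_nat)
    have h2 := (Complex.continuous_exp.tendsto _).comp h1
    refine tendsto_nhds_unique h2 ?_
    have h3 := ((tendsto_qseq hs).div (tendsto_qseq hz0)
      (one_div_ne_zero (Complex.Gamma_ne_zero_of_re_pos hz0))).mul
      (tendsto_succ_cpow_div (z - s))
    rw [mul_one, show 1 / Complex.Gamma s / (1 / Complex.Gamma z) =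
      Complex.Gamma z / Complex.Gamma s by rw [one_div, one_div, inv_div_inv]] at h3
    refine h3.congr' ?_
    filter_upwards [eventually_gt_atTop 0] with n hn
    have hn' : (n : ℂ) ≠ 0 := by exact_mod_cast hn.ne'
    have hn1 : (n : ℂ) + 1 ≠ 0 := by exact_mod_cast n.succ_ne_zero
    have hcp : ∀ w : ℂ, (n : ℂ) ^ w ≠ 0 := fun w => by
      rw [Ne, Complex.cpow_eq_zero_iff]; tauto
    have e1 : Complex.exp (∑ k ∈ Finset.range n, g k z) =
        ((n : ℂ) + 1) ^ (z - s) * (∏ k ∈ Finset.range n, (s + k)) /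
          ∏ k ∈ Finset.range n, (z + k) := by
      simp only [g, Finset.sum_sub_distrib, ← Finset.mul_sum, htele]
      rw [Complex.exp_sub, Complex.exp_sub, Complex.exp_sum, Complex.exp_sum,
        Complex.cpow_def_of_ne_zero hn1]
      rw [Finset.prod_congr rfl (fun k _ => Complex.exp_log (add_natCast_ne_zero hz0 k)),
        Finset.prod_congr rfl (fun k _ => Complex.exp_log (add_natCast_ne_zero hs k))]
      have : Complex.log ((n : ℂ) + 1) = (Real.log (n + 1) : ℂ) := by
        rw [Complex.ofReal_log (by positivity)]; push_cast; rfl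
      rw [this, mul_comm (z - s)]
      rw [div_div_eq_mul_div]
    simp only [Function.comp, e1, Pi.div_apply]
    have hf : (n.factorial : ℂ) ≠ 0 := by exact_mod_cast n.factorial_ne_zero
    have hp1 : ∏ i ∈ Finset.range n, (z + (i : ℂ)) ≠ 0 :=
      Finset.prod_ne_zero_iff.2 fun i _ => add_natCast_ne_zero hz0 i
    have hcs : (n : ℂ) ^ (z - s) * (n : ℂ) ^ (s - 1) = (n : ℂ) ^ (z - 1) := by
      rw [← Complex.cpow_add _ _ hn']; congr 1; ring
    rw [qseq, qseq, ← hcs]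
    have := hcp (z - s)
    have := hcp (s - 1)
    field_simp
  have hGs : Complex.Gamma s ≠ 0 := Complex.Gamma_ne_zero_of_re_pos hs
  have hdig : ∑' k, g' k s = Complex.digamma s := by
    have h1 := hD.cexp
    have h2 : HasDerivAt (fun z => Complex.Gamma z / Complex.Gamma s)
        (Complex.exp (∑' k, g k s) * ∑' k, g' k s) s := by
      refine h1.congr_of_eventuallyEq ?_
      filter_upwards [Metric.isOpen_ball.mem_nhds hst] with z hz
      exact (hexp z hz).symm
    rw [hexp s hst, div_self hGs, one_mul] at h2
    have h3 := (h2.mul_const (Complex.Gamma s)).deriv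
    have h4 : (fun z => Complex.Gamma z / Complex.Gamma s * Complex.Gamma s) = Complex.Gamma := by
      funext z; field_simp
    rw [h4] at h3
    rw [Complex.digamma_def, logDeriv_apply, h3]
    field_simp
  have hS' : Summable (fun k => g' k s) :=
    Summable.of_norm_bounded hsum (fun k => hbound k s hst)
  have h1 := hS'.hasSum.tendsto_sum_nat
  rw [hdig] at h1
  have hlog : Tendsto (fun n : ℕ => ((Real.log (n + 1) - Real.log n : ℝ) : ℂ)) atTop (𝓝 0) := by
    rw [← Complex.ofReal_zero]
    refine (Complex.continuous_ofReal.tendsto _).comp ?_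
    have h0 : Tendsto (fun n : ℕ => Real.log (1 + 1 / (n : ℝ))) atTop (𝓝 (Real.log (1 + 0))) := by
      refine Tendsto.log ?_ (by norm_num)
      exact (tendsto_const_div_atTop_nhds_zero_nat (1 : ℝ)).const_add 1
    rw [add_zero, Real.log_one] at h0
    refine h0.congr' ?_
    filter_upwards [eventually_gt_atTop 0] with n hn
    have hn' : (0 : ℝ) < n := by exact_mod_cast hn
    rw [← Real.log_div (by positivity) (by positivity)]
    congr 1; field_simp
  have h2 := hlog.sub h1
  rw [zero_sub] at h2
  refine h2.congr fun n => ?_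
  simp only [g', Finset.sum_sub_distrib, htele, ell]
  push_cast
  ring

theorem digamma_two : Complex.digamma 2 = 1 - (Real.eulerMascheroniConstant : ℂ) := by
  have h := Complex.digamma_apply_add_one 1 (fun k => by
    intro h
    have := congrArg Complex.re h
    simp at this
    have hk : (0 : ℝ) ≤ k := k.cast_nonneg
    linarith)
  rw [Complex.digamma_one] at h
  norm_num at h
  rw [h]; ring

end GammaLimits

/-! ### Derivatives in the parameter, which supply the logarithmic terms. -/

section Derivatives

/-- The derivative of `qseq` in its first argument. -/
noncomputable def dq (s : ℂ) (n : ℕ) : ℂ := deriv (fun z => qseq z n) s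

/-- The second derivative of `qseq` in its first argument. -/
noncomputable def ddq (s : ℂ) (n : ℕ) : ℂ := deriv (fun z => dq z n) s

/-- The sum of the squares of the summands of `ell`. -/
noncomputable def ellSq (s : ℂ) (n : ℕ) : ℂ := ∑ i ∈ Finset.range n, 1 / (s + i) ^ 2

theorem contDiff_qseq (n : ℕ) : ContDiff ℂ ⊤ (fun z => qseq z n) := by
  unfold qseq
  refine ContDiff.div_const ?_ _
  exact contDiff_prod (fun i _ => contDiff_id.add contDiff_const)

theorem hasDerivAt_qseq (s : ℂ) (n : ℕ) : HasDerivAt (fun z => qseq z n) (dq s n) s :=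
  ((contDiff_qseq n).differentiable (by simp)).differentiableAt.hasDerivAt

theorem hasDerivAt_dq (s : ℂ) (n : ℕ) : HasDerivAt (fun z => dq z n) (ddq s n) s := by
  have h : Differentiable ℂ (deriv (fun z => qseq z n)) := by
    have := (contDiff_qseq n).differentiable_iteratedDeriv 1 (by decide)
    rwa [iteratedDeriv_one] at this
  exact h.differentiableAt.hasDerivAt

theorem dq_eq {s : ℂ} {n : ℕ} (hs : ∀ i < n, s + i ≠ 0) : dq s n = qseq s n * ell s n := by
  unfold dq
  have h1 : logDeriv (fun z : ℂ => ∏ i ∈ Finset.range n, (z + i)) s = ell s n := by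
    have := logDeriv_prod (s := Finset.range n) (f := fun (i : ℕ) (z : ℂ) => z + (i : ℂ)) (x := s)
      (fun i hi => hs i (Finset.mem_range.1 hi)) (fun i _ => by fun_prop)
    rw [this]
    refine Finset.sum_congr rfl fun i _ => ?_
    rw [logDeriv_apply]
    simp
  have hp : ∏ i ∈ Finset.range n, (s + (i : ℂ)) ≠ 0 :=
    Finset.prod_ne_zero_iff.2 fun i hi => hs i (Finset.mem_range.1 hi)
  rw [logDeriv_apply, div_eq_iff hp] at h1
  have h2 : (fun z => qseq z n) = fun z : ℂ =>
      (∏ i ∈ Finset.range n, (z + (i : ℂ))) / (n.factorial : ℂ) := rfl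
  rw [h2, deriv_div_const, h1, qseq]
  ring

theorem dq_eq_of_re_pos {s : ℂ} (hs : 0 < s.re) (n : ℕ) : dq s n = qseq s n * ell s n :=
  dq_eq fun i _ => add_natCast_ne_zero hs i

theorem hasDerivAt_ell {s : ℂ} (hs : 0 < s.re) (n : ℕ) :
    HasDerivAt (fun z => ell z n) (-ellSq s n) s := by
  unfold ell ellSq
  rw [← Finset.sum_neg_distrib]
  refine HasDerivAt.fun_sum fun i _ => ?_
  have h := ((hasDerivAt_id s).add_const (i : ℂ)).inv (add_natCast_ne_zero hs i)
  have e : (fun z : ℂ => 1 / (z + (i : ℂ))) = (fun z : ℂ => id z + (i : ℂ))⁻¹ := by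
    funext z; simp
  rw [e]
  exact h.congr_deriv (by rw [neg_div, id_eq])

theorem ddq_eq {s : ℂ} (hs : 0 < s.re) (n : ℕ) :
    ddq s n = qseq s n * (ell s n ^ 2 - ellSq s n) := by
  have h1 : (fun z => dq z n) =ᶠ[𝓝 s] fun z => qseq z n * ell z n := by
    have : ∀ᶠ z : ℂ in 𝓝 s, 0 < z.re :=
      (Complex.continuous_re.tendsto s).eventually (lt_mem_nhds hs)
    filter_upwards [this] with z hz
    exact dq_eq_of_re_pos hz n
  have h2 := ((hasDerivAt_qseq s n).mul (hasDerivAt_ell hs n)).congr_of_eventuallyEq h1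
  rw [ddq, h2.deriv, dq_eq_of_re_pos hs]
  ring

variable {m n : ℕ}

theorem risingProd_eq (m : ℕ) (s : ℂ) :
    risingProd m s = (m - 1).factorial * qseq s (m - 1) := by
  have : ((m - 1).factorial : ℂ) ≠ 0 := by exact_mod_cast Nat.factorial_ne_zero _
  rw [risingProd, qseq]; field_simp

theorem hasDerivAt_risingProd {s : ℂ} (hs : risingProd m s ≠ 0) :
    HasDerivAt (risingProd m) (risingProd m s * ell s (m - 1)) s := by
  have h1 := (hasDerivAt_qseq s (m - 1)).const_mul ((m - 1).factorial : ℂ)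
  have h2 : risingProd m = fun s => ((m - 1).factorial : ℂ) * qseq s (m - 1) := by
    funext z; exact risingProd_eq m z
  have h3 : ∀ i < m - 1, s + i ≠ 0 := by
    intro i hi h
    exact hs (Finset.prod_eq_zero (Finset.mem_range.2 hi) h)
  rw [dq_eq h3] at h1
  rw [h2]
  exact h1.congr_deriv (mul_assoc _ _ _).symm

theorem risingProd_ne_zero {s : ℂ} (hs : 0 < s.re) : risingProd m s ≠ 0 :=
  Finset.prod_ne_zero_iff.2 fun i _ => add_natCast_ne_zero hs i

theorem hasDerivAt_compMean {x : ℂ → ℕ → ℂ} {x' : ℕ → ℂ} {s : ℂ}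
    (h : ∀ k, HasDerivAt (fun z => x z k) (x' k) s) :
    HasDerivAt (fun z => compMean m n (x z)) (compMean m n x') s := by
  unfold compMean compAvg
  refine HasDerivAt.div_const ?_ _
  refine HasDerivAt.fun_sum fun c _ => ?_
  exact HasDerivAt.fun_sum fun i _ => h (c i)

theorem hasDerivAt_crossMean {x : ℕ → ℂ} {y : ℂ → ℕ → ℂ} {y' : ℕ → ℂ} {s : ℂ}
    (h : ∀ k, HasDerivAt (fun z => y z k) (y' k) s) :
    HasDerivAt (fun z => crossMean m n x (y z)) (crossMean m n x y') s := by
  unfold crossMean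
  refine HasDerivAt.const_mul _ (HasDerivAt.div_const ?_ _)
  simp only [PowerSeries.coeff_mul, PowerSeries.coeff_mk]
  refine HasDerivAt.fun_sum fun p _ => ?_
  refine HasDerivAt.mul_const ?_ _
  refine HasDerivAt.fun_sum fun p' _ => ?_
  exact (h _).const_mul _

theorem crossMean_comm (x y : ℕ → ℂ) : crossMean m n x y = crossMean m n y x := by
  unfold crossMean; rw [mul_comm (PowerSeries.mk x)]

theorem compMean_add (x y : ℕ → ℂ) :
    compMean m n (fun i => x i + y i) = compMean m n x + compMean m n y := by
  simp only [compMean, Finset.sum_add_distrib, compAvg_add]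

theorem compMean_sub (x y : ℕ → ℂ) :
    compMean m n (fun i => x i - y i) = compMean m n x - compMean m n y := by
  simp only [compMean, Finset.sum_sub_distrib, compAvg_sub]

theorem compMean_const_mul (a : ℂ) (x : ℕ → ℂ) :
    compMean m n (fun i => a * x i) = a * compMean m n x := by
  simp only [compMean, ← Finset.mul_sum, compAvg_const_mul]

theorem crossMean_sub_right (x y z : ℕ → ℂ) :
    crossMean m n x (fun i => y i - z i) = crossMean m n x y - crossMean m n x z := by
  have : PowerSeries.mk (fun i => y i - z i) = PowerSeries.mk y - PowerSeries.mk z := by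
    ext; simp
  simp only [crossMean, this, mul_sub, sub_mul, map_sub, sub_div]

theorem crossMean_const_mul_right (a : ℂ) (x y : ℕ → ℂ) :
    crossMean m n x (fun i => a * y i) = a * crossMean m n x y := by
  have : PowerSeries.mk (fun i => a * y i) = PowerSeries.C a * PowerSeries.mk y := by
    ext; simp
  simp only [crossMean, this]
  rw [mul_left_comm (PowerSeries.mk x), mul_assoc (PowerSeries.C a), PowerSeries.coeff_C_mul]
  ring

theorem compMean_qseq (hm : 2 ≤ m) (hn : m - 1 ≤ n) {s : ℂ} (hs : risingProd m s ≠ 0) :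
    compMean m n (qseq s) = m.factorial / risingProd m s * qseq s n := by
  have := risingProd_mul_compMean hm hn s
  field_simp
  rw [mul_comm]; exact this

/-- The eigenvalue equation differentiated in `s`. At a zero of Λ it reads L(dq s) = dq s - ell ·
qseq s, so `dq` solves the recurrence for a resonant toll. -/
theorem compMean_dq (hm : 2 ≤ m) (hn : m - 1 ≤ n) {s : ℂ} (hs : risingProd m s ≠ 0) :
    compMean m n (dq s) =
      m.factorial / risingProd m s * dq s n - ell s (m - 1) * compMean m n (qseq s) := by
  have h1 := (hasDerivAt_risingProd hs).mul
    (hasDerivAt_compMean (m := m) (n := n) (fun k => hasDerivAt_qseq s k))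
  have h2 := (hasDerivAt_qseq s n).const_mul (m.factorial : ℂ)
  have h3 : (risingProd m * fun z => compMean m n (qseq z)) =
      fun z => (m.factorial : ℂ) * qseq z n := by
    funext z; exact risingProd_mul_compMean hm hn z
  rw [h3] at h1
  have h4 := h1.unique h2
  field_simp
  linear_combination h4

/-- The free constant `h` will be `ell 2 n`, after which only differences of `ell` at the same `n`,
which converge, remain. -/
theorem compMean_dq_sub (hm : 2 ≤ m) (hn : m - 1 ≤ n) {s : ℂ} (hs : 0 < s.re) (h : ℂ) :
    compMean m n (fun i => dq s i - h * qseq s i) =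
      compMean m n (qseq s) * (ell s n - h - ell s (m - 1)) := by
  rw [compMean_sub, compMean_const_mul, compMean_dq hm hn (risingProd_ne_zero hs),
    dq_eq_of_re_pos hs, compMean_qseq hm hn (risingProd_ne_zero hs)]
  ring

theorem compMean_ddq (hm : 2 ≤ m) (hn : m - 1 ≤ n) {s : ℂ} (hs : 0 < s.re) :
    compMean m n (ddq s) = compMean m n (qseq s) *
      ((ell s n - ell s (m - 1)) ^ 2 - (ellSq s n - ellSq s (m - 1))) := by
  have h1 := hasDerivAt_compMean (m := m) (n := n) (fun k => hasDerivAt_dq s k)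
  have hev : (fun z => compMean m n (dq z)) =ᶠ[𝓝 s]
      (fun z => compMean m n (qseq z)) * fun z => (ell z n - ell z (m - 1)) := by
    have : ∀ᶠ z : ℂ in 𝓝 s, 0 < z.re :=
      (Complex.continuous_re.tendsto s).eventually (lt_mem_nhds hs)
    filter_upwards [this] with z hz
    have := compMean_dq_sub hm hn hz 0
    simpa using this
  have h2 := ((hasDerivAt_compMean (m := m) (n := n) (fun k => hasDerivAt_qseq s k)).mul
    ((hasDerivAt_ell hs n).sub (hasDerivAt_ell hs (m - 1)))).congr_of_eventuallyEq hev
  rw [h1.unique h2]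
  have h3 := compMean_dq_sub hm hn hs 0
  simp only [zero_mul, sub_zero] at h3
  rw [h3]
  simp only [Pi.sub_apply]
  ring

/-- `crossMean_qseq` is an identity in the parameters, so it may be differentiated; one more
derivative treats two factors `dq`. -/
theorem crossMean_qseq_dq (hm : 2 ≤ m) (s t : ℂ) :
    crossMean m n (qseq s) (dq t) = (m - 1) * compMean m n (dq (s + t - 1)) := by
  have h1 := hasDerivAt_crossMean (m := m) (n := n) (x := qseq s) (fun k => hasDerivAt_qseq t k)
  have h2 : HasDerivAt (fun z => ((m : ℂ) - 1) * compMean m n (qseq (s + z - 1)))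
      ((m - 1) * compMean m n (dq (s + t - 1))) t := by
    refine HasDerivAt.const_mul _ (hasDerivAt_compMean fun k => ?_)
    have h3 : HasDerivAt (fun z : ℂ => s + z - 1) 1 t :=
      ((hasDerivAt_id t).const_add s).sub_const 1
    have h4 := (hasDerivAt_qseq (s + t - 1) k).comp t h3
    rw [mul_one] at h4
    exact h4
  have h3 : (fun z => crossMean m n (qseq s) (qseq z)) =
      fun z => ((m : ℂ) - 1) * compMean m n (qseq (s + z - 1)) := by
    funext z; exact crossMean_qseq hm s z
  rw [h3] at h1
  exact h1.unique h2

theorem crossMean_dq_dq (hm : 2 ≤ m) (s t : ℂ) :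
    crossMean m n (dq s) (dq t) = (m - 1) * compMean m n (ddq (s + t - 1)) := by
  have h1 := hasDerivAt_crossMean (m := m) (n := n) (x := dq t) (fun k => hasDerivAt_qseq s k)
  have h2 : HasDerivAt (fun z => ((m : ℂ) - 1) * compMean m n (dq (z + t - 1)))
      ((m - 1) * compMean m n (ddq (s + t - 1))) s := by
    refine HasDerivAt.const_mul _ (hasDerivAt_compMean fun k => ?_)
    have h3 : HasDerivAt (fun z : ℂ => z + t - 1) 1 s :=
      ((hasDerivAt_id s).add_const t).sub_const 1
    have h4 := (hasDerivAt_dq (s + t - 1) k).comp s h3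
    rw [mul_one] at h4
    exact h4
  have h3 : (fun z => crossMean m n (dq t) (qseq z)) =
      fun z => ((m : ℂ) - 1) * compMean m n (dq (z + t - 1)) := by
    funext z; rw [crossMean_comm, crossMean_qseq_dq hm z t]
  rw [h3] at h1
  rw [crossMean_comm]
  exact h1.unique h2

end Derivatives

/-! ### Simplicity of the zeros of Λ, partial fractions and initial values. -/

section IndicialRoots

open Polynomial in
/-- The indicial polynomial. -/
noncomputable def indicialPoly (m : ℕ) : ℂ[X] :=
  ∏ j ∈ Finset.range (m - 1), (X + C (j : ℂ)) - C (m.factorial : ℂ)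

/-- The set of zeros of the indicial polynomial. -/
noncomputable def indicialRoots (m : ℕ) : Finset ℂ := (indicialPoly m).roots.toFinset

theorem eval_indicialPoly (m : ℕ) (s : ℂ) :
    (indicialPoly m).eval s = risingProd m s - m.factorial := by
  simp [indicialPoly, Polynomial.eval_prod, risingProd]

theorem degree_prod_X_add (k : ℕ) :
    (∏ j ∈ Finset.range k, (Polynomial.X + Polynomial.C (j : ℂ))).degree = (k : WithBot ℕ) := by
  rw [Polynomial.degree_prod]
  simp only [Polynomial.degree_X_add_C]
  simp

theorem degree_indicialPoly {m : ℕ} (hm : 2 ≤ m) :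
    (indicialPoly m).degree = ((m - 1 : ℕ) : WithBot ℕ) := by
  unfold indicialPoly
  rw [Polynomial.degree_sub_eq_left_of_degree_lt, degree_prod_X_add]
  rw [degree_prod_X_add]
  refine Polynomial.degree_C_le.trans_lt ?_
  exact_mod_cast (show 0 < m - 1 by omega)

theorem monic_indicialPoly {m : ℕ} (hm : 2 ≤ m) : (indicialPoly m).Monic := by
  unfold indicialPoly
  apply Polynomial.Monic.sub_of_left
  · exact Polynomial.monic_prod_of_monic _ _ fun j _ => Polynomial.monic_X_add_C _
  · rw [degree_prod_X_add]
    refine Polynomial.degree_C_le.trans_lt ?_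
    exact_mod_cast (show 0 < m - 1 by omega)

theorem mem_indicialRoots {m : ℕ} (hm : 2 ≤ m) {s : ℂ} :
    s ∈ indicialRoots m ↔ risingProd m s = m.factorial := by
  rw [indicialRoots, Multiset.mem_toFinset, Polynomial.mem_roots (monic_indicialPoly hm).ne_zero,
    Polynomial.IsRoot, eval_indicialPoly, sub_eq_zero]

theorem eval_derivative_indicialPoly {m : ℕ} {s : ℂ} (hs : risingProd m s ≠ 0) :
    (Polynomial.derivative (indicialPoly m)).eval s = risingProd m s * ell s (m - 1) := by
  have h1 := (indicialPoly m).hasDerivAt s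
  have h2 : (fun x => (indicialPoly m).eval x) = fun x => risingProd m x - m.factorial := by
    funext x; exact eval_indicialPoly m x
  rw [h2] at h1
  exact h1.unique ((hasDerivAt_risingProd hs).sub_const _)

/-- Rules out real zeros of Λ in [-(m-2), 0], the one place where the sign argument for simplicity
fails. -/
theorem abs_prod_sub_le_factorial (r : ℕ) (t : ℝ) (h0 : 0 ≤ t) (hr : t ≤ r) :
    |∏ j ∈ Finset.range (r + 1), (t - j)| ≤ r.factorial := by
  induction r with
  | zero =>
    have : t = 0 := le_antisymm (by simpa using hr) h0
    simp [this]
  | succ r ih =>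
    rw [Finset.prod_range_succ, abs_mul]
    push_cast at hr ⊢
    rcases le_or_gt t r with h | h
    · have h1 : |t - ((r : ℝ) + 1)| ≤ r + 1 := by
        rw [abs_le]; constructor <;> linarith
      rw [Nat.factorial_succ]
      push_cast
      rw [mul_comm ((r : ℝ) + 1)]
      exact mul_le_mul (ih h) h1 (abs_nonneg _) (by positivity)
    · have h1 : |t - ((r : ℝ) + 1)| ≤ 1 := by
        rw [abs_le]; constructor <;> linarith
      have h2 : |∏ j ∈ Finset.range (r + 1), (t - j)| ≤ (r + 1).factorial := by
        rw [← Finset.prod_range_add_one_eq_factorial, Finset.abs_prod, ← Finset.prod_range_reflect]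
        push_cast
        refine Finset.prod_le_prod (fun i _ => abs_nonneg _) fun i hi => ?_
        have hi' : i ≤ r := Nat.lt_succ_iff.1 (Finset.mem_range.1 hi)
        have hi'' : (i : ℝ) ≤ r := by exact_mod_cast hi'
        have : ((r - i : ℕ) : ℝ) = r - i := by push_cast [hi']; ring
        rw [this, abs_le]
        constructor <;> linarith
      calc _ ≤ ((r + 1).factorial : ℝ) * 1 := mul_le_mul h2 h1 (abs_nonneg _) (by positivity)
        _ = _ := by rw [mul_one]

/-- The sum of the 1/(s + j) is the logarithmic derivative of the product, so its nonvanishing makes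
the zeros simple. For nonreal `s` all imaginary parts have one sign; for real `s` outside [-(m-2),
0] all terms have one sign; and on that interval the product is at most (m-2)! < m! in modulus. -/
theorem ell_ne_zero_of_root {m : ℕ} (hm : 3 ≤ m) {s : ℂ} (hs : risingProd m s = m.factorial) :
    ell s (m - 1) ≠ 0 := by
  have hne : ∀ j ∈ Finset.range (m - 1), s + (j : ℂ) ≠ 0 := by
    intro j hj h
    have h1 : risingProd m s = 0 := Finset.prod_eq_zero hj h
    rw [h1] at hs
    exact (Nat.factorial_ne_zero m) (by exact_mod_cast hs.symm)
  have hpos : ∀ j ∈ Finset.range (m - 1), 0 < Complex.normSq (s + (j : ℂ)) :=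
    fun j hj => Complex.normSq_pos.2 (hne j hj)
  have hnonempty : (Finset.range (m - 1)).Nonempty := ⟨0, Finset.mem_range.2 (by omega)⟩
  have hre : (ell s (m - 1)).re =
      ∑ j ∈ Finset.range (m - 1), (s.re + j) / Complex.normSq (s + (j : ℂ)) := by
    simp [ell, Complex.inv_re]
  have him : (ell s (m - 1)).im =
      ∑ j ∈ Finset.range (m - 1), (-s.im) / Complex.normSq (s + (j : ℂ)) := by
    simp [ell, Complex.inv_im]
  intro h0
  rcases lt_trichotomy s.im 0 with h | h | h
  · have : 0 < (ell s (m - 1)).im := by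
      rw [him]
      exact Finset.sum_pos (fun j hj => div_pos (by linarith) (hpos j hj)) hnonempty
    rw [h0] at this; simp at this
  · rcases lt_or_ge 0 s.re with hx | hx
    · have : 0 < (ell s (m - 1)).re := by
        rw [hre]
        exact Finset.sum_pos (fun j hj => div_pos (by positivity) (hpos j hj)) hnonempty
      rw [h0] at this; simp at this
    · rcases lt_or_ge s.re (-((m - 2 : ℕ) : ℝ)) with hx' | hx'
      · have : 0 < -(ell s (m - 1)).re := by
          rw [hre, ← Finset.sum_neg_distrib]
          refine Finset.sum_pos (fun j hj => ?_) hnonempty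
          rw [← neg_div]
          refine div_pos ?_ (hpos j hj)
          have : (j : ℝ) ≤ ((m - 2 : ℕ) : ℝ) := by
            have := Finset.mem_range.1 hj
            exact_mod_cast (show j ≤ m - 2 by omega)
          linarith
        rw [h0] at this; simp at this
      · have h1 := abs_prod_sub_le_factorial (m - 2) (-s.re) (by linarith) (by linarith)
        have h2 : ‖risingProd m s‖ = |∏ j ∈ Finset.range (m - 2 + 1), (-s.re - j)| := by
          have e : s = (s.re : ℂ) := by
            apply Complex.ext <;> simp [h]
          rw [risingProd, norm_prod, Finset.abs_prod, show m - 2 + 1 = m - 1 by omega]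
          refine Finset.prod_congr rfl fun j _ => ?_
          rw [e, show ((s.re : ℂ) + (j : ℂ)) = ((s.re + j : ℝ) : ℂ) by push_cast; rfl,
            Complex.norm_real, Real.norm_eq_abs, ← abs_neg, Complex.ofReal_re]
          congr 1; ring
        rw [← h2, hs, Complex.norm_natCast] at h1
        have h3 : (m - 2).factorial < m.factorial := (Nat.factorial_lt (by omega)).2 (by omega)
        have h4 : m.factorial ≤ (m - 2).factorial := by exact_mod_cast h1
        omega
  · have : 0 < -(ell s (m - 1)).im := by
      rw [him, ← Finset.sum_neg_distrib]
      refine Finset.sum_pos (fun j hj => ?_) hnonempty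
      rw [← neg_div, neg_neg]
      exact div_pos h (hpos j hj)
    rw [h0] at this; simp at this

theorem roots_indicialPoly_nodup {m : ℕ} (hm : 3 ≤ m) : (indicialPoly m).roots.Nodup := by
  classical
  rw [Multiset.nodup_iff_count_le_one]
  intro s
  rw [Polynomial.count_roots]
  by_contra h
  push Not at h
  have h1 := (Polynomial.one_lt_rootMultiplicity_iff_isRoot
    (monic_indicialPoly (by omega : 2 ≤ m)).ne_zero).1 h
  have h2 : risingProd m s = m.factorial := by
    have := h1.1
    rwa [Polynomial.IsRoot, eval_indicialPoly, sub_eq_zero] at this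
  have hne : risingProd m s ≠ 0 := by
    rw [h2]; exact_mod_cast Nat.factorial_ne_zero m
  have h3 := h1.2
  rw [Polynomial.IsRoot, eval_derivative_indicialPoly hne] at h3
  exact (mul_ne_zero hne (ell_ne_zero_of_root hm h2)) h3

theorem nodal_indicialRoots {m : ℕ} (hm : 3 ≤ m) :
    Lagrange.nodal (indicialRoots m) id = indicialPoly m := by
  have h1 := (IsAlgClosed.splits (indicialPoly m)).eq_prod_roots
  rw [(monic_indicialPoly (by omega)).leadingCoeff, Polynomial.C_1, one_mul] at h1
  conv_rhs => rw [h1]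
  rw [Lagrange.nodal_eq, indicialRoots]
  rw [Finset.prod_eq_multiset_prod, Multiset.toFinset_val,
    (roots_indicialPoly_nodup hm).dedup]
  rfl

theorem card_indicialRoots {m : ℕ} (hm : 3 ≤ m) : (indicialRoots m).card = m - 1 := by
  have h := Lagrange.degree_nodal (s := indicialRoots m) (v := (id : ℂ → ℂ))
  rw [nodal_indicialRoots hm, degree_indicialPoly (by omega)] at h
  exact_mod_cast h.symm

/-- Lagrange interpolation of `f` at the zeros. The node weights are the inverse derivatives of the
indicial polynomial, which at a zero equal m! times `ell`. -/
theorem sum_partial_fractions {m : ℕ} (hm : 3 ≤ m) (f : Polynomial ℂ)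
    (hf : f.degree < ((m - 1 : ℕ) : WithBot ℕ)) (x : ℂ) (hx : x ∉ indicialRoots m) :
    ∑ z ∈ indicialRoots m, f.eval z / (m.factorial * ell z (m - 1) * (x - z)) =
      f.eval x / (risingProd m x - m.factorial) := by
  have hx0 : risingProd m x - m.factorial ≠ 0 := fun h =>
    hx ((mem_indicialRoots (by omega)).2 (sub_eq_zero.1 h))
  have h1 := Lagrange.eq_interpolate (s := indicialRoots m) (v := (id : ℂ → ℂ)) (f := f)
    (Function.injective_id.injOn) (by rwa [card_indicialRoots hm])
  have h2 := Lagrange.eval_interpolate_not_at_node (s := indicialRoots m) (v := (id : ℂ → ℂ))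
    (r := fun i => f.eval (id i)) (x := x) (fun i hi h => hx (h ▸ hi))
  rw [← h1, nodal_indicialRoots hm, eval_indicialPoly] at h2
  rw [h2, mul_div_cancel_left₀ _ hx0]
  refine Finset.sum_congr rfl fun z hz => ?_
  have hz' := (mem_indicialRoots (by omega)).1 hz
  rw [Lagrange.nodalWeight_eq_eval_derivative_nodal hz, nodal_indicialRoots hm, id,
    eval_derivative_indicialPoly, hz']
  · rw [div_eq_mul_inv, mul_inv]; ring
  · rw [hz']; exact_mod_cast Nat.factorial_ne_zero m

theorem two_mem_indicialRoots {m : ℕ} (hm : 2 ≤ m) : (2 : ℂ) ∈ indicialRoots m := by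
  rw [mem_indicialRoots hm, risingProd]
  obtain ⟨k, rfl⟩ := Nat.exists_eq_add_of_le hm
  rw [show 2 + k - 1 = k + 1 by omega, add_comm 2 k, ← Finset.prod_range_add_one_eq_factorial,
    Finset.prod_range_succ' _ (k + 1)]
  push_cast
  simp only [mul_one]
  refine Finset.prod_congr rfl fun j _ => ?_
  ring

/-- Arbitrary initial values are matched by a linear combination of the sequences `qseq z`. -/
theorem exists_coeff_initial {m : ℕ} (hm : 3 ≤ m) (u : ℕ → ℂ) :
    ∃ d : ℂ → ℂ, ∀ n < m - 1, ∑ z ∈ indicialRoots m, d z * qseq z n = u n := by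
  classical
  let e : Fin (m - 1) ≃ indicialRoots m :=
    ((indicialRoots m).equivFinOfCardEq (card_indicialRoots hm)).symm
  let v : Fin (m - 1) → ℂ := fun i => (e i : ℂ)
  have hv : Function.Injective v := Subtype.val_injective.comp e.injective
  let T : (Fin (m - 1) → ℂ) →ₗ[ℂ] (Fin (m - 1) → ℂ) :=
    { toFun := fun d n => ∑ i, d i * qseq (v i) n
      map_add' := by
        intro a b; funext n; simp [add_mul, Finset.sum_add_distrib]
      map_smul' := by
        intro a b; funext n; simp [Finset.mul_sum, mul_assoc] }
  have hT : Function.Injective T := by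
    rw [injective_iff_map_eq_zero]
    intro d hd
    have h0 : ∀ n < m - 1, ∑ i, d i * qseq (v i) n = 0 := fun n hn => congrFun hd ⟨n, hn⟩
    -- The recurrence v · qseq v n = (n + 1) qseq v (n + 1) - n · qseq v n trades an index for a
    -- power of `v`, so all power sums up to degree `m - 2` vanish and the Vandermonde matrix
    -- finishes.
    have h1 : ∀ k n, n + k < m - 1 → ∑ i, d i * ((v i) ^ k * qseq (v i) n) = 0 := by
      intro k
      induction k with
      | zero => intro n hn; simpa using h0 n hn
      | succ k ih =>
        intro n hn
        have e1 := ih (n + 1) (by omega)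
        have e2 := ih n (by omega)
        have e3 : ∀ i, d i * ((v i) ^ (k + 1) * qseq (v i) n) =
            ((n : ℂ) + 1) * (d i * ((v i) ^ k * qseq (v i) (n + 1))) -
            n * (d i * ((v i) ^ k * qseq (v i) n)) := by
          intro i
          have := qseq_succ (v i) n
          linear_combination (- d i * (v i) ^ k) * this
        simp only [e3, Finset.sum_sub_distrib, ← Finset.mul_sum, e1, e2]
        simp
    apply Matrix.eq_zero_of_forall_pow_sum_mul_pow_eq_zero hv
    intro k
    have := h1 k 0 (by simp)
    simpa [qseq_zero] using this
  obtain ⟨d, hd⟩ := (LinearMap.injective_iff_surjective.1 hT) (fun n => u n)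
  refine ⟨fun z => if h : z ∈ indicialRoots m then d (e.symm ⟨z, h⟩) else 0, fun n hn => ?_⟩
  have h1 := congrFun hd ⟨n, hn⟩
  rw [← Finset.sum_coe_sort (indicialRoots m), ← e.sum_comp]
  simp only [Subtype.coe_eta, Equiv.symm_apply_apply, Finset.coe_mem, dif_pos]
  exact h1

theorem coeffA_eq (m : ℕ) (s : ℂ) : coeffA m s = 1 / (s * (s - 1) * ell s (m - 1)) := by
  unfold coeffA ell
  congr 2
  exact Finset.sum_congr rfl fun j _ => by rw [add_comm]

theorem risingProd_one (m : ℕ) : risingProd m 1 = (m - 1).factorial := by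
  rw [risingProd, ← Finset.prod_range_add_one_eq_factorial]
  push_cast
  exact Finset.prod_congr rfl fun j _ => add_comm _ _

/-- The coefficients `coeffA` match the initial values of the mean size, up to a shift. -/
theorem sum_coeffA_initial {m : ℕ} (hm : 3 ≤ m) (n : ℕ) (hn : n < m - 1) :
    ∑ z ∈ indicialRoots m, coeffA m z * qseq z n = (if n = 0 then 0 else 1) + 1 / ((m : ℂ) - 1) := by
  have hm1 : (m : ℂ) - 1 ≠ 0 := by
    rw [sub_ne_zero]; exact_mod_cast (show m ≠ 1 by omega)
  have hmf : (m.factorial : ℂ) = m * (m - 1).factorial := by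
    exact_mod_cast (Nat.mul_factorial_pred (by omega)).symm
  have hm1f : ((m - 1).factorial : ℂ) ≠ 0 := by exact_mod_cast Nat.factorial_ne_zero _
  have hm0 : (m : ℂ) ≠ 0 := by exact_mod_cast (show m ≠ 0 by omega)
  have h1 : (1 : ℂ) ∉ indicialRoots m := by
    rw [mem_indicialRoots (by omega), risingProd_one]
    intro h
    have h' : (m - 1).factorial = m.factorial := by exact_mod_cast h
    have := (Nat.factorial_lt (by omega : 0 < m - 1)).2 (by omega : m - 1 < m)
    omega
  have h0 : (0 : ℂ) ∉ indicialRoots m := by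
    rw [mem_indicialRoots (by omega)]
    intro h
    have : risingProd m 0 = 0 :=
      Finset.prod_eq_zero (Finset.mem_range.2 (show 0 < m - 1 by omega)) (by simp)
    rw [this] at h
    exact Nat.factorial_ne_zero m (by exact_mod_cast h.symm)
  have hΛ1 : risingProd m 1 - m.factorial = -((m : ℂ) - 1) * (m - 1).factorial := by
    rw [risingProd_one, hmf]; ring
  have hz : ∀ z ∈ indicialRoots m, z ≠ 0 ∧ z - 1 ≠ 0 ∧ ell z (m - 1) ≠ 0 := fun z hz =>
    ⟨fun h => h0 (h ▸ hz), fun h => h1 ((sub_eq_zero.1 h) ▸ hz),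
      ell_ne_zero_of_root hm ((mem_indicialRoots (by omega)).1 hz)⟩
  have hmf0 : (m.factorial : ℂ) ≠ 0 := by exact_mod_cast Nat.factorial_ne_zero _
  have hconst : ((1 : Polynomial ℂ)).degree < ((m - 1 : ℕ) : WithBot ℕ) := by
    rw [Polynomial.degree_one]; exact_mod_cast (show 0 < m - 1 by omega)
  rcases Nat.eq_zero_or_pos n with rfl | hpos
  -- Here 1/(z(z - 1)) = 1/(z - 1) - 1/z, so partial fractions are evaluated at both 1 and 0.
  · have e1 := sum_partial_fractions hm 1 hconst 1 h1
    have e0 := sum_partial_fractions hm 1 hconst 0 h0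
    have hr0 : risingProd m 0 = 0 :=
      Finset.prod_eq_zero (Finset.mem_range.2 (show 0 < m - 1 by omega)) (by simp)
    rw [hΛ1] at e1
    rw [hr0] at e0
    simp only [Polynomial.eval_one] at e0 e1
    have key : ∀ z ∈ indicialRoots m, coeffA m z * qseq z 0 =
        m.factorial * (1 / (m.factorial * ell z (m - 1) * (0 - z))) -
        m.factorial * (1 / (m.factorial * ell z (m - 1) * (1 - z))) := by
      intro z hz'
      obtain ⟨a, b, c⟩ := hz z hz'
      have b' : 1 - z ≠ 0 := fun h => b (by linear_combination -h)
      rw [coeffA_eq, qseq_zero]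
      have : (0 : ℂ) - z ≠ 0 := by simpa using a
      field_simp
      ring
    rw [Finset.sum_congr rfl key, Finset.sum_sub_distrib, ← Finset.mul_sum, ← Finset.mul_sum,
      e0, e1, hmf]
    simp only [if_true]
    field_simp
    ring
  · obtain ⟨k, rfl⟩ := Nat.exists_eq_add_of_le hpos
    have hk : ((k + 1 : ℕ) : ℂ) ≠ 0 := by exact_mod_cast k.succ_ne_zero
    -- For positive index `qseq z` is divisible by `z`. This cancels the pole of `coeffA` at 0, and
    -- only the evaluation at 1 remains.
    obtain ⟨f, hfd, hf⟩ : ∃ f : Polynomial ℂ, f.degree = (k : WithBot ℕ) ∧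
        ∀ s, s * f.eval s = qseq s (1 + k) := by
      have hc : (((k + 1).factorial : ℂ)⁻¹) ≠ 0 :=
        inv_ne_zero (by exact_mod_cast Nat.factorial_ne_zero _)
      refine ⟨Polynomial.C (((k + 1).factorial : ℂ)⁻¹) *
        ∏ j ∈ Finset.range k, (Polynomial.X + Polynomial.C ((j + 1 : ℕ) : ℂ)), ?_, fun s => ?_⟩
      · rw [Polynomial.degree_C_mul hc, Polynomial.degree_prod]
        simp only [Polynomial.degree_X_add_C]
        simp
      · rw [add_comm 1 k, qseq, Finset.prod_range_succ']
        simp [Polynomial.eval_prod, div_eq_inv_mul]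
        ring
    have hf1 : f.eval 1 = 1 := by
      have := hf 1
      rwa [one_mul, qseq_one] at this
    have e1 := sum_partial_fractions hm f (by
      rw [hfd]; exact_mod_cast (show k < m - 1 by omega)) 1 h1
    rw [hΛ1, hf1] at e1
    have key : ∀ z ∈ indicialRoots m, coeffA m z * qseq z (1 + k) =
        -m.factorial * (f.eval z / (m.factorial * ell z (m - 1) * (1 - z))) := by
      intro z hz'
      obtain ⟨a, b, c⟩ := hz z hz'
      have b' : 1 - z ≠ 0 := fun h => b (by linear_combination -h)
      rw [coeffA_eq, ← hf]
      field_simp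
      ring
    rw [Finset.sum_congr rfl key, ← Finset.mul_sum, e1, hmf, if_neg (by omega)]
    field_simp
    ring

theorem coeffA_two {m : ℕ} (hm : 2 ≤ m) : coeffA m 2 = (occ m : ℂ) := by
  have h : ∑ j ∈ Finset.range (m - 1), 1 / ((j : ℂ) + 2) = ((harm 1 m - 1 : ℝ) : ℂ) := by
    obtain ⟨k, rfl⟩ := Nat.exists_eq_add_of_le hm
    have h1 : harm 1 (2 + k) = 1 + ∑ j ∈ Finset.range (k + 1), 1 / ((j : ℝ) + 2) := by
      unfold harm
      rw [← Finset.Ico_add_one_right_eq_Icc, Finset.sum_Ico_eq_sum_range,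
        show 2 + k + 1 - 1 = k + 1 + 1 by omega, Finset.sum_range_succ', add_comm]
      congr 1
      · simp
      · refine Finset.sum_congr rfl fun j _ => ?_
        push_cast; rw [pow_one]; congr 1; ring
    rw [h1, show 2 + k - 1 = k + 1 by omega]
    push_cast
    ring
  unfold coeffA occ
  rw [h]
  push_cast
  congr 1
  ring

end IndicialRoots

/-! ### Location of the zeros of Λ and the threshold 3/2. -/

section RootLocation

theorem arctan_le_poly {t : ℝ} (ht : 0 ≤ t) : Real.arctan t ≤ t - t ^ 3 / 3 + t ^ 5 / 5 := by
  have hd : ∀ x : ℝ, HasDerivAt (fun x => x - x ^ 3 / 3 + x ^ 5 / 5 - Real.arctan x)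
      (1 - x ^ 2 + x ^ 4 - 1 / (1 + x ^ 2)) x := by
    intro x
    have h := ((((hasDerivAt_id x).sub (((hasDerivAt_pow 3 x)).div_const 3)).add
      ((hasDerivAt_pow 5 x).div_const 5)).sub (Real.hasDerivAt_arctan x))
    refine h.congr_deriv ?_
    norm_num
  have hmono : MonotoneOn (fun x => x - x ^ 3 / 3 + x ^ 5 / 5 - Real.arctan x) (Set.Ici 0) := by
    apply monotoneOn_of_deriv_nonneg (convex_Ici 0)
    · exact fun x _ => (hd x).continuousAt.continuousWithinAt
    · exact fun x _ => (hd x).differentiableAt.differentiableWithinAt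
    · intro x _
      rw [(hd x).deriv]
      have : 1 - x ^ 2 + x ^ 4 - 1 / (1 + x ^ 2) = x ^ 6 / (1 + x ^ 2) := by
        have : (1 + x ^ 2) ≠ 0 := by positivity
        field_simp; ring
      rw [this]; positivity
  have := hmono (Set.mem_Ici.2 le_rfl) (Set.mem_Ici.2 ht) ht
  simp at this
  linarith

theorem le_arctan_poly {t : ℝ} (ht : 0 ≤ t) : t - t ^ 3 / 3 ≤ Real.arctan t := by
  have hd : ∀ x : ℝ, HasDerivAt (fun x => Real.arctan x - (x - x ^ 3 / 3))
      (1 / (1 + x ^ 2) - (1 - x ^ 2)) x := by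
    intro x
    have h := (Real.hasDerivAt_arctan x).sub ((hasDerivAt_id x).sub ((hasDerivAt_pow 3 x).div_const 3))
    refine h.congr_deriv ?_
    norm_num
  have hmono : MonotoneOn (fun x => Real.arctan x - (x - x ^ 3 / 3)) (Set.Ici 0) := by
    apply monotoneOn_of_deriv_nonneg (convex_Ici 0)
    · exact fun x _ => (hd x).continuousAt.continuousWithinAt
    · exact fun x _ => (hd x).differentiableAt.differentiableWithinAt
    · intro x _
      rw [(hd x).deriv]
      have : 1 / (1 + x ^ 2) - (1 - x ^ 2) = x ^ 4 / (1 + x ^ 2) := by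
        have : (1 + x ^ 2) ≠ 0 := by positivity
        field_simp; ring
      rw [this]; positivity
  have := hmono (Set.mem_Ici.2 le_rfl) (Set.mem_Ici.2 ht) ht
  simp at this
  linarith

/-- Moves arguments near 1, where the Taylor bounds are too weak, to small ones. -/
theorem arctan_eq_pi_div_four_sub {t : ℝ} (ht : 0 < t) :
    Real.arctan t = Real.pi / 4 - Real.arctan ((1 - t) / (1 + t)) := by
  have h1 : t * ((1 - t) / (1 + t)) < 1 := by
    rw [mul_div_assoc', div_lt_one (by positivity)]
    nlinarith [sq_nonneg t]
  have h := Real.arctan_add h1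
  have h2 : (t + (1 - t) / (1 + t)) / (1 - t * ((1 - t) / (1 + t))) = 1 := by
    have : (1 + t) ≠ 0 := by positivity
    have h3 : 1 + t * t ≠ 0 := by positivity
    have h4 : 1 - t * ((1 - t) / (1 + t)) = (1 + t * t) / (1 + t) := by field_simp; ring
    rw [h4]
    field_simp
    ring
  rw [h2, Real.arctan_one] at h
  linarith


/-- By `modSq_small`, 551/250 bounds the imaginary part of a zero with real part at least 3/2 when
`m ≤ 26`; the 25 terms are the factors for `m = 26`. The margin is small, so the first three terms
are rewritten through π/4. -/
theorem arctan_sum_lt :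
    ∑ j ∈ Finset.range 25, Real.arctan ((551 / 250 : ℝ) / (3 / 2 + (j : ℕ))) < 2 * Real.pi := by
  have hpi := Real.pi_gt_d6
  rw [← Finset.sum_range_add_sum_Ico _ (show 3 ≤ 25 by norm_num)]
  have h1 : ∑ j ∈ Finset.Ico (3 : ℕ) 25, Real.arctan ((551 / 250 : ℝ) / (3 / 2 + (j : ℝ))) ≤
      ∑ j ∈ Finset.Ico (3 : ℕ) 25, (((551 / 250 : ℝ) / (3 / 2 + (j : ℝ))) - ((551 / 250 : ℝ) / (3 / 2 + (j : ℝ))) ^ 3 / 3 + ((551 / 250 : ℝ) / (3 / 2 + (j : ℝ))) ^ 5 / 5) :=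
    Finset.sum_le_sum fun j _ => arctan_le_poly (by positivity)
  have h2 : ∑ j ∈ Finset.Ico (3 : ℕ) 25, (((551 / 250 : ℝ) / (3 / 2 + (j : ℝ))) - ((551 / 250 : ℝ) / (3 / 2 + (j : ℝ))) ^ 3 / 3 + ((551 / 250 : ℝ) / (3 / 2 + (j : ℝ))) ^ 5 / 5) ≤ 4.0224 := by
    rw [Finset.sum_Ico_eq_sum_range]
    simp only [Finset.sum_range_succ, Finset.sum_range_zero]
    norm_num
  have b0 := arctan_le_poly (show (0 : ℝ) ≤ 88 / 463 by norm_num)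
  have b1 := le_arctan_poly (show (0 : ℝ) ≤ 37 / 588 by norm_num)
  have b2 := le_arctan_poly (show (0 : ℝ) ≤ 162 / 713 by norm_num)
  have a0 := arctan_eq_pi_div_four_sub (show (0 : ℝ) < 551 / 375 by norm_num)
  rw [show (1 - (551 / 375 : ℝ)) / (1 + 551 / 375) = -(88 / 463) by norm_num] at a0
  have a1 := arctan_eq_pi_div_four_sub (show (0 : ℝ) < 551 / 625 by norm_num)
  rw [show (1 - (551 / 625 : ℝ)) / (1 + 551 / 625) = 37 / 588 by norm_num] at a1
  have a2 := arctan_eq_pi_div_four_sub (show (0 : ℝ) < 551 / 875 by norm_num)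
  rw [show (1 - (551 / 875 : ℝ)) / (1 + 551 / 875) = 162 / 713 by norm_num] at a2
  rw [Real.arctan_neg] at a0
  have h3 : ∑ j ∈ Finset.range 3, Real.arctan ((551 / 250 : ℝ) / (3 / 2 + (j : ℝ))) =
      Real.arctan (551 / 375) + Real.arctan (551 / 625) + Real.arctan (551 / 875) := by
    simp only [Finset.sum_range_succ, Finset.sum_range_zero]
    norm_num
  rw [h3, a0, a1, a2]
  norm_num at b0 b1 b2
  linarith

/-- The counterpart for `m = 27`, with 26 terms: by `modSq_large` the level curve of modulus m!
meets Re s = 3/2 at height at least 11/5. -/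
theorem lt_arctan_sum :
    2 * Real.pi < ∑ j ∈ Finset.range 26, Real.arctan ((11 / 5 : ℝ) / (3 / 2 + (j : ℕ))) := by
  have hpi := Real.pi_lt_d6
  rw [← Finset.sum_range_add_sum_Ico _ (show 3 ≤ 26 by norm_num)]
  have h1 : ∑ j ∈ Finset.Ico (3 : ℕ) 26, (((11 / 5 : ℝ) / (3 / 2 + (j : ℝ))) - ((11 / 5 : ℝ) / (3 / 2 + (j : ℝ))) ^ 3 / 3) ≤
      ∑ j ∈ Finset.Ico (3 : ℕ) 26, Real.arctan ((11 / 5 : ℝ) / (3 / 2 + (j : ℝ))) :=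
    Finset.sum_le_sum fun j _ => le_arctan_poly (by positivity)
  have h2 : 4.0886 ≤ ∑ j ∈ Finset.Ico (3 : ℕ) 26, (((11 / 5 : ℝ) / (3 / 2 + (j : ℝ))) - ((11 / 5 : ℝ) / (3 / 2 + (j : ℝ))) ^ 3 / 3) := by
    rw [Finset.sum_Ico_eq_sum_range]
    simp only [Finset.sum_range_succ, Finset.sum_range_zero]
    norm_num
  have b0 := le_arctan_poly (show (0 : ℝ) ≤ 7 / 37 by norm_num)
  have b1 := arctan_le_poly (show (0 : ℝ) ≤ 3 / 47 by norm_num)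
  have b2 := arctan_le_poly (show (0 : ℝ) ≤ 13 / 57 by norm_num)
  have a0 := arctan_eq_pi_div_four_sub (show (0 : ℝ) < 22 / 15 by norm_num)
  rw [show (1 - (22 / 15 : ℝ)) / (1 + 22 / 15) = -(7 / 37) by norm_num] at a0
  have a1 := arctan_eq_pi_div_four_sub (show (0 : ℝ) < 22 / 25 by norm_num)
  rw [show (1 - (22 / 25 : ℝ)) / (1 + 22 / 25) = 3 / 47 by norm_num] at a1
  have a2 := arctan_eq_pi_div_four_sub (show (0 : ℝ) < 22 / 35 by norm_num)
  rw [show (1 - (22 / 35 : ℝ)) / (1 + 22 / 35) = 13 / 57 by norm_num] at a2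
  rw [Real.arctan_neg] at a0
  have h3 : ∑ j ∈ Finset.range 3, Real.arctan ((11 / 5 : ℝ) / (3 / 2 + (j : ℝ))) =
      Real.arctan (22 / 15) + Real.arctan (22 / 25) + Real.arctan (22 / 35) := by
    simp only [Finset.sum_range_succ, Finset.sum_range_zero]
    norm_num
  rw [h3, a0, a1, a2]
  norm_num at b0 b1 b2
  linarith


/-- The squared modulus of `risingProd m (x + i y)`. -/
noncomputable def modSq (m : ℕ) (x y : ℝ) : ℝ :=
  ∏ j ∈ Finset.range (m - 1), ((x + (j : ℕ)) ^ 2 + y ^ 2)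

/-- The argument of `risingProd m (x + i y)`. -/
noncomputable def argSum (m : ℕ) (x y : ℝ) : ℝ :=
  ∑ j ∈ Finset.range (m - 1), Real.arctan (y / (x + (j : ℕ)))

theorem normSq_risingProd (m : ℕ) (s : ℂ) :
    Complex.normSq (risingProd m s) = modSq m s.re s.im := by
  rw [risingProd, map_prod, modSq]
  refine Finset.prod_congr rfl fun j _ => ?_
  simp [Complex.normSq_apply]
  ring

theorem modSq_mono (m : ℕ) {x x' y y' : ℝ} (hx : 0 < x) (hxx : x ≤ x') (hy : 0 ≤ y)
    (hyy : y ≤ y') : modSq m x y ≤ modSq m x' y' :=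
  Finset.prod_le_prod (fun j _ => by positivity) fun j _ => by gcongr

theorem modSq_strictMono {m : ℕ} (hm : 2 ≤ m) {x x' y y' : ℝ} (hx : 0 < x) (hxx : x ≤ x')
    (hy : 0 ≤ y) (hyy : y ≤ y') (h : x < x' ∨ y < y') : modSq m x y < modSq m x' y' := by
  refine Finset.prod_lt_prod_of_nonempty (fun j _ => by positivity) (fun j _ => ?_)
    ⟨0, Finset.mem_range.2 (by omega)⟩
  have hj : (0 : ℝ) ≤ j := j.cast_nonneg
  rcases h with h | h
  · have : (x + (j : ℕ)) ^ 2 < (x' + (j : ℕ)) ^ 2 := by gcongr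
    have : y ^ 2 ≤ y' ^ 2 := by gcongr
    linarith
  · have : (x + (j : ℕ)) ^ 2 ≤ (x' + (j : ℕ)) ^ 2 := by gcongr
    have : y ^ 2 < y' ^ 2 := by gcongr
    linarith

theorem modSq_two_zero {m : ℕ} (hm : 2 ≤ m) : modSq m 2 0 = (m.factorial : ℝ) ^ 2 := by
  have h := normSq_risingProd m 2
  rw [(mem_indicialRoots hm).1 (two_mem_indicialRoots hm), Complex.normSq_natCast] at h
  simp at h
  rw [← h, sq]

theorem modSq_of_root {m : ℕ} {s : ℂ} (hs : risingProd m s = m.factorial) :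
    modSq m s.re |s.im| = (m.factorial : ℝ) ^ 2 := by
  have h := normSq_risingProd m s
  rw [hs, Complex.normSq_natCast] at h
  rw [sq, h]
  simp [modSq]

/-- For Re s > 0 each factor has its argument in (-π/2, π/2), so `argSum` is a continuous, unreduced
argument that can be compared with 2π. -/
theorem risingProd_polar (m : ℕ) {s : ℂ} (hs : 0 < s.re) :
    risingProd m s = (√(modSq m s.re s.im) : ℂ) * Complex.exp (argSum m s.re s.im * Complex.I) := by
  have hfac : ∀ j : ℕ, s + (j : ℂ) = (√((s.re + j) ^ 2 + s.im ^ 2) : ℂ) *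
      Complex.exp ((Real.arctan (s.im / (s.re + j)) : ℂ) * Complex.I) := by
    intro j
    have hp : 0 < s.re + j := by positivity
    have h1 : √((s.re + j) ^ 2 + s.im ^ 2) = (s.re + j) * √(1 + (s.im / (s.re + j)) ^ 2) := by
      rw [← Real.sqrt_sq hp.le, ← Real.sqrt_mul (by positivity), Real.sqrt_sq hp.le]
      congr 1; field_simp
    have h2 : √(1 + (s.im / (s.re + j)) ^ 2) ≠ 0 := by positivity
    rw [Complex.exp_mul_I, ← Complex.ofReal_cos, ← Complex.ofReal_sin, Real.cos_arctan,
      Real.sin_arctan, h1]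
    apply Complex.ext
    · simp only [Complex.add_re, Complex.natCast_re, Complex.re_ofReal_mul, Complex.ofReal_re,
        Complex.re_ofReal_mul, Complex.I_re, mul_zero, add_zero]
      field_simp
    · simp only [Complex.add_im, Complex.natCast_im, Complex.im_ofReal_mul, Complex.ofReal_im,
        Complex.I_im, mul_one, zero_add]
      field_simp
      simp
  rw [risingProd, Finset.prod_congr rfl (fun j _ => hfac j), Finset.prod_mul_distrib,
    ← Complex.exp_sum, ← Finset.sum_mul, modSq, Real.sqrt_prod _ (fun j _ => by positivity), argSum]
  push_cast
  rfl

/-- For Re s > 0 the modulus is strictly increasing in Re s and in |Im s|, and it already equals m!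
at 2. -/
theorem eq_two_of_two_le_re {m : ℕ} (hm : 2 ≤ m) {s : ℂ} (hs : risingProd m s = m.factorial)
    (h : 2 ≤ s.re) : s = 2 := by
  have h1 := modSq_of_root hs
  rw [← modSq_two_zero hm] at h1
  by_contra hne
  have : 2 < s.re ∨ 0 < |s.im| := by
    by_contra hc
    push Not at hc
    apply hne
    apply Complex.ext
    · simp; linarith [hc.1]
    · simpa using hc.2
  have := modSq_strictMono hm two_pos h le_rfl (abs_nonneg s.im) this
  linarith

theorem eq_two_of_im_eq_zero {m : ℕ} (hm : 2 ≤ m) {s : ℂ} (hs : risingProd m s = m.factorial)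
    (h0 : 0 < s.re) (h : s.im = 0) : s = 2 := by
  apply eq_two_of_two_le_re hm hs
  by_contra hlt
  push Not at hlt
  have h1 := modSq_of_root hs
  rw [← modSq_two_zero hm, h, abs_zero] at h1
  have := modSq_strictMono hm h0 hlt.le le_rfl le_rfl (Or.inl hlt)
  linarith

theorem risingProd_conj (m : ℕ) (s : ℂ) :
    risingProd m (starRingEnd ℂ s) = starRingEnd ℂ (risingProd m s) := by
  simp [risingProd, map_prod]

theorem conj_root {m : ℕ} {s : ℂ} (hs : risingProd m s = m.factorial) :
    risingProd m (starRingEnd ℂ s) = m.factorial := by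
  rw [risingProd_conj, hs]; simp

theorem eq_two_of_conj {s : ℂ} (h : starRingEnd ℂ s = 2) : s = 2 := by
  have h1 := congrArg Complex.re h
  have h2 := congrArg Complex.im h
  apply Complex.ext
  · simpa using h1
  · simpa using h2

theorem modSq_small {m : ℕ} (hm : 3 ≤ m) (hm' : m ≤ 26) :
    (m.factorial : ℝ) ^ 2 ≤ modSq m (3 / 2) (551 / 250) := by
  unfold modSq
  interval_cases m <;>
  · simp only [Finset.prod_range_succ, Finset.prod_range_zero, Nat.factorial,
      show ∀ k : ℕ, k + 1 - 1 = k from fun _ => rfl]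
    norm_num [Finset.prod_range_succ]

/-- If Re s ≥ 3/2, the modulus condition forces Im s ≤ 551/250. The argument sum then lies strictly
between 0 and 2π, whereas at a zero it must be a multiple of 2π. -/
theorem re_lt_of_root {m : ℕ} (hm : 3 ≤ m) (hm' : m ≤ 26) {s : ℂ}
    (hs : risingProd m s = m.factorial) (h2 : s ≠ 2) : s.re < 3 / 2 := by
  wlog him : 0 ≤ s.im generalizing s
  · have := this (conj_root hs) (fun h => h2 (eq_two_of_conj h)) (by simp; linarith)
    simpa using this
  by_contra hre
  push Not at hre
  have h0 : 0 < s.re := by linarith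
  have himpos : 0 < s.im :=
    lt_of_le_of_ne him (fun h => h2 (eq_two_of_im_eq_zero (by omega) hs h0 h.symm))
  have hmod := modSq_of_root hs
  rw [abs_of_pos himpos] at hmod
  have hy : s.im ≤ 551 / 250 := by
    by_contra hc
    push Not at hc
    have h1 := modSq_strictMono (by omega : 2 ≤ m) (by norm_num : (0 : ℝ) < 3 / 2) hre
      (by norm_num) hc.le (Or.inr hc)
    have h3 := modSq_small hm hm'
    linarith
  have hpolar := risingProd_polar m h0
  rw [hs, hmod, Real.sqrt_sq (by positivity)] at hpolar
  have hf : (m.factorial : ℂ) ≠ 0 := by exact_mod_cast Nat.factorial_ne_zero _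
  have hexp : Complex.exp (argSum m s.re s.im * Complex.I) = 1 := by
    have : (m.factorial : ℂ) * 1 = m.factorial * Complex.exp (argSum m s.re s.im * Complex.I) := by
      rw [mul_one]
      simpa using hpolar
    exact (mul_left_cancel₀ hf this).symm
  rw [Complex.exp_eq_one_iff] at hexp
  obtain ⟨k, hk⟩ := hexp
  have hk' : argSum m s.re s.im = k * (2 * Real.pi) := by
    have h5 : (argSum m s.re s.im : ℂ) * Complex.I = ((k * (2 * Real.pi) : ℝ) : ℂ) * Complex.I := by
      rw [hk]; push_cast; ring
    exact_mod_cast mul_right_cancel₀ Complex.I_ne_zero h5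
  have hpos : 0 < argSum m s.re s.im := by
    refine Finset.sum_pos (fun j _ => ?_) ⟨0, Finset.mem_range.2 (by omega)⟩
    rw [Real.arctan_pos]
    positivity
  have hlt : argSum m s.re s.im < 2 * Real.pi := by
    refine lt_of_le_of_lt ?_ arctan_sum_lt
    refine (Finset.sum_le_sum fun j _ => ?_).trans
      (Finset.sum_le_sum_of_subset_of_nonneg
        (Finset.range_subset_range.2 (show m - 1 ≤ 25 by omega)) fun j _ _ => ?_)
    · apply Real.arctan_mono
      gcongr
    · rw [Real.arctan_nonneg]; positivity
  rw [hk'] at hpos hlt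
  have hpi := Real.pi_pos
  have hk1 : (0 : ℝ) < k := by
    by_contra hc; push Not at hc; nlinarith
  have hk2 : (k : ℝ) < 1 := by
    by_contra hc; push Not at hc; nlinarith
  have : 0 < k := by exact_mod_cast hk1
  have : k < 1 := by exact_mod_cast hk2
  omega

/-- In the induction step (m + 1/2)² + (11/5)² ≤ (m + 1)², so the right side gains the larger
factor. -/
theorem modSq_large {m : ℕ} (hm : 27 ≤ m) :
    modSq m (3 / 2) (11 / 5) ≤ (m.factorial : ℝ) ^ 2 := by
  induction m, hm using Nat.le_induction with
  | base =>
    unfold modSq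
    norm_num [Finset.prod_range_succ, Nat.factorial]
  | succ m hm ih =>
    unfold modSq at ih ⊢
    rw [show m + 1 - 1 = m - 1 + 1 by omega, Finset.prod_range_succ, Nat.factorial_succ]
    push_cast [show 1 ≤ m by omega]
    rw [mul_pow, mul_comm]
    have hm' : (27 : ℝ) ≤ m := by exact_mod_cast hm
    refine mul_le_mul ?_ ih (Finset.prod_nonneg fun j _ => by positivity) (by positivity)
    nlinarith

theorem continuous_modSq (m : ℕ) : Continuous fun p : ℝ × ℝ => modSq m p.1 p.2 := by
  unfold modSq
  fun_prop

theorem continuousOn_argSum (m : ℕ) :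
    ContinuousOn (fun p : ℝ × ℝ => argSum m p.1 p.2) {p | 0 < p.1} := by
  unfold argSum
  refine continuousOn_finsetSum _ fun j _ => ?_
  refine Real.continuous_arctan.comp_continuousOn ?_
  refine ContinuousOn.div (by fun_prop) (by fun_prop) fun p hp => ?_
  have : (0 : ℝ) < p.1 := hp
  positivity

/-- Follow the curve of modulus m! rightwards from Re s = 3/2, where the argument exceeds 2π,
towards 2, where it is 0. At the rightmost point with argument at least 2π the argument is exactly
2π, and that point is a zero. -/
theorem exists_root_re_gt {m : ℕ} (hm : 27 ≤ m) :
    ∃ s : ℂ, risingProd m s = m.factorial ∧ s ≠ 2 ∧ 3 / 2 < s.re := by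
  set G : ℝ := (m.factorial : ℝ) ^ 2 with hG
  have hm2 : 2 ≤ m := by omega
  have hf1 : (1 : ℝ) ≤ m.factorial := by exact_mod_cast Nat.succ_le_of_lt m.factorial_pos
  have hbig : ∀ x : ℝ, 3 / 2 ≤ x → G ≤ modSq m x m.factorial := by
    intro x hx
    unfold modSq
    rw [← Finset.mul_prod_erase _ _ (Finset.mem_range.2 (show 0 < m - 1 by omega))]
    have h1 : G ≤ (x + (0 : ℕ)) ^ 2 + (m.factorial : ℝ) ^ 2 := by rw [hG]; nlinarith [sq_nonneg (x + (0 : ℕ))]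
    have h2 : (1 : ℝ) ≤ ∏ j ∈ (Finset.range (m - 1)).erase 0,
        ((x + (j : ℕ)) ^ 2 + (m.factorial : ℝ) ^ 2) := by
      rw [← Finset.prod_const_one (s := (Finset.range (m - 1)).erase 0)]
      refine Finset.prod_le_prod (fun _ _ => zero_le_one) fun j _ => ?_
      nlinarith [sq_nonneg (x + (j : ℕ))]
    have hG0 : 0 ≤ G := by positivity
    nlinarith
  have harg0 : ∀ y : ℝ, 11 / 5 ≤ y → 2 * Real.pi < argSum m (3 / 2) y := by
    intro y hy
    refine lt_arctan_sum.trans_le ?_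
    refine (Finset.sum_le_sum fun j _ => ?_).trans
      (Finset.sum_le_sum_of_subset_of_nonneg
        (Finset.range_subset_range.2 (show 26 ≤ m - 1 by omega)) fun j _ _ => ?_)
    · apply Real.arctan_mono
      gcongr
    · rw [Real.arctan_nonneg]; positivity
  -- The points of the level curve in a compact box with argument at least 2π; the first coordinate
  -- is maximised over this set.
  let K : Set (ℝ × ℝ) := {p | (p.1 ∈ Set.Icc (3 / 2 : ℝ) 2 ∧ p.2 ∈ Set.Icc (0 : ℝ) m.factorial) ∧
    modSq m p.1 p.2 = G ∧ 2 * Real.pi ≤ argSum m p.1 p.2}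
  have hbox : IsCompact ((Set.Icc (3 / 2 : ℝ) 2) ×ˢ (Set.Icc (0 : ℝ) m.factorial)) :=
    isCompact_Icc.prod isCompact_Icc
  have hKeq : K = ((Set.Icc (3 / 2 : ℝ) 2) ×ˢ (Set.Icc (0 : ℝ) m.factorial)) ∩
      ({p | modSq m p.1 p.2 = G} ∩ (((Set.Icc (3 / 2 : ℝ) 2) ×ˢ (Set.Icc (0 : ℝ) m.factorial)) ∩
        (fun p : ℝ × ℝ => argSum m p.1 p.2) ⁻¹' Set.Ici (2 * Real.pi))) := by
    ext p
    simp only [K, Set.mem_ofPred_eq, Set.mem_inter_iff, Set.mem_prod, Set.mem_preimage, Set.mem_Ici]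
    tauto
  have hKc : IsCompact K := by
    rw [hKeq]
    apply hbox.inter_right
    apply IsClosed.inter
    · exact isClosed_eq (continuous_modSq m) continuous_const
    · refine ContinuousOn.preimage_isClosed_of_isClosed ?_ hbox.isClosed isClosed_Ici
      refine (continuousOn_argSum m).mono ?_
      rintro p ⟨hp, _⟩
      have := hp.1
      show 0 < p.1
      linarith
  have hKn : K.Nonempty := by
    have hc : ContinuousOn (fun y => modSq m (3 / 2) y) (Set.Icc (11 / 5 : ℝ) m.factorial) :=
      ((continuous_modSq m).comp (Continuous.prodMk continuous_const continuous_id)).continuousOn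
    have hle : (11 / 5 : ℝ) ≤ m.factorial := by
      have : 3 ≤ m.factorial := (by omega : 3 ≤ m).trans (Nat.self_le_factorial m)
      have : (3 : ℝ) ≤ m.factorial := by exact_mod_cast this
      linarith
    obtain ⟨y, hy, hyG⟩ := intermediate_value_Icc hle hc
      (show G ∈ Set.Icc _ _ from ⟨modSq_large hm, hbig _ le_rfl⟩)
    refine ⟨(3 / 2, y), ⟨⟨⟨le_rfl, by norm_num⟩, ⟨by linarith [hy.1], hy.2⟩⟩, hyG, ?_⟩⟩
    exact (harg0 y hy.1).le
  obtain ⟨p, hpK, hpmax⟩ := hKc.exists_isMaxOn hKn continuous_fst.continuousOn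
  obtain ⟨⟨hp1, hp2⟩, hpG, hparg⟩ := hpK
  have hp1pos : 0 < p.1 := by linarith [hp1.1]
  have hpi := Real.pi_pos
  have hy0 : 0 < p.2 := by
    rcases hp2.1.lt_or_eq with h | h
    · exact h
    · rw [← h] at hparg
      simp [argSum] at hparg
      linarith
  have hp12 : p.1 < 2 := by
    rcases hp1.2.lt_or_eq with h | h
    · exact h
    · have := modSq_strictMono hm2 two_pos le_rfl le_rfl hy0.le (Or.inr hy0)
      rw [modSq_two_zero hm2, ← h, hpG] at this
      exact absurd this (lt_irrefl _)
  -- If the argument were larger than 2π, continuity and the intermediate value theorem would give a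
  -- nearby point of the curve further right, still in `K`.
  have hargeq : argSum m p.1 p.2 = 2 * Real.pi := by
    by_contra hne
    have hgt : 2 * Real.pi < argSum m p.1 p.2 := lt_of_le_of_ne hparg (Ne.symm hne)
    have hopen : {q : ℝ × ℝ | 0 < q.1} ∈ 𝓝 p :=
      (isOpen_lt continuous_const continuous_fst).mem_nhds hp1pos
    have hca : ContinuousAt (fun p : ℝ × ℝ => argSum m p.1 p.2) p :=
      (continuousOn_argSum m).continuousAt hopen
    have hev := hca.eventually (lt_mem_nhds hgt)
    rw [Metric.eventually_nhds_iff] at hev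
    obtain ⟨ε, hε, hball⟩ := hev
    set δ := min (ε / 2) (p.2 / 2) with hδ
    have hδ0 : 0 < δ := lt_min (by linarith) (by linarith)
    have hδε : δ < ε := (min_le_left _ _).trans_lt (by linarith)
    have hδy : δ < p.2 := (min_le_right _ _).trans_lt (by linarith)
    have hlow : modSq m p.1 (p.2 - δ) < G := by
      rw [← hpG]
      exact modSq_strictMono hm2 hp1pos le_rfl (by linarith) (by linarith) (Or.inr (by linarith))
    have hcx : ContinuousAt (fun x => modSq m x (p.2 - δ)) p.1 :=
      ((continuous_modSq m).comp (Continuous.prodMk continuous_id continuous_const)).continuousAt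
    have hev2 := hcx.eventually (gt_mem_nhds hlow)
    rw [Metric.eventually_nhds_iff] at hev2
    obtain ⟨η, hη, hball2⟩ := hev2
    set τ := min (min (ε / 2) (η / 2)) (2 - p.1) with hτ
    have hτ0 : 0 < τ := lt_min (lt_min (by linarith) (by linarith)) (by linarith)
    have hτε : τ < ε := ((min_le_left _ _).trans (min_le_left _ _)).trans_lt (by linarith)
    have hτη : τ < η := ((min_le_left _ _).trans (min_le_right _ _)).trans_lt (by linarith)
    have hτ2 : τ ≤ 2 - p.1 := min_le_right _ _
    have hlow2 : modSq m (p.1 + τ) (p.2 - δ) < G := by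
      apply hball2
      rw [Real.dist_eq]
      simpa [abs_of_pos hτ0] using hτη
    have hhigh2 : G ≤ modSq m (p.1 + τ) p.2 := by
      rw [← hpG]
      exact modSq_mono m hp1pos (by linarith) hy0.le le_rfl
    have hc : ContinuousOn (fun y => modSq m (p.1 + τ) y) (Set.Icc (p.2 - δ) p.2) :=
      ((continuous_modSq m).comp (Continuous.prodMk continuous_const continuous_id)).continuousOn
    obtain ⟨y, hy, hyG⟩ := intermediate_value_Icc (by linarith) hc
      (show G ∈ Set.Icc _ _ from ⟨hlow2.le, hhigh2⟩)
    have hin : (p.1 + τ, y) ∈ K := by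
      refine ⟨⟨⟨by linarith [hp1.1], by linarith⟩, ⟨by linarith [hy.1], hy.2.trans hp2.2⟩⟩, hyG, ?_⟩
      apply le_of_lt
      apply hball (y := (p.1 + τ, y))
      rw [Prod.dist_eq, max_lt_iff, Real.dist_eq, Real.dist_eq]
      constructor
      · simpa [abs_of_pos hτ0] using hτε
      · rw [abs_lt]; constructor <;> simp <;> linarith [hy.1, hy.2]
    have := hpmax hin
    simp at this
    linarith
  refine ⟨⟨p.1, p.2⟩, ?_, ?_, ?_⟩
  · rw [risingProd_polar m (by simpa using hp1pos)]
    simp only [hpG, hargeq, hG]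
    rw [Real.sqrt_sq (by positivity)]
    push_cast
    rw [Complex.exp_two_pi_mul_I, mul_one]
  · intro h
    have := congrArg Complex.im h
    simp at this
    linarith
  · rcases hp1.1.lt_or_eq with h | h
    · exact h
    · exfalso
      -- At abscissa 3/2 the curve has height at least 11/5, where the argument exceeds 2π strictly;
      -- this excludes the left edge of the box.
      have h1 : (11 / 5 : ℝ) ≤ p.2 := by
        by_contra hc
        push Not at hc
        have := modSq_strictMono hm2 hp1pos le_rfl hy0.le hc.le (Or.inr hc)
        rw [← h] at this
        have h2 := modSq_large hm
        rw [← h] at hpG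
        linarith
      have := harg0 p.2 h1
      rw [h] at this
      linarith

theorem indicial_eq_zero_iff (m : ℕ) (s : ℂ) :
    indicial m s = 0 ↔ risingProd m s = m.factorial := by
  unfold indicial risingProd
  rw [sub_eq_zero]

/-- A maximiser of the real part exists among finitely many zeros. It is not real because its real
part is positive and 2 is the only positive zero. For a given real part the modulus fixes |Im s|. -/
theorem existsUnique_isSecondZero {m : ℕ} (hm : 27 ≤ m) : ∃! lam : ℂ, IsSecondZero m lam := by
  classical
  have hm2 : 2 ≤ m := by omega
  obtain ⟨s0, hs0, hs02, hs0re⟩ := exists_root_re_gt hm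
  have hne : ((indicialRoots m).erase 2).Nonempty :=
    ⟨s0, Finset.mem_erase.2 ⟨hs02, (mem_indicialRoots hm2).2 hs0⟩⟩
  obtain ⟨w, hw, hwmax⟩ := Finset.exists_max_image _ Complex.re hne
  have hmax : ∀ z : ℂ, indicial m z = 0 → z ≠ 2 → z.re ≤ w.re := fun z hz hz2 =>
    hwmax z (Finset.mem_erase.2 ⟨hz2, (mem_indicialRoots hm2).2 ((indicial_eq_zero_iff m z).1 hz)⟩)
  have hwroot := (mem_indicialRoots hm2).1 (Finset.mem_of_mem_erase hw)
  have hw2 := Finset.ne_of_mem_erase hw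
  have hwre : 3 / 2 < w.re :=
    hs0re.trans_le (hmax s0 ((indicial_eq_zero_iff m s0).2 hs0) hs02)
  have hwim : w.im ≠ 0 := fun h => hw2 (eq_two_of_im_eq_zero hm2 hwroot (by linarith) h)
  have huniq : ∀ a b : ℂ, IsSecondZero m a → IsSecondZero m b → a = b := by
    intro a b ha hb
    have hre : a.re = b.re := le_antisymm (hb.2.2.2 a ha.1 ha.2.1) (ha.2.2.2 b hb.1 hb.2.1)
    have ha0 : 0 < a.re := by
      have := ha.2.2.2 s0 ((indicial_eq_zero_iff m s0).2 hs0) hs02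
      linarith
    have h1 := modSq_of_root ((indicial_eq_zero_iff m a).1 ha.1)
    have h2 := modSq_of_root ((indicial_eq_zero_iff m b).1 hb.1)
    rw [abs_of_pos ha.2.2.1] at h1
    rw [abs_of_pos hb.2.2.1, ← hre] at h2
    apply Complex.ext hre
    rcases lt_trichotomy a.im b.im with h | h | h
    · have := modSq_strictMono hm2 ha0 le_rfl ha.2.2.1.le h.le (Or.inr h)
      linarith
    · exact h
    · have := modSq_strictMono hm2 ha0 le_rfl hb.2.2.1.le h.le (Or.inr h)
      linarith
  have hex : ∃ lam, IsSecondZero m lam := by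
    rcases lt_or_gt_of_ne hwim with h | h
    · refine ⟨starRingEnd ℂ w, (indicial_eq_zero_iff m _).2 (conj_root hwroot), ?_, ?_, ?_⟩
      · exact fun h' => hw2 (eq_two_of_conj h')
      · simpa using h
      · simpa using hmax
    · exact ⟨w, (indicial_eq_zero_iff m w).2 hwroot, hw2, h, hmax⟩
  obtain ⟨lam, hlam⟩ := hex
  exact ⟨lam, hlam, fun y hy => huniq y lam hy hlam⟩

theorem IsSecondZero.re_gt {m : ℕ} (hm : 27 ≤ m) {lam : ℂ} (h : IsSecondZero m lam) :
    3 / 2 < lam.re := by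
  obtain ⟨s0, hs0, hs02, hs0re⟩ := exists_root_re_gt hm
  exact hs0re.trans_le (h.2.2.2 s0 ((indicial_eq_zero_iff m s0).2 hs0) hs02)

theorem re_lt_two_of_root {m : ℕ} (hm : 2 ≤ m) {s : ℂ} (hs : risingProd m s = m.factorial)
    (h2 : s ≠ 2) : s.re < 2 := by
  by_contra h
  push Not at h
  exact h2 (eq_two_of_two_le_re hm hs h)

end RootLocation

/-! ### Transfer of asymptotics from tolls to solutions of the recurrence. -/

section Transfer

variable {m n : ℕ}

theorem le_of_mem_comp (hm : 2 ≤ m) (hn : m - 1 ≤ n) {c : Fin m → ℕ}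
    (hc : c ∈ Finset.piAntidiag Finset.univ (n - (m - 1))) (i : Fin m) : c i < n := by
  rw [Finset.mem_piAntidiag] at hc
  have h1 : c i ≤ ∑ j, c j := Finset.single_le_sum (fun _ _ => Nat.zero_le _) (Finset.mem_univ i)
  have h2 : ∑ j, c j = n - (m - 1) := hc.1
  omega

theorem compAvg_ofReal (F : (Fin m → ℕ) → ℝ) :
    compAvg m n (fun c => (F c : ℂ)) = ((compAvg m n F : ℝ) : ℂ) := by
  simp [compAvg]

theorem compMean_ofReal (x : ℕ → ℝ) :
    compMean m n (fun i => (x i : ℂ)) = ((compMean m n x : ℝ) : ℂ) := by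
  unfold compMean
  rw [← compAvg_ofReal]
  push_cast; rfl

theorem tollCov_ofReal (x y : ℕ → ℝ) :
    tollCov m n (fun i => (x i : ℂ)) (fun i => (y i : ℂ)) = ((tollCov m n x y : ℝ) : ℂ) := by
  unfold tollCov
  rw [compMean_ofReal, compMean_ofReal, Complex.ofReal_sub, ← compAvg_ofReal]
  push_cast; rfl

theorem compAvg_mono {F G : (Fin m → ℕ) → ℝ}
    (h : ∀ c ∈ Finset.piAntidiag (Finset.univ : Finset (Fin m)) (n - (m - 1)), F c ≤ G c) :
    compAvg m n F ≤ compAvg m n G := by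
  unfold compAvg
  exact div_le_div_of_nonneg_right (Finset.sum_le_sum h) (Nat.cast_nonneg _)

theorem compMean_mono (hm : 2 ≤ m) (hn : m - 1 ≤ n) {x y : ℕ → ℝ} (h : ∀ j < n, x j ≤ y j) :
    compMean m n x ≤ compMean m n y :=
  compAvg_mono fun _ hc => Finset.sum_le_sum fun i _ => h _ (le_of_mem_comp hm hn hc i)

theorem norm_compAvg_le (hm : 2 ≤ m) (hn : m - 1 ≤ n) (F : (Fin m → ℕ) → ℂ) (B : ℝ)
    (h : ∀ c ∈ Finset.piAntidiag (Finset.univ : Finset (Fin m)) (n - (m - 1)), ‖F c‖ ≤ B) :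
    ‖compAvg m n F‖ ≤ B := by
  rw [← compAvg_const hm hn B]
  unfold compAvg
  rw [norm_div, Complex.norm_natCast]
  refine div_le_div_of_nonneg_right ?_ (Nat.cast_nonneg _)
  exact (norm_sum_le _ _).trans (Finset.sum_le_sum h)

theorem norm_sum_comp_le (hm : 2 ≤ m) (hn : m - 1 ≤ n) {x : ℕ → ℂ} {B : ℝ}
    (h : ∀ i < n, ‖x i‖ ≤ B) {c : Fin m → ℕ}
    (hc : c ∈ Finset.piAntidiag Finset.univ (n - (m - 1))) : ‖∑ i, x (c i)‖ ≤ m * B := by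
  refine (norm_sum_le _ _).trans ?_
  refine (Finset.sum_le_sum fun i _ => h _ (le_of_mem_comp hm hn hc i)).trans ?_
  simp

theorem norm_compMean_le (hm : 2 ≤ m) (hn : m - 1 ≤ n) {x : ℕ → ℂ} {B : ℝ}
    (h : ∀ i < n, ‖x i‖ ≤ B) : ‖compMean m n x‖ ≤ m * B :=
  norm_compAvg_le hm hn _ _ fun _ hc => norm_sum_comp_le hm hn h hc

theorem norm_tollCov_le (hm : 2 ≤ m) (hn : m - 1 ≤ n) {x y : ℕ → ℂ} {A B : ℝ}
    (hx : ∀ i < n, ‖x i‖ ≤ A) (hy : ∀ i < n, ‖y i‖ ≤ B) :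
    ‖tollCov m n x y‖ ≤ 2 * (m * A) * (m * B) := by
  have hA : 0 ≤ m * A := (norm_nonneg _).trans (norm_compMean_le hm hn hx)
  unfold tollCov
  refine (norm_sub_le _ _).trans ?_
  rw [norm_mul]
  have h1 := norm_compAvg_le hm hn (fun c => (∑ i, x (c i)) * ∑ i, y (c i)) (m * A * (m * B))
    (fun c hc => by
      rw [norm_mul]
      exact mul_le_mul (norm_sum_comp_le hm hn hx hc) (norm_sum_comp_le hm hn hy hc)
        (norm_nonneg _) hA)
  have h2 := mul_le_mul (norm_compMean_le hm hn hx) (norm_compMean_le hm hn hy)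
    (norm_nonneg _) hA
  linarith

/-- Averaging at `n` involves all smaller indices, so a bound at all of them is needed at once.
Finitely many early values are absorbed since n^a → ∞. -/
theorem sup_le_of_isLittleO {x : ℕ → ℂ} {a : ℝ} (ha : 0 < a)
    (h : x =o[atTop] fun n : ℕ => (n : ℝ) ^ a) {ε : ℝ} (hε : 0 < ε) :
    ∀ᶠ n : ℕ in atTop, ∀ i ≤ n, ‖x i‖ ≤ ε * (n : ℝ) ^ a := by
  have h1 := h.def hε
  rw [eventually_atTop] at h1
  obtain ⟨N, hN⟩ := h1
  have ht : Tendsto (fun n : ℕ => ε * (n : ℝ) ^ a) atTop atTop :=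
    ((tendsto_rpow_atTop ha).comp tendsto_natCast_atTop_atTop).const_mul_atTop hε
  filter_upwards [ht.eventually_ge_atTop (∑ i ∈ Finset.range N, ‖x i‖)] with n hn i hi
  rcases lt_or_ge i N with h2 | h2
  · exact (Finset.single_le_sum (f := fun i => ‖x i‖) (fun _ _ => norm_nonneg _)
      (Finset.mem_range.2 h2)).trans hn
  · refine (hN i h2).trans ?_
    rw [Real.norm_of_nonneg (by positivity)]
    gcongr

theorem sup_le_of_isBigO {x : ℕ → ℂ} {a : ℝ} (ha : 0 < a)
    (h : x =O[atTop] fun n : ℕ => (n : ℝ) ^ a) :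
    ∃ C > 0, ∀ᶠ n : ℕ in atTop, ∀ i ≤ n, ‖x i‖ ≤ C * (n : ℝ) ^ a := by
  obtain ⟨C, hC, h1⟩ := h.exists_pos
  refine ⟨C, hC, ?_⟩
  rw [IsBigOWith, eventually_atTop] at h1
  obtain ⟨N, hN⟩ := h1
  have ht : Tendsto (fun n : ℕ => C * (n : ℝ) ^ a) atTop atTop :=
    ((tendsto_rpow_atTop ha).comp tendsto_natCast_atTop_atTop).const_mul_atTop hC
  filter_upwards [ht.eventually_ge_atTop (∑ i ∈ Finset.range N, ‖x i‖)] with n hn i hi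
  rcases lt_or_ge i N with h2 | h2
  · exact (Finset.single_le_sum (f := fun i => ‖x i‖) (fun _ _ => norm_nonneg _)
      (Finset.mem_range.2 h2)).trans hn
  · refine (hN i h2).trans ?_
    rw [Real.norm_of_nonneg (by positivity)]
    gcongr

theorem isLittleO_compMean (hm : 2 ≤ m) {x : ℕ → ℂ} {a : ℝ} (ha : 0 < a)
    (h : x =o[atTop] fun n : ℕ => (n : ℝ) ^ a) :
    (fun n => compMean m n x) =o[atTop] fun n : ℕ => (n : ℝ) ^ a := by
  rw [isLittleO_iff]
  intro ε hε
  have hm0 : (0 : ℝ) < m := by exact_mod_cast (by omega : 0 < m)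
  filter_upwards [sup_le_of_isLittleO ha h (div_pos hε hm0), eventually_ge_atTop (m - 1)]
    with n hn hmn
  refine (norm_compMean_le hm hmn fun i hi => hn i hi.le).trans ?_
  rw [Real.norm_of_nonneg (by positivity)]
  apply le_of_eq
  field_simp

theorem isLittleO_tollCov (hm : 2 ≤ m) {x y : ℕ → ℂ} {a b : ℝ} (ha : 0 < a) (hb : 0 < b)
    (hx : x =o[atTop] fun n : ℕ => (n : ℝ) ^ a) (hy : y =O[atTop] fun n : ℕ => (n : ℝ) ^ b) :
    (fun n => tollCov m n x y) =o[atTop] fun n : ℕ => (n : ℝ) ^ (a + b) := by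
  rw [isLittleO_iff]
  intro ε hε
  have hm0 : (0 : ℝ) < m := by exact_mod_cast (by omega : 0 < m)
  obtain ⟨C, hC, hy'⟩ := sup_le_of_isBigO hb hy
  filter_upwards [sup_le_of_isLittleO ha hx (show 0 < ε / (2 * m * m * C) by positivity), hy',
    eventually_ge_atTop (m - 1), eventually_gt_atTop 0] with n hn1 hn2 hmn hn0
  refine (norm_tollCov_le hm hmn (fun i hi => hn1 i hi.le) (fun i hi => hn2 i hi.le)).trans ?_
  have hn0' : (0 : ℝ) < n := by exact_mod_cast hn0
  rw [Real.norm_of_nonneg (by positivity), Real.rpow_add hn0']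
  apply le_of_eq
  field_simp

theorem tollCov_comm {𝕜 : Type*} [Field 𝕜] (x y : ℕ → 𝕜) : tollCov m n x y = tollCov m n y x := by
  unfold tollCov
  simp only [mul_comm]

theorem tollCov_add_left {𝕜 : Type*} [Field 𝕜] (x y z : ℕ → 𝕜) :
    tollCov m n (fun i => x i + y i) z = tollCov m n x z + tollCov m n y z := by
  simp only [tollCov, compMean, Finset.sum_add_distrib, add_mul, compAvg_add]
  ring

theorem tollCov_const_mul_left {𝕜 : Type*} [Field 𝕜] (a : 𝕜) (x y : ℕ → 𝕜) :
    tollCov m n (fun i => a * x i) y = a * tollCov m n x y := by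
  simp only [tollCov, compMean, ← Finset.mul_sum, mul_assoc, compAvg_const_mul]
  ring

theorem tollCov_add_right {𝕜 : Type*} [Field 𝕜] (x y z : ℕ → 𝕜) :
    tollCov m n x (fun i => y i + z i) = tollCov m n x y + tollCov m n x z := by
  rw [tollCov_comm, tollCov_add_left, tollCov_comm y, tollCov_comm z]

theorem tollCov_const_mul_right {𝕜 : Type*} [Field 𝕜] (a : 𝕜) (x y : ℕ → 𝕜) :
    tollCov m n x (fun i => a * y i) = a * tollCov m n x y := by
  rw [tollCov_comm, tollCov_const_mul_left, tollCov_comm]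

theorem compAvg_congr {𝕜 : Type*} [Field 𝕜] {F G : (Fin m → ℕ) → 𝕜}
    (h : ∀ c ∈ Finset.piAntidiag (Finset.univ : Finset (Fin m)) (n - (m - 1)), F c = G c) :
    compAvg m n F = compAvg m n G := by
  unfold compAvg
  rw [Finset.sum_congr rfl h]

/-- A composition has a fixed sum, so an affine function sums to a constant and has no covariance
with anything. This removes the linear terms of the means. -/
theorem tollCov_affine {𝕜 : Type*} [Field 𝕜] [CharZero 𝕜] (hm : 2 ≤ m) (hn : m - 1 ≤ n) (a b : 𝕜)
    (y : ℕ → 𝕜) : tollCov m n (fun i => a * i + b) y = 0 := by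
  have h : ∀ c ∈ Finset.piAntidiag (Finset.univ : Finset (Fin m)) (n - (m - 1)),
      ∑ i, (a * (c i : 𝕜) + b) = a * ((n - (m - 1) : ℕ) : 𝕜) + m * b := by
    intro c hc
    rw [Finset.mem_piAntidiag] at hc
    have h2 : ∑ j, c j = n - (m - 1) := hc.1
    rw [Finset.sum_add_distrib, ← Finset.mul_sum, ← h2]
    push_cast
    simp
  unfold tollCov compMean
  rw [compAvg_congr h, compAvg_const hm hn,
    compAvg_congr (G := fun c => (a * ((n - (m - 1) : ℕ) : 𝕜) + m * b) * ∑ i, y (c i))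
      (fun c hc => by rw [h c hc]), compAvg_const_mul]
  ring

theorem compMean_const {𝕜 : Type*} [Field 𝕜] [CharZero 𝕜] (hm : 2 ≤ m) (hn : m - 1 ≤ n) (b : 𝕜) :
    compMean m n (fun _ => b) = m * b := by
  unfold compMean
  simp only [Finset.sum_const, Finset.card_univ, Fintype.card_fin, nsmul_eq_mul]
  rw [compAvg_const hm hn]

theorem compMean_natCast {𝕜 : Type*} [Field 𝕜] [CharZero 𝕜] (hm : 2 ≤ m) (hn : m - 1 ≤ n) :
    compMean m n (fun i => (i : 𝕜)) = ((n - (m - 1) : ℕ) : 𝕜) := by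
  unfold compMean
  rw [← compAvg_const hm hn ((n - (m - 1) : ℕ) : 𝕜)]
  unfold compAvg
  congr 1
  refine Finset.sum_congr rfl fun c hc => ?_
  rw [Finset.mem_piAntidiag] at hc
  rw [← hc.1]; push_cast; rfl

/-- A sequence is determined by its recurrence and its initial values. -/
theorem eq_of_compMean_rec (hm : 2 ≤ m) {x y t : ℕ → ℂ}
    (hx : ∀ n, m - 1 ≤ n → x n = compMean m n x + t n)
    (hy : ∀ n, m - 1 ≤ n → y n = compMean m n y + t n) (h0 : ∀ n < m - 1, x n = y n) (n : ℕ) :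
    x n = y n := by
  induction n using Nat.strong_induction_on with
  | _ n ih =>
    rcases lt_or_ge n (m - 1) with h | h
    · exact h0 n h
    · rw [hx n h, hy n h]
      congr 1
      unfold compMean compAvg
      congr 1
      refine Finset.sum_congr rfl fun c hc => Finset.sum_congr rfl fun i _ => ?_
      exact ih _ (le_of_mem_comp hm h hc i)

/-- The real version of `qseq`. -/
noncomputable def qreal (s : ℝ) (n : ℕ) : ℝ := (∏ i ∈ Finset.range n, (s + (i : ℕ))) / n.factorial

/-- The real version of `risingProd`. -/
noncomputable def risingReal (m : ℕ) (s : ℝ) : ℝ := ∏ j ∈ Finset.range (m - 1), (s + (j : ℕ))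

theorem qseq_ofReal (s : ℝ) (n : ℕ) : qseq (s : ℂ) n = (qreal s n : ℂ) := by
  simp [qseq, qreal]

theorem risingProd_ofReal (m : ℕ) (s : ℝ) : risingProd m (s : ℂ) = (risingReal m s : ℂ) := by
  simp [risingProd, risingReal]

theorem qreal_pos {s : ℝ} (hs : 0 < s) (n : ℕ) : 0 < qreal s n :=
  div_pos (Finset.prod_pos fun i _ => by positivity) (by positivity)

theorem risingReal_pos (m : ℕ) {s : ℝ} (hs : 0 < s) : 0 < risingReal m s :=
  Finset.prod_pos fun i _ => by positivity

theorem risingReal_lt {m : ℕ} (hm : 2 ≤ m) {s t : ℝ} (hs : 0 < s) (h : s < t) :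
    risingReal m s < risingReal m t :=
  Finset.prod_lt_prod_of_nonempty (fun j _ => by positivity) (fun j _ => by linarith)
    ⟨0, Finset.mem_range.2 (by omega)⟩

theorem risingReal_two {m : ℕ} (hm : 2 ≤ m) : risingReal m 2 = m.factorial := by
  have h := (mem_indicialRoots hm).1 (two_mem_indicialRoots hm)
  have h2 := risingProd_ofReal m 2
  push_cast at h2
  rw [h] at h2
  exact_mod_cast h2.symm

theorem compMean_qreal (hm : 2 ≤ m) (hn : m - 1 ≤ n) {s : ℝ} (hs : 0 < s) :
    compMean m n (qreal s) = m.factorial / risingReal m s * qreal s n := by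
  have h := compMean_qseq hm hn (s := (s : ℂ)) (by
    rw [risingProd_ofReal]; exact_mod_cast (risingReal_pos m hs).ne')
  have h2 : qseq (s : ℂ) = fun i => (qreal s i : ℂ) := by funext i; exact qseq_ofReal s i
  rw [h2, compMean_ofReal, risingProd_ofReal] at h
  beta_reduce at h
  exact_mod_cast h

theorem tendsto_qreal {s : ℝ} (hs : 0 < s) :
    Tendsto (fun n : ℕ => qreal s n / (n : ℝ) ^ (s - 1)) atTop (𝓝 (1 / Real.Gamma s)) := by
  have h := tendsto_qseq (s := (s : ℂ)) (by simpa using hs)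
  have h2 := (Complex.continuous_re.tendsto _).comp h
  rw [Complex.Gamma_ofReal] at h2
  rw [show (1 / (Real.Gamma s : ℂ)).re = 1 / Real.Gamma s by
    rw [← Complex.ofReal_one, ← Complex.ofReal_div, Complex.ofReal_re]] at h2
  refine h2.congr fun n => ?_
  simp only [Function.comp]
  rw [qseq_ofReal, show ((n : ℂ) ^ ((s : ℂ) - 1)) = (((n : ℝ) ^ (s - 1) : ℝ) : ℂ) by
    rw [Complex.ofReal_cpow (Nat.cast_nonneg n)]; push_cast; rfl, ← Complex.ofReal_div,
    Complex.ofReal_re]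

theorem isBigO_qreal {s : ℝ} (hs : 0 < s) : qreal s =O[atTop] fun n : ℕ => (n : ℝ) ^ (s - 1) := by
  refine IsBigO.of_bound (1 / Real.Gamma s + 1) ?_
  filter_upwards [(tendsto_qreal hs).eventually (gt_mem_nhds (lt_add_one _)), eventually_gt_atTop 0]
    with n hn hn0
  have hn0' : (0 : ℝ) < n := by exact_mod_cast hn0
  rw [div_lt_iff₀ (by positivity)] at hn
  rw [Real.norm_of_nonneg (qreal_pos hs n).le, Real.norm_of_nonneg (by positivity)]
  exact hn.le

theorem rpow_isBigO_qreal {s : ℝ} (hs : 0 < s) :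
    (fun n : ℕ => (n : ℝ) ^ (s - 1)) =O[atTop] qreal s := by
  have hG : 0 < 1 / Real.Gamma s := one_div_pos.2 (Real.Gamma_pos_of_pos hs)
  refine IsBigO.of_bound (2 * Real.Gamma s) ?_
  filter_upwards [(tendsto_qreal hs).eventually (lt_mem_nhds (half_lt_self hG)),
    eventually_gt_atTop 0] with n hn hn0
  have hn0' : (0 : ℝ) < n := by exact_mod_cast hn0
  have hGp := Real.Gamma_pos_of_pos hs
  rw [lt_div_iff₀ (by positivity)] at hn
  rw [Real.norm_of_nonneg (qreal_pos hs n).le, Real.norm_of_nonneg (by positivity)]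
  have : 1 / Real.Gamma s / 2 * (n : ℝ) ^ (s - 1) * (2 * Real.Gamma s) ≤
      qreal s n * (2 * Real.Gamma s) := by gcongr
  have e : 1 / Real.Gamma s / 2 * (n : ℝ) ^ (s - 1) * (2 * Real.Gamma s) = (n : ℝ) ^ (s - 1) := by
    field_simp
  linarith

theorem isLittleO_rpow_rpow {a b : ℝ} (h : a < b) :
    (fun n : ℕ => (n : ℝ) ^ a) =o[atTop] fun n : ℕ => (n : ℝ) ^ b := by
  rw [isLittleO_iff_tendsto' (by
    filter_upwards [eventually_gt_atTop 0] with n hn h0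
    exact absurd h0 (Real.rpow_pos_of_pos (by exact_mod_cast hn) _).ne')]
  have h1 := (tendsto_rpow_neg_atTop (sub_pos.2 h)).comp (tendsto_natCast_atTop_atTop (R := ℝ))
  refine h1.congr' ?_
  filter_upwards [eventually_gt_atTop 0] with n hn
  simp only [Function.comp]
  rw [neg_sub, Real.rpow_sub (by exact_mod_cast hn)]

/-- The transfer theorem for tolls of superlinear growth. -/
theorem isLittleO_of_compMean_le (hm : 2 ≤ m) {a b : ℕ → ℝ} {κ w w' : ℝ} (hκ : 0 ≤ κ)
    (hw' : 0 ≤ w') (hww : w' < w) (hκw : κ * (m.factorial / risingReal m (w' + 1)) ≤ 1)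
    (h : ∀ n, m - 1 ≤ n → |a n| ≤ κ * compMean m n (fun i => |a i|) + b n)
    (hb : b =o[atTop] fun n : ℕ => (n : ℝ) ^ w) :
    a =o[atTop] fun n : ℕ => (n : ℝ) ^ w := by
  have hw : 0 < w := by linarith
  set p := qreal (w + 1) with hp
  set p' := qreal (w' + 1) with hp'
  have hpp : ∀ n, 0 < p n := qreal_pos (by linarith)
  have hpp' : ∀ n, 0 < p' n := qreal_pos (by linarith)
  have hP : 0 < risingReal m (w + 1) := risingReal_pos m (by linarith)
  have hP' : 0 < risingReal m (w' + 1) := risingReal_pos m (by linarith)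
  have hPP : risingReal m (w' + 1) < risingReal m (w + 1) :=
    risingReal_lt hm (by linarith) (by linarith)
  have hf : (0 : ℝ) < m.factorial := by positivity
  set ρ := κ * (m.factorial / risingReal m (w + 1)) with hρ
  have hρ1 : ρ < 1 := by
    rcases hκ.lt_or_eq with h0 | h0
    · refine lt_of_lt_of_le ?_ hκw
      rw [hρ]
      gcongr
    · rw [hρ, ← h0, zero_mul]; exact one_pos
  have hbp : b =o[atTop] p := by
    refine hb.trans_isBigO ?_
    have := rpow_isBigO_qreal (s := w + 1) (by linarith)
    simpa using this
  have hpO : p =O[atTop] fun n : ℕ => (n : ℝ) ^ w := by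
    have := isBigO_qreal (s := w + 1) (by linarith)
    simpa using this
  have hp'o : p' =o[atTop] fun n : ℕ => (n : ℝ) ^ w := by
    have := isBigO_qreal (s := w' + 1) (by linarith)
    refine IsBigO.trans_isLittleO ?_ (isLittleO_rpow_rpow hww)
    simpa using this
  -- Induction with the majorant ε p + D p'. One step contracts p by ρ < 1 and does not enlarge p';
  -- the gain ε(1 - ρ)p pays for the toll, and D p' for the initial values. The factor κ may exceed
  -- 1, which `gapFun` will require.
  have key : ∀ ε > 0, ∃ D ≥ 0, ∀ n, |a n| ≤ ε * p n + D * p' n := by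
    intro ε hε
    have h1 := hbp.def (show 0 < ε * (1 - ρ) from mul_pos hε (by linarith))
    rw [eventually_atTop] at h1
    obtain ⟨N, hN⟩ := h1
    set N' := max N (m - 1)
    refine ⟨∑ i ∈ Finset.range N', |a i| / p' i,
      Finset.sum_nonneg fun i _ => div_nonneg (abs_nonneg _) (hpp' i).le, fun n => ?_⟩
    set D := ∑ i ∈ Finset.range N', |a i| / p' i with hD
    have hD0 : 0 ≤ D := Finset.sum_nonneg fun i _ => div_nonneg (abs_nonneg _) (hpp' i).le
    induction n using Nat.strong_induction_on with
    | _ n ih =>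
      rcases lt_or_ge n N' with hn | hn
      · have h2 : |a n| / p' n ≤ D :=
          Finset.single_le_sum (f := fun i => |a i| / p' i)
            (fun i _ => div_nonneg (abs_nonneg _) (hpp' i).le) (Finset.mem_range.2 hn)
        rw [div_le_iff₀ (hpp' n)] at h2
        have := mul_pos hε (hpp n)
        linarith
      · have hmn : m - 1 ≤ n := (le_max_right _ _).trans hn
        have hNn : N ≤ n := (le_max_left _ _).trans hn
        have h3 := h n hmn
        have h4 : compMean m n (fun i => |a i|) ≤ compMean m n (fun i => ε * p i + D * p' i) :=
          compMean_mono hm hmn ih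
        have h5 : compMean m n (fun i => ε * p i + D * p' i) =
            ε * (m.factorial / risingReal m (w + 1) * p n) +
            D * (m.factorial / risingReal m (w' + 1) * p' n) := by
          have e1 : compMean m n (fun i => ε * p i + D * p' i) =
              ε * compMean m n p + D * compMean m n p' := by
            simp only [compMean, Finset.sum_add_distrib, ← Finset.mul_sum, compAvg_add,
              compAvg_const_mul]
          rw [e1, compMean_qreal hm hmn (by linarith), compMean_qreal hm hmn (by linarith)]
        have h6 := (le_abs_self _).trans (hN n hNn)
        rw [Real.norm_of_nonneg (hpp n).le] at h6
        have h7 := mul_le_mul_of_nonneg_left h4 hκ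
        rw [h5] at h7
        have h8 : κ * (ε * (m.factorial / risingReal m (w + 1) * p n) +
            D * (m.factorial / risingReal m (w' + 1) * p' n)) =
            ε * ρ * p n + D * (κ * (m.factorial / risingReal m (w' + 1))) * p' n := by
          rw [hρ]; ring
        rw [h8] at h7
        have h9 : D * (κ * (m.factorial / risingReal m (w' + 1))) * p' n ≤ D * 1 * p' n :=
          mul_le_mul_of_nonneg_right (mul_le_mul_of_nonneg_left hκw hD0) (hpp' n).le
        nlinarith
  rw [isLittleO_iff]
  intro ε hε
  obtain ⟨C, hC, hCp⟩ := hpO.exists_pos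
  obtain ⟨D, hD, hDa⟩ := key (ε / (2 * C)) (by positivity)
  have h2 := hp'o.def (show 0 < ε / (2 * (D + 1)) by positivity)
  filter_upwards [hCp.bound, h2] with n hn1 hn2
  rw [Real.norm_of_nonneg (hpp n).le] at hn1
  rw [Real.norm_of_nonneg (hpp' n).le] at hn2
  rw [Real.norm_eq_abs]
  refine (hDa n).trans ?_
  have e1 : ε / (2 * C) * p n ≤ ε / (2 * C) * (C * ‖(n : ℝ) ^ w‖) := by gcongr
  have e2 : D * p' n ≤ (D + 1) * (ε / (2 * (D + 1)) * ‖(n : ℝ) ^ w‖) :=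
    mul_le_mul (by linarith) hn2 (hpp' n).le (by linarith)
  have e3 : ε / (2 * C) * (C * ‖(n : ℝ) ^ w‖) + (D + 1) * (ε / (2 * (D + 1)) * ‖(n : ℝ) ^ w‖) =
      ε * ‖(n : ℝ) ^ w‖ := by
    have : D + 1 ≠ 0 := by positivity
    field_simp
    ring
  linarith

theorem norm_compMean_le_compMean (x : ℕ → ℂ) :
    ‖compMean m n x‖ ≤ compMean m n (fun i => ‖x i‖) := by
  unfold compMean compAvg
  rw [norm_div, Complex.norm_natCast]
  refine div_le_div_of_nonneg_right ?_ (Nat.cast_nonneg _)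
  exact (norm_sum_le _ _).trans (Finset.sum_le_sum fun c _ => norm_sum_le _ _)

/-- Sequences with asymptotically equal superlinear tolls are asymptotically equal. -/
theorem isLittleO_sub_of_compMean_rec (hm : 2 ≤ m) {a g b b' : ℕ → ℂ} {w : ℝ} (hw : 1 < w)
    (ha : ∀ n, m - 1 ≤ n → a n = compMean m n a + b n)
    (hg : ∀ n, m - 1 ≤ n → g n = compMean m n g + b' n)
    (hb : (fun n => b n - b' n) =o[atTop] fun n : ℕ => (n : ℝ) ^ w) :
    (fun n => a n - g n) =o[atTop] fun n : ℕ => (n : ℝ) ^ w := by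
  -- The exponent `w' = 1` belongs to the parameter 2, whose eigenvalue is exactly 1.
  refine IsLittleO.of_norm_left (isLittleO_of_compMean_le hm (κ := 1) (w' := 1)
    (b := fun n => ‖b n - b' n‖) zero_le_one zero_le_one hw ?_ ?_ ?_)
  · norm_num
    rw [risingReal_two hm, div_self]
    exact_mod_cast Nat.factorial_ne_zero m
  · intro n hn
    have h2 : a n - g n = compMean m n (fun i => a i - g i) + (b n - b' n) := by
      rw [ha n hn, hg n hn, compMean_sub]; ring
    simp only [abs_norm]
    rw [h2, one_mul]
    exact (norm_add_le _ _).trans (add_le_add (norm_compMean_le_compMean _) le_rfl)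
  · exact hb.norm_left

end Transfer

/-! ### Growth of `qseq` and of its derivative. -/

section Growth

theorem isBigO_inv_add (s : ℂ) {x : ℕ → ℂ} {a : ℝ}
    (h : x =O[atTop] fun n : ℕ => (n : ℝ) ^ (a + 1)) :
    (fun n => x n / (s + n)) =O[atTop] fun n : ℕ => (n : ℝ) ^ a := by
  have h1 : (fun n : ℕ => (s + n : ℂ)⁻¹) =O[atTop] fun n : ℕ => (n : ℝ)⁻¹ := by
    refine IsBigO.of_bound 2 ?_
    filter_upwards [eventually_ge_atTop (⌈2 * ‖s‖⌉₊ + 1)] with n hn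
    have h3 : 2 * ‖s‖ ≤ ⌈2 * ‖s‖⌉₊ := Nat.le_ceil _
    have h4 : ((⌈2 * ‖s‖⌉₊ + 1 : ℕ) : ℝ) ≤ n := by exact_mod_cast hn
    push_cast at h4
    have hn0 : (0 : ℝ) < n := by have := norm_nonneg s; linarith
    have h5 : ‖(n : ℂ)‖ - ‖s‖ ≤ ‖s + n‖ := by
      have := norm_sub_le (s + n) s
      rw [add_sub_cancel_left] at this
      linarith
    rw [Complex.norm_natCast] at h5
    rw [norm_inv, Real.norm_of_nonneg (by positivity), ← div_eq_mul_inv, ← one_div,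
      div_le_div_iff₀ (by linarith) hn0]
    linarith
  refine (h.mul h1).congr' ?_ ?_
  · exact Eventually.of_forall fun n => (div_eq_mul_inv _ _).symm
  · filter_upwards [eventually_gt_atTop 0] with n hn
    have : (n : ℝ) ≠ 0 := by positivity
    rw [Real.rpow_add_one this, mul_assoc, mul_inv_cancel₀ this, mul_one]

theorem isBigO_qseq_of_re_pos {s : ℂ} (hs : 0 < s.re) :
    qseq s =O[atTop] fun n : ℕ => (n : ℝ) ^ (s.re - 1) := by
  have h := (tendsto_qseq hs).norm
  refine IsBigO.of_bound (‖1 / Complex.Gamma s‖ + 1) ?_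
  filter_upwards [h.eventually (gt_mem_nhds (lt_add_one _)), eventually_gt_atTop 0] with n hn hn0
  have hn0' : (0 : ℝ) < n := by exact_mod_cast hn0
  rw [norm_div, Complex.norm_natCast_cpow_of_pos hn0, Complex.sub_re, Complex.one_re,
    div_lt_iff₀ (by positivity)] at hn
  rw [Real.norm_of_nonneg (by positivity)]
  exact hn.le

theorem exists_nat_re_add_pos (s : ℂ) : ∃ k : ℕ, 0 < s.re + k := by
  obtain ⟨k, hk⟩ := exists_nat_gt (-s.re)
  exact ⟨k, by linarith⟩

/-- The Gamma limit covers Re s > 0; other `s` are shifted there by `qseq_shift`, each shift costing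
one power of `n`. -/
theorem qseq_isBigO (s : ℂ) : qseq s =O[atTop] fun n : ℕ => (n : ℝ) ^ (s.re - 1) := by
  obtain ⟨k, hk⟩ := exists_nat_re_add_pos s
  induction k generalizing s with
  | zero => exact isBigO_qseq_of_re_pos (by simpa using hk)
  | succ k ih =>
    have h1 := ih (s + 1) (by simp only [Complex.add_re, Complex.one_re]; push_cast at hk; linarith)
    have h2 := isBigO_inv_add s (a := s.re - 1) (x := fun n => s * qseq (s + 1) n)
      ((h1.const_mul_left s).congr_right fun n => by simp)
    refine h2.congr' ?_ EventuallyEq.rfl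
    filter_upwards [eventually_gt_atTop ⌈‖s‖⌉₊] with n hn
    have hne : s + n ≠ 0 := by
      intro h
      have h3 : s = -n := by linear_combination h
      rw [h3, norm_neg, Complex.norm_natCast, Nat.ceil_natCast] at hn
      omega
    rw [qseq_shift, mul_div_cancel_left₀ _ hne]

theorem ell_isLittleO {s : ℂ} (hs : 0 < s.re) {a : ℝ} (ha : 0 < a) :
    ell s =o[atTop] fun n : ℕ => (n : ℝ) ^ a := by
  have h1 : (fun n : ℕ => ell s n - Real.log n) =O[atTop] fun _ => (1 : ℝ) :=
    (tendsto_ell hs).isBigO_one ℝ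
  have h2 : (fun _ : ℕ => (1 : ℝ)) =o[atTop] fun n : ℕ => (n : ℝ) ^ a := by
    rw [isLittleO_const_left]
    right
    exact tendsto_norm_atTop_atTop.comp ((tendsto_rpow_atTop ha).comp tendsto_natCast_atTop_atTop)
  have h3 : (fun n : ℕ => ((Real.log n : ℝ) : ℂ)) =o[atTop] fun n : ℕ => (n : ℝ) ^ a :=
    IsLittleO.of_norm_left
      (((isLittleO_log_rpow_atTop ha).comp_tendsto
        (tendsto_natCast_atTop_atTop (R := ℝ))).norm_left.congr_left fun n => by
          rw [Complex.norm_real]; rfl)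
  simpa using (h1.trans_isLittleO h2).add h3

theorem dq_shift (s : ℂ) (n : ℕ) :
    qseq (s + 1) n + s * dq (s + 1) n = qseq s n + (s + n) * dq s n := by
  have h1 : HasDerivAt (fun z => z * qseq (z + 1) n)
      (1 * qseq (s + 1) n + s * dq (s + 1) n) s :=
    (hasDerivAt_id s).mul ((hasDerivAt_qseq (s + 1) n).comp_add_const s 1)
  have h2 : HasDerivAt (fun z => (z + n) * qseq z n)
      (1 * qseq s n + (s + n) * dq s n) s :=
    ((hasDerivAt_id s).add_const (n : ℂ)).mul (hasDerivAt_qseq s n)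
  have h3 : (fun z => z * qseq (z + 1) n) = fun z => (z + n) * qseq z n := by
    funext z; exact qseq_shift z n
  rw [h3] at h1
  simpa using h1.unique h2

theorem qseq_isLittleO {s : ℂ} {a : ℝ} (h : s.re - 1 < a) :
    qseq s =o[atTop] fun n : ℕ => (n : ℝ) ^ a :=
  (qseq_isBigO s).trans_isLittleO (isLittleO_rpow_rpow h)

theorem isLittleO_inv_add (s : ℂ) {x : ℕ → ℂ} {a : ℝ}
    (h : x =o[atTop] fun n : ℕ => (n : ℝ) ^ (a + 1)) :
    (fun n => x n / (s + n)) =o[atTop] fun n : ℕ => (n : ℝ) ^ a := by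
  have h0 : (fun n : ℕ => (((n : ℝ) ^ (a + 1) : ℝ) : ℂ)) =O[atTop]
      fun n : ℕ => (n : ℝ) ^ (a + 1) :=
    IsBigO.of_norm_left ((isBigO_refl _ _).norm_left.congr_left fun n => by simp)
  have h1 := isBigO_inv_add s h0
  have h2 : x =o[atTop] (fun n : ℕ => (((n : ℝ) ^ (a + 1) : ℝ) : ℂ)) :=
    IsLittleO.of_norm_right (h.norm_right.congr_right fun n => by simp)
  have h3 := h2.mul_isBigO (isBigO_refl (fun n : ℕ => (s + n : ℂ)⁻¹) atTop)
  exact h3.trans_isBigO h1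

/-- The strict inequality for the exponent absorbs the logarithm in `ell`; the shift is `qseq_shift`
differentiated. -/
theorem dq_isLittleO {s : ℂ} {a : ℝ} (h : s.re - 1 < a) :
    dq s =o[atTop] fun n : ℕ => (n : ℝ) ^ a := by
  obtain ⟨k, hk⟩ := exists_nat_re_add_pos s
  induction k generalizing s a with
  | zero =>
    have hs : 0 < s.re := by simpa using hk
    have h1 := (qseq_isBigO s).mul_isLittleO (ell_isLittleO hs (sub_pos.2 h))
    refine h1.congr' ?_ ?_
    · exact Eventually.of_forall fun n => (dq_eq_of_re_pos hs n).symm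
    · filter_upwards [eventually_gt_atTop 0] with n hn
      rw [← Real.rpow_add (by exact_mod_cast hn)]
      congr 1; ring
  | succ k ih =>
    have h0 : (s + 1).re - 1 < a + 1 := by
      simp only [Complex.add_re, Complex.one_re]; linarith
    have h1 := ih (s := s + 1) (a := a + 1) h0
      (by simp only [Complex.add_re, Complex.one_re]; push_cast at hk; linarith)
    have h2 := isLittleO_inv_add s (a := a)
      (x := fun n => qseq (s + 1) n + s * dq (s + 1) n - qseq s n)
      (((qseq_isLittleO h0).add (h1.const_mul_left s)).sub (qseq_isLittleO (by linarith)))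
    refine h2.congr' ?_ EventuallyEq.rfl
    filter_upwards [eventually_gt_atTop ⌈‖s‖⌉₊] with n hn
    have hne : s + n ≠ 0 := by
      intro h
      have h3 : s = -n := by linear_combination h
      rw [h3, norm_neg, Complex.norm_natCast, Nat.ceil_natCast] at hn
      omega
    rw [dq_shift, add_sub_cancel_left, mul_div_cancel_left₀ _ hne]

end Growth

/-! ### Means of the functionals as combinations over the zeros of Λ. -/

section Means

variable {m : ℕ}

theorem compMean_sum {n : ℕ} (S : Finset ℂ) (x : ℂ → ℕ → ℂ) :
    compMean m n (fun i => ∑ z ∈ S, x z i) = ∑ z ∈ S, compMean m n (x z) := by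
  unfold compMean
  rw [← compAvg_sum]
  congr 1
  funext c
  exact Finset.sum_comm

theorem compMean_qseq_root {n : ℕ} (hm : 2 ≤ m) (hn : m - 1 ≤ n) {z : ℂ}
    (hz : z ∈ indicialRoots m) : compMean m n (qseq z) = qseq z n := by
  rw [mem_indicialRoots hm] at hz
  have h0 : (m.factorial : ℂ) ≠ 0 := by exact_mod_cast m.factorial_ne_zero
  rw [compMean_qseq hm hn (by rw [hz]; exact h0), hz, div_self h0, one_mul]

theorem compMean_dq_root {n : ℕ} (hm : 2 ≤ m) (hn : m - 1 ≤ n) {z : ℂ}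
    (hz : z ∈ indicialRoots m) :
    compMean m n (dq z) = dq z n - ell z (m - 1) * qseq z n := by
  have h1 := compMean_qseq_root hm hn hz
  rw [mem_indicialRoots hm] at hz
  have h0 : (m.factorial : ℂ) ≠ 0 := by exact_mod_cast m.factorial_ne_zero
  rw [compMean_dq hm hn (by rw [hz]; exact h0), h1, hz, div_self h0, one_mul]

theorem compMean_sum_roots {n : ℕ} (hm : 2 ≤ m) (hn : m - 1 ≤ n) {S : Finset ℂ}
    (hS : S ⊆ indicialRoots m) (d : ℂ → ℂ) :
    compMean m n (fun i => ∑ z ∈ S, d z * qseq z i) = ∑ z ∈ S, d z * qseq z n := by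
  rw [compMean_sum S (fun z i => d z * qseq z i)]
  refine Finset.sum_congr rfl fun z hz => ?_
  rw [compMean_const_mul, compMean_qseq_root hm hn (hS hz)]

theorem isLittleO_finset_sum {S : Finset ℂ} {x : ℂ → ℕ → ℂ} {g : ℕ → ℝ}
    (h : ∀ z ∈ S, x z =o[atTop] g) : (fun n => ∑ z ∈ S, x z n) =o[atTop] g := by
  have h1 := IsLittleO.sum h
  rwa [show ∑ z ∈ S, x z = fun n => ∑ z ∈ S, x z n by funext n; simp] at h1

theorem isLittleO_sum_roots (hm : 2 ≤ m) (d : ℂ → ℂ) :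
    (fun n => ∑ z ∈ (indicialRoots m).erase 2, d z * qseq z n) =o[atTop]
      fun n : ℕ => (n : ℝ) ^ (1 : ℝ) := by
  refine isLittleO_finset_sum fun z hz => (qseq_isLittleO ?_).const_mul_left _
  rw [Finset.mem_erase, mem_indicialRoots hm] at hz
  have := re_lt_two_of_root hm hz.2 hz.1
  linarith

theorem permAvg_sizeFun_rec (hm : 2 ≤ m) {n : ℕ} (hn : m - 1 ≤ n) :
    permAvg n (sizeFun m) = 1 + compMean m n (fun j => permAvg j (sizeFun m)) :=
  permAvg_rec hm hn _ _ (orderInv_sizeFun hm) 1 fun σ =>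
    sizeFun_rec hm _ (by rwa [valueList_length])

theorem permAvg_sizeFun_short {n : ℕ} (hn : n < m - 1) :
    permAvg n (sizeFun m) = if n = 0 then 0 else 1 := by
  rw [permAvg_congr (g := fun _ => if n = 0 then 0 else 1) fun σ => ?_, permAvg_const]
  have hl := valueList_length σ
  by_cases h0 : n = 0
  · rw [if_pos h0, List.eq_nil_of_length_eq_zero (hl.trans h0), sizeFun_nil]
  · rw [if_neg h0]
    refine sizeFun_short _ (fun h => h0 ?_) (by omega)
    rw [h] at hl; exact hl.symm

/-- The exact mean of the number of nodes. -/
theorem permAvg_sizeFun (hm : 3 ≤ m) (n : ℕ) :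
    (permAvg n (sizeFun m) : ℂ) + 1 / ((m : ℂ) - 1) =
      ∑ z ∈ indicialRoots m, coeffA m z * qseq z n := by
  have hm2 : 2 ≤ m := by omega
  have hm1 : (m : ℂ) - 1 ≠ 0 := by
    have : (m : ℂ) ≠ 1 := by exact_mod_cast (by omega : m ≠ 1)
    exact sub_ne_zero.2 this
  -- Averaging multiplies a constant by `m`, so adding 1/(m - 1) absorbs the toll 1 and makes the
  -- recurrence homogeneous.
  refine eq_of_compMean_rec hm2 (t := fun _ => 0)
    (x := fun n => (permAvg n (sizeFun m) : ℂ) + 1 / ((m : ℂ) - 1))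
    (y := fun n => ∑ z ∈ indicialRoots m, coeffA m z * qseq z n) ?_ ?_ ?_ n
  · intro n hn
    rw [compMean_add, compMean_const hm2 hn, compMean_ofReal, permAvg_sizeFun_rec hm2 hn]
    push_cast
    field_simp
    ring
  · intro n hn
    rw [compMean_sum_roots hm2 hn subset_rfl, add_zero]
  · intro n hn
    rw [sum_coeffA_initial hm n hn, permAvg_sizeFun_short hn]
    congr 1
    split_ifs <;> simp

theorem permAvg_sizeFun_split (hm : 3 ≤ m) (n : ℕ) :
    (permAvg n (sizeFun m) : ℂ) = ∑ z ∈ (indicialRoots m).erase 2, coeffA m z * qseq z n +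
      ((occ m : ℂ) * n + ((occ m : ℂ) - 1 / ((m : ℂ) - 1))) := by
  have h := permAvg_sizeFun hm n
  rw [← Finset.add_sum_erase _ _ (two_mem_indicialRoots (by omega)), coeffA_two (by omega),
    qseq_two] at h
  linear_combination h

theorem permAvg_keyFun_rec (hm : 2 ≤ m) {n : ℕ} (hn : m - 1 ≤ n) :
    permAvg n (keyFun m) =
      ((n - (m - 1) : ℕ) : ℝ) + compMean m n (fun j => permAvg j (keyFun m)) :=
  permAvg_rec hm hn _ _ (orderInv_keyFun hm) _ fun σ => by
    rw [keyFun_rec hm _ (by rwa [valueList_length]) (valueList_nodup σ), valueList_length]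

theorem ell_two (hm : 3 ≤ m) : 2 * (occ m : ℂ) * ell 2 (m - 1) = 1 := by
  have h1 := coeffA_two (m := m) (by omega)
  have h0 := ell_ne_zero_of_root hm ((mem_indicialRoots (by omega)).1 (two_mem_indicialRoots (by omega)))
  rw [coeffA_eq] at h1
  rw [← h1]
  field_simp
  norm_num

/-- The mean of the key path length. -/
theorem exists_permAvg_keyFun (hm : 3 ≤ m) : ∃ (e : ℕ → ℂ) (a b : ℂ),
    e =o[atTop] (fun n : ℕ => (n : ℝ) ^ (1 : ℝ)) ∧
    ∀ n, (permAvg n (keyFun m) : ℂ) = (2 * (occ m : ℂ) * dq 2 n + e n) + (a * n + b) := by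
  have hm2 : 2 ≤ m := by omega
  have hm1 : (m : ℂ) - 1 ≠ 0 := by
    have : (m : ℂ) ≠ 1 := by exact_mod_cast (by omega : m ≠ 1)
    exact sub_ne_zero.2 this
  obtain ⟨d, hd⟩ := exists_coeff_initial hm
    (fun n => permAvg n (keyFun m) - 2 * (occ m : ℂ) * dq 2 n - m / ((m : ℂ) - 1))
  -- The resonant term 2φ · dq 2 produces the toll n + 1 and the constant m/(m - 1) the toll -m,
  -- together n - (m - 1). The remaining sum fits the initial values.
  have key : ∀ n, (permAvg n (keyFun m) : ℂ) = 2 * (occ m : ℂ) * dq 2 n + m / ((m : ℂ) - 1) +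
      ∑ z ∈ indicialRoots m, d z * qseq z n := by
    refine eq_of_compMean_rec hm2 (t := fun n => ((n - (m - 1) : ℕ) : ℂ)) ?_ ?_ ?_
    · intro n hn
      rw [compMean_ofReal, permAvg_keyFun_rec hm2 hn]
      push_cast
      ring
    · intro n hn
      rw [compMean_add, compMean_sum_roots hm2 hn subset_rfl, compMean_add, compMean_const hm2 hn,
        compMean_const_mul, compMean_dq_root hm2 hn (two_mem_indicialRoots hm2), qseq_two,
        Nat.cast_sub hn, Nat.cast_sub (by omega : 1 ≤ m), Nat.cast_one]
      have hl := ell_two hm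
      field_simp
      linear_combination (m - 1) * ((n : ℂ) + 1) * hl
    · intro n hn
      rw [hd n hn]; ring
  refine ⟨fun n => ∑ z ∈ (indicialRoots m).erase 2, d z * qseq z n, d 2,
    m / ((m : ℂ) - 1) + d 2, isLittleO_sum_roots hm2 d, fun n => ?_⟩
  rw [key n, ← Finset.add_sum_erase _ _ (two_mem_indicialRoots hm2), qseq_two]
  ring

/-- The node path length minus the expected multiple of the key path length. -/
noncomputable def gapFun (m : ℕ) (l : List ℕ) : ℝ := nodeFun m l - occ m * keyFun m l

/-- The contribution of a subtree to `gapFun`. -/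
noncomputable def gapPart (m : ℕ) (l : List ℕ) : ℝ :=
  gapFun m l + (sizeFun m l - occ m * l.length)

theorem orderInv_gapFun (hm : 2 ≤ m) : OrderInv (gapFun m) :=
  (orderInv_nodeFun hm).comp₂ (orderInv_keyFun hm) (fun x y => x - occ m * y)

theorem orderInv_gapPart (hm : 2 ≤ m) : OrderInv (gapPart m) :=
  (orderInv_gapFun hm).comp₂ ((orderInv_sizeFun hm).comp₂ orderInv_length
    (fun x y => x - occ m * y)) (fun x y => x + y)

theorem gapFun_rec (hm : 2 ≤ m) (l : List ℕ) (hl : m - 1 ≤ l.length) (hd : l.Nodup) :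
    gapFun m l = 0 + ∑ i : Fin m, gapPart m (part m i l) := by
  unfold gapPart gapFun
  rw [nodeFun_rec hm l hl, keyFun_rec hm l hl hd, ← sum_length_part hm l]
  push_cast
  simp only [mul_add, Finset.sum_add_distrib, Finset.sum_sub_distrib, Finset.mul_sum]
  ring

theorem permAvg_gapPart (n : ℕ) : permAvg n (gapPart m) =
    permAvg n (gapFun m) + (permAvg n (sizeFun m) - occ m * n) := by
  unfold gapPart
  rw [permAvg_add, permAvg_sub, permAvg_const_mul, permAvg_length]

theorem permAvg_gapFun_rec (hm : 2 ≤ m) {n : ℕ} (hn : m - 1 ≤ n) :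
    permAvg n (gapFun m) = 0 + compMean m n (fun j => permAvg j (gapPart m)) :=
  permAvg_rec hm hn _ _ (orderInv_gapPart hm) 0 fun σ =>
    gapFun_rec hm _ (by rwa [valueList_length]) (valueList_nodup σ)

/-- In N - φK the toll is the mean size minus its linear part, which involves only zeros other than
2 and a constant. Resonance at these zeros yields `dq z` with Re z < 2, so no term n log n survives.
-/
theorem exists_permAvg_gapFun (hm : 3 ≤ m) : ∃ (e : ℕ → ℂ) (a b : ℂ),
    e =o[atTop] (fun n : ℕ => (n : ℝ) ^ (1 : ℝ)) ∧
    ∀ n, (permAvg n (gapFun m) : ℂ) = e n + (a * n + b) := by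
  have hm2 : 2 ≤ m := by omega
  have hm1 : (m : ℂ) - 1 ≠ 0 := by
    have : (m : ℂ) ≠ 1 := by exact_mod_cast (by omega : m ≠ 1)
    exact sub_ne_zero.2 this
  set R := (indicialRoots m).erase 2 with hR
  have hRs : R ⊆ indicialRoots m := Finset.erase_subset _ _
  set c : ℂ := m * ((occ m : ℂ) - 1 / ((m : ℂ) - 1)) / ((m : ℂ) - 1) with hc
  set D : ℕ → ℂ := fun n => ∑ z ∈ R, coeffA m z / ell z (m - 1) * dq z n with hD
  obtain ⟨d, hd⟩ := exists_coeff_initial hm (fun n => permAvg n (gapFun m) - (D n - c))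
  have key : ∀ n, (permAvg n (gapFun m) : ℂ) = (D n - c) +
      ∑ z ∈ indicialRoots m, d z * qseq z n := by
    refine eq_of_compMean_rec hm2 (t := fun n => (m * ((occ m : ℂ) - 1 / ((m : ℂ) - 1))) +
      ∑ z ∈ R, coeffA m z * qseq z n) ?_ ?_ ?_
    · intro n hn
      have h1 : (fun j => (permAvg j (gapPart m) : ℂ)) = fun j => (permAvg j (gapFun m) : ℂ) +
          (∑ z ∈ R, coeffA m z * qseq z j + ((occ m : ℂ) - 1 / ((m : ℂ) - 1))) := by
        funext j
        rw [permAvg_gapPart]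
        push_cast
        rw [permAvg_sizeFun_split hm]
        ring
      rw [permAvg_gapFun_rec hm2 hn, zero_add, ← compMean_ofReal, h1, compMean_add, compMean_add,
        compMean_const hm2 hn, compMean_sum_roots hm2 hn hRs]
      ring
    · intro n hn
      have h1 : compMean m n D = D n - ∑ z ∈ R, coeffA m z * qseq z n := by
        rw [hD, compMean_sum R (fun z i => coeffA m z / ell z (m - 1) * dq z i),
          ← Finset.sum_sub_distrib]
        refine Finset.sum_congr rfl fun z hz => ?_
        have h0 := ell_ne_zero_of_root hm ((mem_indicialRoots hm2).1 (hRs hz))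
        rw [compMean_const_mul, compMean_dq_root hm2 hn (hRs hz)]
        field_simp
      rw [compMean_add, compMean_sum_roots hm2 hn subset_rfl, compMean_sub, compMean_const hm2 hn,
        h1]
      have h2 : c * (m - 1) = m * ((occ m : ℂ) - 1 / ((m : ℂ) - 1)) := by
        rw [hc]; field_simp
      linear_combination h2
    · intro n hn
      rw [hd n hn]; ring
  refine ⟨fun n => D n + ∑ z ∈ R, d z * qseq z n, d 2, d 2 - c, ?_, fun n => ?_⟩
  · refine IsLittleO.add ?_ (isLittleO_sum_roots hm2 d)
    refine isLittleO_finset_sum fun z hz => (dq_isLittleO ?_).const_mul_left _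
    rw [hR, Finset.mem_erase, mem_indicialRoots hm2] at hz
    have := re_lt_two_of_root hm2 hz.2 hz.1
    linarith
  · rw [key n, ← Finset.add_sum_erase _ _ (two_mem_indicialRoots hm2), qseq_two]
    ring

theorem coeffA_conj (m : ℕ) (s : ℂ) : coeffA m (starRingEnd ℂ s) = starRingEnd ℂ (coeffA m s) := by
  simp [coeffA]

/-- The oscillating part of the mean number of nodes. -/
theorem exists_permAvg_sizeFun (hm : 27 ≤ m) {lam : ℂ} (hlam : IsSecondZero m lam) :
    ∃ (e : ℕ → ℂ) (a b : ℂ), e =o[atTop] (fun n : ℕ => (n : ℝ) ^ (lam.re - 1)) ∧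
    ∀ n, (permAvg n (sizeFun m) : ℂ) = (coeffA m lam * qseq lam n +
      coeffA m (starRingEnd ℂ lam) * qseq (starRingEnd ℂ lam) n + e n) + (a * n + b) := by
  have hm2 : 2 ≤ m := by omega
  obtain ⟨h0, h2, him, hmax⟩ := id hlam
  rw [indicial_eq_zero_iff] at h0
  have hne : starRingEnd ℂ lam ≠ lam := by
    intro h
    have := congrArg Complex.im h
    rw [Complex.conj_im] at this
    linarith
  have hmem : lam ∈ (indicialRoots m).erase 2 := by
    rw [Finset.mem_erase, mem_indicialRoots hm2]; exact ⟨h2, h0⟩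
  have hmem' : starRingEnd ℂ lam ∈ ((indicialRoots m).erase 2).erase lam := by
    rw [Finset.mem_erase, Finset.mem_erase, mem_indicialRoots hm2]
    exact ⟨hne, fun h => h2 (eq_two_of_conj h), conj_root h0⟩
  refine ⟨fun n => ∑ z ∈ (((indicialRoots m).erase 2).erase lam).erase (starRingEnd ℂ lam),
    coeffA m z * qseq z n, occ m, (occ m : ℂ) - 1 / ((m : ℂ) - 1), ?_, fun n => ?_⟩
  · refine isLittleO_finset_sum fun z hz => (qseq_isLittleO ?_).const_mul_left _
    simp only [Finset.mem_erase, mem_indicialRoots hm2] at hz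
    obtain ⟨hz1, hz2, hz3, hz4⟩ := hz
    have hle : z.re ≤ lam.re := hmax z ((indicial_eq_zero_iff m z).2 hz4) hz3
    have hα := hlam.re_gt hm
    -- A zero whose real part equals that of `lam` would be real, or `lam` or its conjugate by
    -- uniqueness; all three are excluded.
    rcases hle.lt_or_eq with h | h
    · linarith
    · exfalso
      have hu := existsUnique_isSecondZero hm
      rcases lt_trichotomy z.im 0 with hi | hi | hi
      · have hz' : IsSecondZero m (starRingEnd ℂ z) := by
          refine ⟨(indicial_eq_zero_iff _ _).2 (conj_root hz4), fun h => hz3 (eq_two_of_conj h),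
            by rw [Complex.conj_im]; linarith, fun w hw hw2 => ?_⟩
          rw [Complex.conj_re, h]; exact hmax w hw hw2
        have := hu.unique hz' hlam
        rw [← this, Complex.conj_conj] at hz1
        exact hz1 rfl
      · exact hz3 (eq_two_of_im_eq_zero hm2 hz4 (by linarith) hi)
      · exact hz2 (hu.unique ⟨(indicial_eq_zero_iff _ _).2 hz4, hz3, hi, fun w hw hw2 => by
          rw [h]; exact hmax w hw hw2⟩ hlam)
  · rw [permAvg_sizeFun_split (by omega), ← Finset.add_sum_erase _ _ hmem,
      ← Finset.add_sum_erase _ _ hmem']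
    ring

end Means

/-! ### Leading terms of the toll covariances. -/

section Tolls

variable {m : ℕ}

theorem isLittleO_mul_rpow {x y : ℕ → ℂ} {a b c : ℝ} (hc : a + b = c)
    (hx : x =O[atTop] fun n : ℕ => (n : ℝ) ^ a) (hy : y =o[atTop] fun n : ℕ => (n : ℝ) ^ b) :
    (fun n => x n * y n) =o[atTop] fun n : ℕ => (n : ℝ) ^ c := by
  refine (hx.mul_isLittleO hy).congr' EventuallyEq.rfl ?_
  filter_upwards [eventually_gt_atTop 0] with n hn
  rw [← Real.rpow_add (by exact_mod_cast hn), hc]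

theorem qseq_mul_isLittleO {u κ : ℂ} {θ : ℕ → ℂ} {a : ℝ} (ha : u.re - 1 = a)
    (h : Tendsto θ atTop (𝓝 κ)) :
    (fun n => qseq u n * θ n - κ * qseq u n) =o[atTop] fun n : ℕ => (n : ℝ) ^ a := by
  have h1 : (fun n => θ n - κ) =o[atTop] fun n : ℕ => (n : ℝ) ^ (0 : ℝ) := by
    simp only [Real.rpow_zero, isLittleO_one_iff]
    simpa using h.sub_const κ
  refine (isLittleO_mul_rpow (by linarith) (qseq_isBigO u) h1).congr_left fun n => by ring

theorem tendsto_qseq_mul_div {s t : ℂ} (hs : 0 < s.re) (ht : 0 < t.re)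
    (hst : 0 < (s + t - 1).re) :
    Tendsto (fun n => qseq s n * qseq t n / qseq (s + t - 1) n) atTop
      (𝓝 (Complex.Gamma (s + t - 1) / (Complex.Gamma s * Complex.Gamma t))) := by
  have h := ((tendsto_qseq hs).mul (tendsto_qseq ht)).div (tendsto_qseq hst)
    (one_div_ne_zero (Complex.Gamma_ne_zero_of_re_pos hst))
  have e : 1 / Complex.Gamma s * (1 / Complex.Gamma t) / (1 / Complex.Gamma (s + t - 1)) =
      Complex.Gamma (s + t - 1) / (Complex.Gamma s * Complex.Gamma t) := by
    have := Complex.Gamma_ne_zero_of_re_pos hs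
    have := Complex.Gamma_ne_zero_of_re_pos ht
    field_simp
  rw [e] at h
  refine h.congr' ?_
  filter_upwards [eventually_gt_atTop 0] with n hn
  have hn' : (n : ℂ) ≠ 0 := by exact_mod_cast hn.ne'
  have h1 : (n : ℂ) ^ (s + t - 1 - 1) = (n : ℂ) ^ (s - 1) * (n : ℂ) ^ (t - 1) := by
    rw [← Complex.cpow_add _ _ hn']; congr 1; ring
  have h2 : (n : ℂ) ^ (s - 1) ≠ 0 := by simp [Complex.cpow_eq_zero_iff, hn']
  have h3 : (n : ℂ) ^ (t - 1) ≠ 0 := by simp [Complex.cpow_eq_zero_iff, hn']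
  have h4 := qseq_ne_zero hst n
  simp only [Pi.div_apply]
  rw [h1]
  field_simp

theorem qseq_mul_qseq_isLittleO {s t : ℂ} (hs : 0 < s.re) (ht : 0 < t.re)
    (hst : 0 < (s + t - 1).re) {a : ℝ} (ha : (s + t - 1).re - 1 = a) :
    (fun n => qseq s n * qseq t n -
      Complex.Gamma (s + t - 1) / (Complex.Gamma s * Complex.Gamma t) * qseq (s + t - 1) n)
      =o[atTop] fun n : ℕ => (n : ℝ) ^ a := by
  refine (qseq_mul_isLittleO ha (tendsto_qseq_mul_div hs ht hst)).congr_left fun n => ?_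
  rw [mul_div_cancel₀ _ (qseq_ne_zero hst n)]

/-- The leading coefficient of `tollCov m n (qseq s) (qseq t)`. -/
noncomputable def tollCoeff (m : ℕ) (s t : ℂ) : ℂ :=
  (Complex.Gamma (s + t - 1) / (Complex.Gamma s * Complex.Gamma t) + (m - 1)) *
    (m.factorial / risingProd m (s + t - 1)) -
  m.factorial / risingProd m s * (m.factorial / risingProd m t) *
    (Complex.Gamma (s + t - 1) / (Complex.Gamma s * Complex.Gamma t))

/-- The product of `qseq s` and `qseq t` is asymptotic to a Gamma quotient times `qseq (s + t - 1)`.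
So the diagonal part, the cross part and the product of the means are all multiples of one sequence.
Re(s + t - 1) > 1 makes the exponent positive, as averaging the error requires. -/
theorem tollCov_qseq_isLittleO (hm : 2 ≤ m) {s t : ℂ} (hs : 0 < s.re) (ht : 0 < t.re)
    (hst : 1 < (s + t - 1).re) {a : ℝ} (ha : (s + t - 1).re - 1 = a) :
    (fun n => tollCov m n (qseq s) (qseq t) - tollCoeff m s t * qseq (s + t - 1) n)
      =o[atTop] fun n : ℕ => (n : ℝ) ^ a := by
  set u := s + t - 1 with hu
  set G := Complex.Gamma u / (Complex.Gamma s * Complex.Gamma t) with hG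
  have h1 := qseq_mul_qseq_isLittleO hs ht (show 0 < (s + t - 1).re by linarith) ha
  rw [← hu, ← hG] at h1
  have h2 := isLittleO_compMean hm (by linarith) h1
  have h3 := h1.const_mul_left (m.factorial / risingProd m s * (m.factorial / risingProd m t))
  refine (h2.sub h3).congr' ?_ EventuallyEq.rfl
  filter_upwards [eventually_ge_atTop (m - 1)] with n hn
  rw [tollCov_eq, crossMean_qseq hm, compMean_sub, compMean_const_mul, ← hu,
    compMean_qseq hm hn (risingProd_ne_zero hs), compMean_qseq hm hn (risingProd_ne_zero ht),
    compMean_qseq hm hn (risingProd_ne_zero (show 0 < u.re by linarith)), tollCoeff, ← hu, ← hG]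
  ring

/-- `qseq 2` is affine, so any multiple of it can be removed; taking h = `ell 2 n` cancels the
logarithm at the top index. -/
theorem tollCov_dq_two_sub (hm : 2 ≤ m) {n : ℕ} (hn : m - 1 ≤ n) (x : ℕ → ℂ) (h : ℂ) :
    tollCov m n x (fun i => dq 2 i - h * qseq 2 i) = tollCov m n x (dq 2) := by
  have h1 : (fun i => dq 2 i - h * qseq 2 i) = fun i => dq 2 i + ((-h) * (i : ℂ) + (-h)) := by
    funext i; rw [qseq_two]; ring
  rw [h1, tollCov_add_right, tollCov_comm x (fun i => -h * (i : ℂ) + -h), tollCov_affine hm hn,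
    add_zero]

theorem tendsto_ell_sub {s t : ℂ} (hs : 0 < s.re) (ht : 0 < t.re) :
    Tendsto (fun n => ell s n - ell t n) atTop
      (𝓝 (Complex.digamma t - Complex.digamma s)) := by
  have h := (tendsto_ell hs).sub (tendsto_ell ht)
  have e : -Complex.digamma s - -Complex.digamma t = Complex.digamma t - Complex.digamma s := by
    ring
  rw [e] at h
  exact h.congr fun n => by ring

/-- The leading coefficient of `tollCov m n (qseq s) (dq 2)` at a root `s`. -/
noncomputable def tollCoeffLog (m : ℕ) (s : ℂ) : ℂ :=
  -(m.factorial / risingProd m (s + 1)) * ((s + m - 1) * ell (s + 1) (m - 1) +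
    (m - 1) * (Complex.digamma (s + 1) - Complex.digamma 2)) + s * ell 2 (m - 1)

/-- After subtraction of h = `ell 2 n` every logarithm occurs as a difference `ell u - ell 2`, which
tends to a difference of digamma values. -/
theorem tollCov_qseq_dq_isLittleO (hm : 2 ≤ m) {s : ℂ} (hr : s ∈ indicialRoots m)
    (hs : 0 < s.re) :
    (fun n => tollCov m n (qseq s) (dq 2) - tollCoeffLog m s * qseq (s + 1) n)
      =o[atTop] fun n : ℕ => (n : ℝ) ^ s.re := by
  set u := s + 1 with hu
  have hure : u.re = s.re + 1 := by simp [hu]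
  have hu0 : 0 < u.re := by rw [hure]; linarith
  set D := Complex.digamma u - Complex.digamma 2 with hD
  set E := ell u (m - 1) with hE
  set M := m.factorial / risingProd m u with hM
  have h2re : 0 < (2 : ℂ).re := by norm_num
  have hl1 : ell 2 =o[atTop] fun n : ℕ => (n : ℝ) ^ (1 : ℝ) := ell_isLittleO h2re one_pos
  have hql : (fun n => qseq s n * ell 2 n) =o[atTop] fun n : ℕ => (n : ℝ) ^ s.re :=
    isLittleO_mul_rpow (by ring) (qseq_isBigO s) hl1
  have hq : qseq s =o[atTop] fun n : ℕ => (n : ℝ) ^ s.re := qseq_isLittleO (by linarith)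
  have h1 := qseq_mul_isLittleO (u := u) (a := s.re) (by rw [hure]; ring)
    (tendsto_ell_sub h2re hu0)
  -- The error left after (i + 1) qseq s i = s · qseq (s + 1) i + (1 - s) · qseq s i is used to
  -- express the product through `dq u` and `qseq u`.
  obtain ⟨r, hrr⟩ : ∃ r : ℕ → ℂ, r = fun n =>
    s * (qseq u n * (ell 2 n - ell u n) - D * qseq u n) + (1 - s) * (qseq s n * ell 2 n) :=
    ⟨_, rfl⟩
  have h2 : r =o[atTop] fun n : ℕ => (n : ℝ) ^ s.re := by
    rw [hrr]
    exact (h1.const_mul_left s).add (hql.const_mul_left (1 - s))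
  have h3 := isLittleO_compMean hm hs h2
  have h4 := qseq_mul_isLittleO (u := u) (a := s.re) (by rw [hure]; ring)
    (tendsto_ell_sub hu0 h2re)
  have h5 := ((h3.sub (hql.const_mul_left (1 - s))).add
    (h4.const_mul_left ((s + (m - 1)) * M))).add (hq.const_mul_left ((1 - s) * ell 2 (m - 1)))
  refine h5.congr' ?_ EventuallyEq.rfl
  filter_upwards [eventually_ge_atTop (m - 1)] with n hn
  set h := ell 2 n with hh
  have e1 : (fun i => qseq s i * (dq 2 i - h * qseq 2 i)) = fun i =>
      (r i + (s * (dq u i - h * qseq u i) + (s * D) * qseq u i)) - (h * (1 - s)) * qseq s i := by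
    funext i
    rw [dq_eq_of_re_pos h2re, dq_eq_of_re_pos hu0, qseq_two, hrr]
    have := qseq_shift s i
    rw [← hu] at this
    linear_combination (h - ell 2 i) * this
  have e2 : compMean m n (fun i => qseq s i * (dq 2 i - h * qseq 2 i)) =
      (compMean m n r + (s * compMean m n (fun i => dq u i - h * qseq u i) +
        (s * D) * compMean m n (qseq u))) - (h * (1 - s)) * compMean m n (qseq s) := by
    rw [e1, compMean_sub, compMean_add, compMean_add, compMean_const_mul, compMean_const_mul,
      compMean_const_mul]
  have e3 : crossMean m n (qseq s) (fun i => dq 2 i - h * qseq 2 i) =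
      (m - 1) * compMean m n (fun i => dq u i - h * qseq u i) := by
    have h6 := crossMean_qseq_dq (n := n) hm s 2
    have h7 := crossMean_qseq (n := n) hm s 2
    rw [show s + 2 - 1 = u by rw [hu]; ring] at h6 h7
    rw [crossMean_sub_right, crossMean_const_mul_right, compMean_sub, compMean_const_mul]
    linear_combination h6 - h * h7
  rw [← tollCov_dq_two_sub hm hn _ h, tollCov_eq, e2, e3, compMean_dq_sub hm hn hu0,
    compMean_dq_sub hm hn h2re, compMean_qseq_root hm hn hr,
    compMean_qseq_root hm hn (two_mem_indicialRoots hm),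
    compMean_qseq hm hn (risingProd_ne_zero hu0), ← hM, ← hE, ← hh, tollCoeffLog, ← hu, ← hM, ← hE,
    ← hD, qseq_two]
  have := qseq_shift s n
  rw [← hu] at this
  linear_combination (ell 2 (m - 1)) * this

theorem qseq_two_isBigO : qseq 2 =O[atTop] fun n : ℕ => (n : ℝ) ^ (1 : ℝ) :=
  (qseq_isBigO 2).congr_right fun n => by norm_num

theorem ell_two_sub (i : ℕ) : ell 2 i = ell 3 i + 1 / 2 - 1 / ((i : ℂ) + 2) := by
  induction i with
  | zero => simp [ell]
  | succ i ih =>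
    have h2 : (i : ℂ) + 2 ≠ 0 := by exact_mod_cast (by omega : i + 2 ≠ 0)
    have h3 : (i : ℂ) + 3 ≠ 0 := by exact_mod_cast (by omega : i + 3 ≠ 0)
    have h4 : (2 : ℂ) + i ≠ 0 := by rwa [add_comm]
    have h5 : (3 : ℂ) + i ≠ 0 := by rwa [add_comm]
    have h6 : (i : ℂ) + 1 + 2 ≠ 0 := by rwa [add_assoc, show (1 : ℂ) + 2 = 3 by norm_num]
    unfold ell at *
    rw [Finset.sum_range_succ, Finset.sum_range_succ, ih]
    push_cast
    field_simp
    ring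

/-- The tail of ζ(2) from 3 onwards; this is where π² enters C_K. -/
theorem tendsto_ellSq_three :
    Tendsto (fun n => ellSq 3 n) atTop (𝓝 ((Real.pi : ℂ) ^ 2 / 6 - 5 / 4)) := by
  have h := (hasSum_zeta_two.tendsto_sum_nat).comp (tendsto_add_atTop_nat 3)
  have h2 := (Complex.continuous_ofReal.tendsto _).comp (h.sub_const (5 / 4))
  push_cast at h2
  refine h2.congr fun n => ?_
  simp only [Function.comp]
  rw [add_comm n 3, Finset.sum_range_add]
  unfold ellSq
  rw [Complex.ofReal_sub, Complex.ofReal_add]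
  push_cast
  norm_num [Finset.sum_range_succ]

/-- The leading coefficient of `tollCov m n (dq 2) (dq 2)`. -/
noncomputable def tollCoeffSq (m : ℕ) : ℂ :=
  (m.factorial / risingProd m 3) * (2 * (ell 3 (m - 1) ^ 2 + ellSq 3 (m - 1)) +
    (m - 1) * ((1 / 2 + ell 3 (m - 1)) ^ 2 - ((Real.pi : ℂ) ^ 2 / 6 - 5 / 4) +
      ellSq 3 (m - 1))) - 2 * ell 2 (m - 1) ^ 2

theorem crossMean_dq_sub (hm : 2 ≤ m) {n : ℕ} (hn : m - 1 ≤ n) (h : ℂ) :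
    crossMean m n (fun i => dq 2 i - h * qseq 2 i) (fun i => dq 2 i - h * qseq 2 i) =
      (m - 1) * (compMean m n (qseq 3) * ((ell 3 n - h - ell 3 (m - 1)) ^ 2 -
        (ellSq 3 n - ellSq 3 (m - 1)))) := by
  have h3 : (0 : ℝ) < (3 : ℂ).re := by norm_num
  have e : (2 : ℂ) + 2 - 1 = 3 := by norm_num
  have hx : ∀ x, crossMean m n (fun i => dq 2 i - h * qseq 2 i) x =
      crossMean m n (dq 2) x - h * crossMean m n (qseq 2) x := by
    intro x
    rw [crossMean_comm, crossMean_sub_right, crossMean_const_mul_right, crossMean_comm x,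
      crossMean_comm x]
  have h4 := compMean_dq_sub hm hn h3 0
  simp only [zero_mul, sub_zero] at h4
  have h5 : (fun i => dq 3 i) = dq 3 := rfl
  rw [h5] at h4
  rw [crossMean_sub_right, crossMean_const_mul_right, hx, hx, crossMean_dq_dq hm,
    crossMean_comm (dq 2) (qseq 2), crossMean_qseq_dq hm, crossMean_qseq hm, e,
    compMean_ddq hm hn h3, h4]
  ring

/-- Up to lower order the square of `dq 2` is twice the second derivative `ddq 3` plus terms in `dq
3` and `qseq 3`, because `qseq 2` squared is 2 · qseq 3 - qseq 2. The averages of those are exact,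
and h = `ell 2 n` cancels the logarithms. -/
theorem tollCov_dq_dq_isLittleO (hm : 2 ≤ m) :
    (fun n => tollCov m n (dq 2) (dq 2) - tollCoeffSq m * qseq 3 n)
      =o[atTop] fun n : ℕ => (n : ℝ) ^ (2 : ℝ) := by
  have h2re : 0 < (2 : ℂ).re := by norm_num
  have h3re : 0 < (3 : ℂ).re := by norm_num
  set σ := (Real.pi : ℂ) ^ 2 / 6 - 5 / 4 with hσ
  set E := ell 3 (m - 1) with hE
  set E2 := ellSq 3 (m - 1) with hE2
  set M := m.factorial / risingProd m 3 with hM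
  set l := ell 2 (m - 1) with hl
  have hL : ell 2 =o[atTop] fun n : ℕ => (n : ℝ) ^ (1 / 2 : ℝ) :=
    ell_isLittleO h2re (by norm_num)
  have hqL : (fun n => qseq 2 n * ell 2 n) =o[atTop] fun n : ℕ => (n : ℝ) ^ (3 / 2 : ℝ) :=
    isLittleO_mul_rpow (by norm_num) qseq_two_isBigO hL
  have h32 : (fun n : ℕ => (n : ℝ) ^ (3 / 2 : ℝ)) =o[atTop] fun n : ℕ => (n : ℝ) ^ (2 : ℝ) :=
    isLittleO_rpow_rpow (by norm_num)
  have hq32 : qseq 2 =o[atTop] fun n : ℕ => (n : ℝ) ^ (3 / 2 : ℝ) :=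
    qseq_isLittleO (by norm_num)
  -- `A` and `B` are the error terms of the expansion, ordered by powers of `h`. Since h =
  -- o(n^(1/2)), `B` must be o(n^(3/2)).
  obtain ⟨A, hAd⟩ : ∃ A : ℕ → ℂ, A = fun n => 2 * (qseq 3 n * ellSq 3 n - σ * qseq 3 n) -
      ((qseq 2 n * ell 2 n) * ell 2 n + 2 * (qseq 2 n * ell 2 n) + qseq 2 n / (2 + (n : ℂ))) :=
    ⟨_, rfl⟩
  obtain ⟨B, hBd⟩ : ∃ B : ℕ → ℂ, B = fun n => 2 * (qseq 2 n * ell 2 n) + 2 * qseq 2 n := ⟨_, rfl⟩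
  have hA : A =o[atTop] fun n : ℕ => (n : ℝ) ^ (2 : ℝ) := by
    rw [hAd]
    refine ((qseq_mul_isLittleO (u := 3) (by norm_num) tendsto_ellSq_three).const_mul_left 2).sub
      (IsLittleO.add (IsLittleO.add ?_ ?_) ?_)
    · exact isLittleO_mul_rpow (by norm_num) hqL.isBigO hL
    · exact (hqL.trans h32).const_mul_left 2
    · have := isBigO_inv_add 2 (x := qseq 2) (a := 0) (by simpa using qseq_two_isBigO)
      exact this.trans_isLittleO (isLittleO_rpow_rpow (by norm_num))
  have hB : B =o[atTop] fun n : ℕ => (n : ℝ) ^ (3 / 2 : ℝ) := by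
    rw [hBd]
    exact (hqL.const_mul_left 2).add (hq32.const_mul_left 2)
  have hAm := isLittleO_compMean hm (by norm_num) hA
  have hBm := isLittleO_mul_rpow (c := 2) (by norm_num)
    (isLittleO_compMean hm (by norm_num) hB).isBigO hL
  have hC := isLittleO_mul_rpow (c := 2) (by norm_num) hqL.isBigO hL
  have hθ : Tendsto (fun n => 2 * ((ell 3 n - ell 2 n - E) ^ 2 - ellSq 3 n + E2 + σ +
      (ell 3 n - ell 2 n - E) + 1 / 4) + (m - 1) * ((ell 3 n - ell 2 n - E) ^ 2 -
        (ellSq 3 n - E2))) atTop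
      (𝓝 (2 * ((-(1 / 2) - E) ^ 2 - σ + E2 + σ + (-(1 / 2) - E) + 1 / 4) +
        (m - 1) * ((-(1 / 2) - E) ^ 2 - (σ - E2)))) := by
    have h0 : Tendsto (fun n => ell 3 n - ell 2 n - E) atTop (𝓝 (-(1 / 2) - E)) := by
      refine Tendsto.sub_const ?_ E
      have h1 : Tendsto (fun n : ℕ => -(1 / 2 : ℂ) + 1 / ((n : ℂ) + 2)) atTop
          (𝓝 (-(1 / 2) + 0)) := by
        refine tendsto_const_nhds.add ?_
        have := (tendsto_one_div_add_atTop_nhds_zero_nat (𝕜 := ℂ)).comp (tendsto_add_atTop_nat 1)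
        refine this.congr fun n => ?_
        simp only [Function.comp]; push_cast; ring
      rw [add_zero] at h1
      refine h1.congr fun n => ?_
      rw [ell_two_sub n]; ring
    exact ((((((h0.pow 2).sub tendsto_ellSq_three).add_const E2).add_const σ).add h0).add_const
      (1 / 4)).const_mul 2 |>.add (((h0.pow 2).sub (tendsto_ellSq_three.sub_const E2)).const_mul _)
  have hD := (qseq_mul_isLittleO (u := 3) (a := 2) (by norm_num) hθ).const_mul_left M
  have hF : (fun n => l ^ 2 * qseq 2 n) =o[atTop] fun n : ℕ => (n : ℝ) ^ (2 : ℝ) :=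
    (hq32.trans h32).const_mul_left _
  refine ((((hAm.add hBm).sub hC).add hD).add hF).congr' ?_ EventuallyEq.rfl
  filter_upwards [eventually_ge_atTop (m - 1)] with n hn
  set h := ell 2 n with hh
  have e1 : (fun i => (dq 2 i - h * qseq 2 i) * (dq 2 i - h * qseq 2 i)) = fun i =>
      ((A i + h * B i) - h ^ 2 * qseq 2 i) + ((2 * ddq 3 i + (-4 * h + 2) *
        (dq 3 i - h * qseq 3 i)) + (2 * σ - 2 * h ^ 2 + 1 / 2) * qseq 3 i) := by
    funext i
    have hi : (i : ℂ) + 2 ≠ 0 := by exact_mod_cast (by omega : i + 2 ≠ 0)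
    have hi' : (2 : ℂ) + i ≠ 0 := by rwa [add_comm]
    simp only [hAd, hBd, dq_eq_of_re_pos h2re, dq_eq_of_re_pos h3re, ddq_eq h3re, qseq_two,
      qseq_three]
    rw [ell_two_sub i]
    field_simp
    ring
  have e2 : compMean m n (fun i => (dq 2 i - h * qseq 2 i) * (dq 2 i - h * qseq 2 i)) =
      ((compMean m n A + h * compMean m n B) - h ^ 2 * compMean m n (qseq 2)) +
      ((2 * compMean m n (ddq 3) + (-4 * h + 2) * compMean m n (fun i => dq 3 i - h * qseq 3 i)) +
        (2 * σ - 2 * h ^ 2 + 1 / 2) * compMean m n (qseq 3)) := by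
    rw [e1, compMean_add, compMean_sub, compMean_add, compMean_const_mul, compMean_const_mul,
      compMean_add, compMean_add, compMean_const_mul, compMean_const_mul, compMean_const_mul]
  rw [← tollCov_dq_two_sub hm hn _ h, tollCov_comm, ← tollCov_dq_two_sub hm hn _ h, tollCov_eq, e2,
    crossMean_dq_sub hm hn, compMean_ddq hm hn h3re, compMean_dq_sub hm hn h3re,
    compMean_dq_sub hm hn h2re, compMean_qseq_root hm hn (two_mem_indicialRoots hm),
    compMean_qseq hm hn (risingProd_ne_zero h3re), tollCoeffSq, ← hM, ← hE, ← hE2, ← hh, ← hl]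
  have hq : qseq 2 n * qseq 2 n = 2 * qseq 3 n - qseq 2 n := by
    rw [qseq_two, qseq_three]; ring
  linear_combination l ^ 2 * hq

end Tolls

/-! ### Solving the covariance recurrences; the variance of K and the case m ≤ 26. -/

section Asymptotic

variable {m : ℕ}

theorem risingProd_ne_factorial (hm : 2 ≤ m) {u : ℂ} (hu : 2 < u.re) :
    risingProd m u ≠ m.factorial := by
  intro h
  have := eq_two_of_two_le_re hm h hu.le
  rw [this] at hu
  norm_num at hu

theorem one_sub_ne_zero_of_re (hm : 2 ≤ m) {u : ℂ} (hu : 2 < u.re) :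
    1 - m.factorial / risingProd m u ≠ 0 := by
  intro h
  have h0 := risingProd_ne_zero (m := m) (show 0 < u.re by linarith)
  rw [sub_eq_zero, eq_div_iff h0, one_mul] at h
  exact risingProd_ne_factorial hm hu h

/-- Here n^(u-1) = n^w · exp(i · Im u · log n). Dividing by a factor of modulus 1 does not change a
null limit. -/
theorem tendsto_qseq_osc {u : ℂ} {w : ℝ} (hu : u.re = w + 1) (hw : 0 < w) :
    Tendsto (fun n : ℕ => qseq u n / (((n : ℝ) ^ w : ℝ) : ℂ) -
      1 / Complex.Gamma u * Complex.exp (Complex.I * ((u.im * Real.log n : ℝ) : ℂ)))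
      atTop (𝓝 0) := by
  have h := (tendsto_qseq (s := u) (by linarith)).sub_const (1 / Complex.Gamma u)
  rw [sub_self] at h
  rw [tendsto_zero_iff_norm_tendsto_zero] at h ⊢
  refine h.congr' ?_
  filter_upwards [eventually_gt_atTop 0] with n hn
  have hn' : (n : ℂ) ≠ 0 := by exact_mod_cast hn.ne'
  set x := Complex.exp (Complex.I * ((u.im * Real.log n : ℝ) : ℂ)) with hx
  have hx1 : ‖x‖ = 1 := by rw [hx, mul_comm, Complex.norm_exp_ofReal_mul_I]
  have hx0 : x ≠ 0 := Complex.exp_ne_zero _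
  have e : (n : ℂ) ^ (u - 1) = (((n : ℝ) ^ w : ℝ) : ℂ) * x := by
    have e1 : u - 1 = (w : ℂ) + Complex.I * u.im := by
      apply Complex.ext <;> simp [hu]
    rw [e1, Complex.cpow_add _ _ hn', Complex.ofReal_cpow (by positivity), hx]
    congr 1
    rw [Complex.cpow_def_of_ne_zero hn', ← Complex.natCast_log]
    congr 1
    push_cast
    ring
  have h1 : qseq u n / (n : ℂ) ^ (u - 1) - 1 / Complex.Gamma u =
      (qseq u n / (((n : ℝ) ^ w : ℝ) : ℂ) - 1 / Complex.Gamma u * x) / x := by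
    rw [e, sub_div, div_div, mul_div_cancel_right₀ _ hx0]
  rw [h1, norm_div, hx1, div_one]

/-- The factor relating the leading coefficients of toll and solution. -/
noncomputable def growthCoeff (m : ℕ) (u : ℂ) : ℂ :=
  1 / ((1 - m.factorial / risingProd m u) * Complex.Gamma u)

/-- A toll κ · qseq u has the particular solution κ/(1 - eigenvalue) · qseq u; the eigenvalue is not
1 because Re u > 2. Any other solution with an asymptotically equal toll differs by o(n^w), whatever
its initial values. -/
theorem tendsto_of_compMean_rec (hm : 2 ≤ m) {ι : Type*} [Fintype ι] {κ u : ι → ℂ}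
    {C T : ℕ → ℝ} {w : ℝ} (hw : 1 < w) (hu : ∀ k, (u k).re = w + 1)
    (hC : ∀ n, m - 1 ≤ n → C n = compMean m n C + T n)
    (hT : (fun n => (T n : ℂ) - ∑ k, κ k * qseq (u k) n) =o[atTop] fun n : ℕ => (n : ℝ) ^ w) :
    Tendsto (fun n : ℕ => (C n : ℂ) / (((n : ℝ) ^ w : ℝ) : ℂ) - ∑ k, κ k * growthCoeff m (u k) *
      Complex.exp (Complex.I * (((u k).im * Real.log n : ℝ) : ℂ))) atTop (𝓝 0) := by
  have hu0 : ∀ k, risingProd m (u k) ≠ 0 := fun k => risingProd_ne_zero (by rw [hu k]; linarith)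
  have hu1 : ∀ k, 1 - m.factorial / risingProd m (u k) ≠ 0 := fun k =>
    one_sub_ne_zero_of_re hm (by rw [hu k]; linarith)
  have h1 := isLittleO_sub_of_compMean_rec hm hw (a := fun n => (C n : ℂ))
    (g := fun n => ∑ k, κ k / (1 - m.factorial / risingProd m (u k)) * qseq (u k) n)
    (b := fun n => (T n : ℂ)) (b' := fun n => ∑ k, κ k * qseq (u k) n)
    (fun n hn => by rw [compMean_ofReal, hC n hn]; push_cast; rfl)
    (fun n hn => by
      have e : compMean m n (fun i => ∑ k, κ k / (1 - m.factorial / risingProd m (u k)) *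
          qseq (u k) i) = ∑ k, κ k / (1 - m.factorial / risingProd m (u k)) *
            (m.factorial / risingProd m (u k) * qseq (u k) n) := by
        have e1 : compMean m n (fun i => ∑ k, κ k / (1 - m.factorial / risingProd m (u k)) *
          qseq (u k) i) = ∑ k, compMean m n (fun i =>
            κ k / (1 - m.factorial / risingProd m (u k)) * qseq (u k) i) := by
          unfold compMean
          rw [← compAvg_sum]
          congr 1
          funext c
          exact Finset.sum_comm
        rw [e1]
        refine Finset.sum_congr rfl fun k _ => ?_
        rw [compMean_const_mul, compMean_qseq hm hn (hu0 k)]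
      rw [e, ← Finset.sum_add_distrib]
      refine Finset.sum_congr rfl fun k _ => ?_
      have := hu1 k
      have h := div_mul_cancel₀ (κ k) this
      linear_combination qseq (u k) n * h) hT
  have h2 : Tendsto (fun n : ℕ => ((C n : ℂ) - ∑ k, κ k / (1 - m.factorial / risingProd m (u k)) *
      qseq (u k) n) / (((n : ℝ) ^ w : ℝ) : ℂ)) atTop (𝓝 0) := by
    rw [tendsto_zero_iff_norm_tendsto_zero]
    refine h1.norm_left.tendsto_div_nhds_zero.congr fun n => ?_
    rw [norm_div, Complex.norm_real, Real.norm_of_nonneg (by positivity)]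
  have h3 : Tendsto (fun n : ℕ => ∑ k, κ k / (1 - m.factorial / risingProd m (u k)) *
      (qseq (u k) n / (((n : ℝ) ^ w : ℝ) : ℂ) - 1 / Complex.Gamma (u k) *
        Complex.exp (Complex.I * (((u k).im * Real.log n : ℝ) : ℂ)))) atTop (𝓝 0) := by
    rw [show (0 : ℂ) = ∑ k : ι, κ k / (1 - m.factorial / risingProd m (u k)) * 0 by simp]
    exact tendsto_finsetSum _ fun k _ => (tendsto_qseq_osc (hu k) (by linarith)).const_mul _
  have h4 := h2.add h3
  rw [add_zero] at h4
  refine h4.congr fun n => ?_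
  rw [sub_div, Finset.sum_div]
  simp only [mul_sub, Finset.sum_sub_distrib, growthCoeff]
  have e1 : ∀ k, κ k / (1 - m.factorial / risingProd m (u k)) * qseq (u k) n /
      (((n : ℝ) ^ w : ℝ) : ℂ) = κ k / (1 - m.factorial / risingProd m (u k)) * (qseq (u k) n /
      (((n : ℝ) ^ w : ℝ) : ℂ)) := fun k => mul_div_assoc _ _ _
  simp only [e1]
  have e2 : ∀ k, κ k / (1 - m.factorial / risingProd m (u k)) * (1 / Complex.Gamma (u k) *
        Complex.exp (Complex.I * (((u k).im * Real.log n : ℝ) : ℂ))) =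
      κ k * (1 / ((1 - m.factorial / risingProd m (u k)) * Complex.Gamma (u k))) *
      Complex.exp (Complex.I * (((u k).im * Real.log n : ℝ) : ℂ)) := fun k => by
    rw [one_div_mul_eq_div, div_mul_div_comm, mul_one_div, div_mul_eq_mul_div]
  simp only [e2]
  ring

theorem tollCov_add_affine {𝕜 : Type*} [Field 𝕜] [CharZero 𝕜] {n : ℕ} (hm : 2 ≤ m)
    (hn : m - 1 ≤ n) (x y : ℕ → 𝕜) (a b c d : 𝕜) :
    tollCov m n (fun i => x i + (a * i + b)) (fun i => y i + (c * i + d)) = tollCov m n x y := by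
  rw [tollCov_add_left, tollCov_affine hm hn, tollCov_add_right,
    tollCov_comm x (fun i => c * (i : 𝕜) + d), tollCov_affine hm hn]
  ring

theorem permCov_sizeFun_rec (hm : 2 ≤ m) {n : ℕ} (hn : m - 1 ≤ n) :
    permCov n (sizeFun m) (sizeFun m) = compMean m n (fun j => permCov j (sizeFun m) (sizeFun m)) +
      tollCov m n (fun j => permAvg j (sizeFun m)) (fun j => permAvg j (sizeFun m)) :=
  permCov_rec hm hn _ _ _ _ (orderInv_sizeFun hm) (orderInv_sizeFun hm) 1 1
    (fun σ => sizeFun_rec hm _ (by rwa [valueList_length]))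
    (fun σ => sizeFun_rec hm _ (by rwa [valueList_length]))

theorem permCov_sizeFun_keyFun_rec (hm : 2 ≤ m) {n : ℕ} (hn : m - 1 ≤ n) :
    permCov n (sizeFun m) (keyFun m) = compMean m n (fun j => permCov j (sizeFun m) (keyFun m)) +
      tollCov m n (fun j => permAvg j (sizeFun m)) (fun j => permAvg j (keyFun m)) :=
  permCov_rec hm hn _ _ _ _ (orderInv_sizeFun hm) (orderInv_keyFun hm) 1 ((n - (m - 1) : ℕ) : ℝ)
    (fun σ => sizeFun_rec hm _ (by rwa [valueList_length]))
    (fun σ => by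
      rw [keyFun_rec hm _ (by rwa [valueList_length]) (valueList_nodup σ), valueList_length])

theorem permCov_keyFun_rec (hm : 2 ≤ m) {n : ℕ} (hn : m - 1 ≤ n) :
    permCov n (keyFun m) (keyFun m) = compMean m n (fun j => permCov j (keyFun m) (keyFun m)) +
      tollCov m n (fun j => permAvg j (keyFun m)) (fun j => permAvg j (keyFun m)) :=
  permCov_rec hm hn _ _ _ _ (orderInv_keyFun hm) (orderInv_keyFun hm) ((n - (m - 1) : ℕ) : ℝ)
    ((n - (m - 1) : ℕ) : ℝ)
    (fun σ => by
      rw [keyFun_rec hm _ (by rwa [valueList_length]) (valueList_nodup σ), valueList_length])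
    (fun σ => by
      rw [keyFun_rec hm _ (by rwa [valueList_length]) (valueList_nodup σ), valueList_length])

/-- The difference is -(i + 1) times a sum of n - i terms, each at most 1/(i + 1): a bound of order
n with no logarithm. -/
theorem norm_dq_two_sub_le {i n : ℕ} (h : i ≤ n) :
    ‖dq 2 i - ell 2 n * qseq 2 i‖ ≤ n := by
  have h2re : 0 < (2 : ℂ).re := by norm_num
  obtain ⟨k, rfl⟩ := Nat.exists_eq_add_of_le h
  have e : dq 2 i - ell 2 (i + k) * qseq 2 i =
      -(qseq 2 i * ∑ j ∈ Finset.range k, 1 / (2 + ((i + j : ℕ) : ℂ))) := by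
    rw [dq_eq_of_re_pos h2re, ell, ell, Finset.sum_range_add]
    ring
  have h1 : ‖∑ j ∈ Finset.range k, 1 / (2 + ((i + j : ℕ) : ℂ))‖ ≤ k * (1 / ((i : ℝ) + 1)) := by
    refine (norm_sum_le_of_le (Finset.range k) (f := fun j => 1 / (2 + ((i + j : ℕ) : ℂ)))
      (n := fun _ => 1 / ((i : ℝ) + 1)) fun j _ => ?_).trans (by simp)
    have : (2 : ℂ) + ((i + j : ℕ) : ℂ) = ((2 + (i + j) : ℕ) : ℂ) := by push_cast; ring
    rw [this, norm_div, norm_one, Complex.norm_natCast]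
    apply one_div_le_one_div_of_le (by positivity)
    push_cast
    have : (0 : ℝ) ≤ j := Nat.cast_nonneg j
    linarith
  have h3 : ‖qseq 2 i‖ = (i : ℝ) + 1 := by
    rw [qseq_two, show (i : ℂ) + 1 = ((i + 1 : ℕ) : ℂ) by push_cast; rfl, Complex.norm_natCast]
    push_cast; rfl
  rw [e, norm_neg, norm_mul, h3]
  refine (mul_le_mul_of_nonneg_left h1 (by positivity)).trans ?_
  have : ((i : ℝ) + 1) * (k * (1 / ((i : ℝ) + 1))) = k := by field_simp
  rw [this]
  push_cast
  have : (0 : ℝ) ≤ i := Nat.cast_nonneg i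
  linarith

theorem tollCov_dq_two_isLittleO (hm : 2 ≤ m) {x : ℕ → ℂ} {a b : ℝ} (ha : 0 < a) (hb : a + 1 = b)
    (hx : x =o[atTop] fun n : ℕ => (n : ℝ) ^ a) :
    (fun n => tollCov m n x (dq 2)) =o[atTop] fun n : ℕ => (n : ℝ) ^ b := by
  rw [isLittleO_iff]
  intro ε hε
  have hm0 : (0 : ℝ) < m := by exact_mod_cast (by omega : 0 < m)
  filter_upwards [sup_le_of_isLittleO ha hx (show 0 < ε / (2 * m * m) by positivity),
    eventually_ge_atTop (m - 1), eventually_gt_atTop 0] with n hn1 hmn hn0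
  rw [← tollCov_dq_two_sub hm hmn x (ell 2 n)]
  refine (norm_tollCov_le hm hmn (fun i hi => hn1 i hi.le)
    (fun i hi => norm_dq_two_sub_le hi.le)).trans ?_
  have hn0' : (0 : ℝ) < n := by exact_mod_cast hn0
  rw [Real.norm_of_nonneg (by positivity), ← hb, Real.rpow_add hn0', Real.rpow_one]
  apply le_of_eq
  field_simp

theorem tollCov_permAvg_eq {n : ℕ} (hm : 2 ≤ m) (hn : m - 1 ≤ n) {f g : List ℕ → ℝ} {x y : ℕ → ℂ}
    {a b c d : ℂ} (hx : ∀ n, (permAvg n f : ℂ) = x n + (a * n + b))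
    (hy : ∀ n, (permAvg n g : ℂ) = y n + (c * n + d)) :
    ((tollCov m n (fun j => permAvg j f) (fun j => permAvg j g) : ℝ) : ℂ) =
      tollCov m n x y := by
  rw [← tollCov_ofReal]
  simp only [hx, hy]
  exact tollCov_add_affine hm hn _ _ _ _ _ _

theorem tendsto_of_compMean_rec_zero (hm : 2 ≤ m) {C T : ℕ → ℝ} {w : ℝ} (hw : 1 < w)
    (hC : ∀ n, m - 1 ≤ n → C n = compMean m n C + T n)
    (hT : (fun n => (T n : ℂ)) =o[atTop] fun n : ℕ => (n : ℝ) ^ w) :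
    Tendsto (fun n : ℕ => C n / (n : ℝ) ^ w) atTop (𝓝 0) := by
  have h := tendsto_of_compMean_rec hm (ι := Fin 0) (κ := fun _ => 0) (u := fun k => k.elim0) hw
    (fun k => k.elim0) hC (by simpa using hT)
  simp only [Finset.univ_eq_empty, Finset.sum_empty, sub_zero] at h
  have h2 := (Complex.continuous_re.tendsto _).comp h
  rw [Complex.zero_re] at h2
  refine h2.congr fun n => ?_
  simp only [Function.comp]
  rw [← Complex.ofReal_div, Complex.ofReal_re]

/-- The variance of the number of nodes is subquadratic. -/
theorem tendsto_permCov_sizeFun_div_sq (hm : 3 ≤ m) :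
    Tendsto (fun n : ℕ => permCov n (sizeFun m) (sizeFun m) / (n : ℝ) ^ (2 : ℝ)) atTop (𝓝 0) := by
  have hm2 : 2 ≤ m := by omega
  refine tendsto_of_compMean_rec_zero hm2 (by norm_num)
    (fun n hn => permCov_sizeFun_rec hm2 hn) ?_
  have he := isLittleO_sum_roots hm2 (coeffA m)
  have h := isLittleO_tollCov hm2 one_pos one_pos he he.isBigO
  rw [show (1 : ℝ) + 1 = 2 by norm_num] at h
  refine h.congr' ?_ EventuallyEq.rfl
  filter_upwards [eventually_ge_atTop (m - 1)] with n hn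
  exact (tollCov_permAvg_eq hm2 hn (permAvg_sizeFun_split hm) (permAvg_sizeFun_split hm)).symm

/-- For `m ≤ 26` the covariance of the number of nodes and the key path length is
`o(n ^ (3 / 2))`. -/
theorem tendsto_permCov_sizeFun_keyFun_small (hm : 3 ≤ m) (hm' : m ≤ 26) :
    Tendsto (fun n : ℕ => permCov n (sizeFun m) (keyFun m) / (n : ℝ) ^ (3 / 2 : ℝ)) atTop
      (𝓝 0) := by
  have hm2 : 2 ≤ m := by omega
  refine tendsto_of_compMean_rec_zero hm2 (by norm_num)
    (fun n hn => permCov_sizeFun_keyFun_rec hm2 hn) ?_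
  have he : (fun n => ∑ z ∈ (indicialRoots m).erase 2, coeffA m z * qseq z n) =o[atTop]
      fun n : ℕ => (n : ℝ) ^ (1 / 2 : ℝ) := by
    refine isLittleO_finset_sum fun z hz => (qseq_isLittleO ?_).const_mul_left _
    rw [Finset.mem_erase, mem_indicialRoots hm2] at hz
    have := re_lt_of_root hm hm' hz.2 hz.1
    linarith
  obtain ⟨e, a, b, hk, hkeq⟩ := exists_permAvg_keyFun hm
  have h1 := (tollCov_dq_two_isLittleO hm2 (b := 3 / 2) (by norm_num) (by norm_num)
    he).const_mul_left (2 * (occ m : ℂ))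
  have h2 := isLittleO_tollCov hm2 (by norm_num) one_pos he hk.isBigO
  rw [show (1 / 2 : ℝ) + 1 = 3 / 2 by norm_num] at h2
  refine (h1.add h2).congr' ?_ EventuallyEq.rfl
  filter_upwards [eventually_ge_atTop (m - 1)] with n hn
  rw [tollCov_permAvg_eq hm2 hn (permAvg_sizeFun_split hm) hkeq, tollCov_add_right,
    tollCov_const_mul_right]

theorem mul_risingProd_add_one (hm : 2 ≤ m) (s : ℂ) :
    s * risingProd m (s + 1) = (s + m - 1) * risingProd m s := by
  rw [risingProd_eq, risingProd_eq]
  have := qseq_shift s (m - 1)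
  rw [Nat.cast_sub (by omega), Nat.cast_one] at this
  linear_combination ((m - 1).factorial : ℂ) * this

theorem ellSq_three (hm : 2 ≤ m) :
    ellSq 3 (m - 1) = (harm 2 m : ℂ) + 1 / ((m : ℂ) + 1) ^ 2 - 5 / 4 := by
  induction m, hm using Nat.le_induction with
  | base => norm_num [ellSq, harm, Finset.sum_Icc_succ_top]
  | succ k hk ih =>
    have h1 : harm 2 (k + 1) = harm 2 k + 1 / ((k : ℝ) + 1) ^ 2 := by
      unfold harm
      rw [Finset.sum_Icc_succ_top (by omega)]
      push_cast; rfl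
    have h2 : ellSq 3 (k + 1 - 1) = ellSq 3 (k - 1) + 1 / ((k : ℂ) + 2) ^ 2 := by
      have : k + 1 - 1 = (k - 1) + 1 := by omega
      rw [this]
      unfold ellSq
      rw [Finset.sum_range_succ, Nat.cast_sub (by omega)]
      congr 3
      push_cast; ring
    rw [h2, ih, h1]
    push_cast
    ring

theorem constK_eq (hm : 3 ≤ m) :
    (2 * (occ m : ℂ)) ^ 2 * tollCoeffSq m * growthCoeff m 3 = constK m := by
  have hm2 : 2 ≤ m := by omega
  have hm1 : (m : ℂ) - 1 ≠ 0 := by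
    have : (m : ℂ) ≠ 1 := by exact_mod_cast (by omega : m ≠ 1)
    exact sub_ne_zero.2 this
  have hmp : (m : ℂ) + 1 ≠ 0 := by exact_mod_cast (by omega : m + 1 ≠ 0)
  have hf : (m.factorial : ℂ) ≠ 0 := by exact_mod_cast m.factorial_ne_zero
  have hP : m.factorial / risingProd m 3 = 2 / ((m : ℂ) + 1) := by
    have h := mul_risingProd_add_one hm2 2
    rw [(mem_indicialRoots hm2).1 (two_mem_indicialRoots hm2)] at h
    have h3 : (2 : ℂ) + 1 = 3 := by norm_num
    rw [h3] at h
    have h4 : risingProd m 3 ≠ 0 := risingProd_ne_zero (by norm_num)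
    rw [div_eq_div_iff h4 hmp]
    linear_combination -h
  have hG : Complex.Gamma 3 = 2 := by
    simp
  have hE := ell_two_sub (m - 1)
  rw [Nat.cast_sub (by omega), Nat.cast_one, show (m : ℂ) - 1 + 2 = m + 1 by ring] at hE
  have hE' : ell 3 (m - 1) = ell 2 (m - 1) - 1 / 2 + 1 / ((m : ℂ) + 1) := by rw [hE]; ring
  have h1 : (1 : ℂ) - 2 / (m + 1) = (m - 1) / (m + 1) := by field_simp; ring
  rw [tollCoeffSq, growthCoeff, hP, hG, hE', ellSq_three hm2, constK, h1]
  push_cast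
  field_simp
  ring

/-- The leading toll belongs to the real parameter 3 = 2 + 2 - 1, so the variance has a limit and
does not oscillate. -/
theorem tendsto_permCov_keyFun (hm : 3 ≤ m) :
    Tendsto (fun n : ℕ => permCov n (keyFun m) (keyFun m) / (n : ℝ) ^ (2 : ℝ)) atTop
      (𝓝 (constK m)) := by
  have hm2 : 2 ≤ m := by omega
  obtain ⟨e, a, b, hk, hkeq⟩ := exists_permAvg_keyFun hm
  have h1 := (tollCov_dq_dq_isLittleO hm2).const_mul_left ((2 * (occ m : ℂ)) ^ 2)
  have h2 := (tollCov_dq_two_isLittleO hm2 (b := 2) one_pos (by norm_num)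
    hk).const_mul_left (2 * (2 * (occ m : ℂ)))
  have h3 := isLittleO_tollCov hm2 one_pos one_pos hk hk.isBigO
  rw [show (1 : ℝ) + 1 = 2 by norm_num] at h3
  have h := tendsto_of_compMean_rec hm2 (ι := Unit)
    (κ := fun _ => (2 * (occ m : ℂ)) ^ 2 * tollCoeffSq m) (u := fun _ => 3) (w := 2) (by norm_num)
    (fun _ => by norm_num) (fun n hn => permCov_keyFun_rec hm2 hn) (by
      refine ((h1.add h2).add h3).congr' ?_ EventuallyEq.rfl
      filter_upwards [eventually_ge_atTop (m - 1)] with n hn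
      rw [tollCov_permAvg_eq hm2 hn hkeq hkeq, tollCov_add_right, tollCov_add_left,
        tollCov_add_left, tollCov_const_mul_right, tollCov_const_mul_right,
        tollCov_const_mul_left, tollCov_const_mul_left, tollCov_comm (dq 2) e]
      simp only [Finset.univ_unique, Finset.sum_singleton]
      ring)
  simp only [Finset.univ_unique, Finset.sum_singleton, constK_eq hm, Complex.im_ofNat, zero_mul,
    Complex.ofReal_zero, mul_zero, Complex.exp_zero, mul_one] at h
  have h2 := ((Complex.continuous_re.tendsto _).comp h).add_const (constK m)
  rw [Complex.zero_re, zero_add] at h2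
  refine h2.congr fun n => ?_
  simp only [Function.comp]
  rw [← Complex.ofReal_div, ← Complex.ofReal_sub, Complex.ofReal_re]
  ring

theorem Gamma_add_natCast {u : ℂ} (hu : 0 < u.re) (k : ℕ) :
    Complex.Gamma (u + k) = (∏ j ∈ Finset.range k, (u + j)) * Complex.Gamma u := by
  induction k with
  | zero => simp
  | succ k ih =>
    rw [Finset.prod_range_succ, Nat.cast_succ, ← add_assoc,
      Complex.Gamma_add_one _ (add_natCast_ne_zero hu k), ih]
    ring

theorem digamma_add_natCast {u : ℂ} (hu : 0 < u.re) (k : ℕ) :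
    Complex.digamma (u + k) = Complex.digamma u + ell u k := by
  induction k with
  | zero => simp [ell]
  | succ k ih =>
    have h : ∀ j : ℕ, u + k ≠ -j := fun j h => by
      have := congrArg Complex.re h
      simp at this
      have h1 : (0 : ℝ) ≤ j := Nat.cast_nonneg j
      have h2 : (0 : ℝ) ≤ k := Nat.cast_nonneg k
      linarith
    rw [Nat.cast_succ, ← add_assoc, Complex.digamma_apply_add_one _ h, ih]
    unfold ell
    rw [Finset.sum_range_succ]
    ring

/-- The coefficient in the expansion of the variance of the number of nodes that belongs to the
pair `(s, t)` of roots. -/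
noncomputable def varCoeff (m : ℕ) (s t : ℂ) : ℂ :=
  1 / (Complex.Gamma s * Complex.Gamma t) * (-1 + (m.factorial : ℂ) * ((m : ℂ) - 1) *
    (Complex.Gamma s * Complex.Gamma t) / (Complex.Gamma (s + t + m - 2) -
      (m.factorial : ℂ) * Complex.Gamma (s + t - 1)))

/-- At zeros of Λ the eigenvalues of `s` and `t` are 1. The rest collapses because the rising
product times Γ(u) is Γ(u + m - 1). -/
theorem tollCoeff_mul_growthCoeff (hm : 2 ≤ m) {s t : ℂ} (hs : s ∈ indicialRoots m)
    (ht : t ∈ indicialRoots m) (hs0 : 0 < s.re) (ht0 : 0 < t.re) (hst : 2 < (s + t - 1).re) :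
    tollCoeff m s t * growthCoeff m (s + t - 1) = varCoeff m s t := by
  rw [mem_indicialRoots hm] at hs ht
  have hf : (m.factorial : ℂ) ≠ 0 := by exact_mod_cast m.factorial_ne_zero
  have hu0 : 0 < (s + t - 1).re := by linarith
  have hGs := Complex.Gamma_ne_zero_of_re_pos hs0
  have hGt := Complex.Gamma_ne_zero_of_re_pos ht0
  have hGu := Complex.Gamma_ne_zero_of_re_pos hu0
  have hP := risingProd_ne_zero (m := m) hu0
  have hP1 := sub_ne_zero.2 (risingProd_ne_factorial hm hst)
  have hG : Complex.Gamma (s + t + m - 2) = risingProd m (s + t - 1) *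
      Complex.Gamma (s + t - 1) := by
    rw [risingProd, ← Gamma_add_natCast hu0, Nat.cast_sub (by omega)]
    congr 1
    push_cast; ring
  have h1 : 1 - m.factorial / risingProd m (s + t - 1) =
      (risingProd m (s + t - 1) - m.factorial) / risingProd m (s + t - 1) := by
    field_simp
  unfold tollCoeff growthCoeff varCoeff
  rw [hs, ht, hG, h1, div_self hf, ← sub_mul]
  generalize Complex.Gamma (s + t - 1) = g at *
  generalize risingProd m (s + t - 1) = P at *
  field_simp
  ring

end Asymptotic

/-! ### Oscillating asymptotics of Var S and Cov(S, K) for m ≥ 27. -/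

section Oscillation

variable {m : ℕ}

theorem mem_of_isSecondZero (hm : 2 ≤ m) {lam : ℂ} (h : IsSecondZero m lam) :
    lam ∈ indicialRoots m :=
  (mem_indicialRoots hm).2 ((indicial_eq_zero_iff m lam).1 h.1)

theorem conj_mem_of_isSecondZero (hm : 2 ≤ m) {lam : ℂ} (h : IsSecondZero m lam) :
    starRingEnd ℂ lam ∈ indicialRoots m :=
  (mem_indicialRoots hm).2 (conj_root ((indicial_eq_zero_iff m lam).1 h.1))

theorem varCoeff_conj (m : ℕ) (s t : ℂ) :
    varCoeff m (starRingEnd ℂ s) (starRingEnd ℂ t) = starRingEnd ℂ (varCoeff m s t) := by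
  unfold varCoeff
  have h1 : starRingEnd ℂ s + starRingEnd ℂ t + m - 2 = starRingEnd ℂ (s + t + m - 2) := by
    simp [map_ofNat (starRingEnd ℂ) 2]
  have h2 : starRingEnd ℂ s + starRingEnd ℂ t - 1 = starRingEnd ℂ (s + t - 1) := by simp
  rw [h1, h2, Complex.Gamma_conj, Complex.Gamma_conj, Complex.Gamma_conj, Complex.Gamma_conj]
  simp

theorem F1_eq (m : ℕ) (lam : ℂ) (z : ℝ) : (F1 m lam z : ℂ) =
    2 * coeffA m lam * coeffA m (starRingEnd ℂ lam) * varCoeff m lam (starRingEnd ℂ lam) +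
    (coeffA m lam ^ 2 * varCoeff m lam lam * Complex.exp (Complex.I * ((2 * z : ℝ) : ℂ)) +
      starRingEnd ℂ (coeffA m lam ^ 2 * varCoeff m lam lam *
        Complex.exp (Complex.I * ((2 * z : ℝ) : ℂ)))) := by
  rw [Complex.add_conj]
  unfold F1
  push_cast
  congr 1
  · rw [coeffA_conj, varCoeff, Complex.Gamma_conj, Complex.add_conj, mul_assoc 2 (coeffA m lam),
      Complex.mul_conj', Complex.mul_conj', ← Complex.Gamma_ofReal, ← Complex.Gamma_ofReal]
    push_cast
    ring
  · congr 2
    rw [varCoeff]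
    congr 1
    rw [show Complex.I * (2 * (z : ℂ)) = 2 * Complex.I * z by ring,
      show lam + lam = 2 * lam by ring]
    ring

theorem isBigO_two_terms {x y : ℕ → ℂ} {g : ℕ → ℝ} (a b : ℂ) (hx : x =O[atTop] g)
    (hy : y =O[atTop] g) : (fun n => a * x n + b * y n) =O[atTop] g :=
  (hx.const_mul_left a).add (hy.const_mul_left b)

theorem tendsto_ofReal_sub {a b : ℕ → ℝ} (h : Tendsto (fun n => (a n : ℂ) - b n) atTop (𝓝 0)) :
    Tendsto (fun n => a n - b n) atTop (𝓝 0) := by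
  have h2 := (Complex.continuous_re.tendsto _).comp h
  rw [Complex.zero_re] at h2
  refine h2.congr fun n => ?_
  simp only [Function.comp]
  rw [← Complex.ofReal_sub, Complex.ofReal_re]

/-- The leading part of the mean is a conjugate pair of terms. Its toll covariance has the
parameters 2λ - 1, 2α - 1 and the conjugate of the first: the middle one gives the constant part of
F₁, the outer pair the wave of frequency 2β in log n. -/
theorem tendsto_permCov_sizeFun (hm : 27 ≤ m) {lam : ℂ} (hlam : IsSecondZero m lam) :
    Tendsto (fun n : ℕ => permCov n (sizeFun m) (sizeFun m) / (n : ℝ) ^ (2 * lam.re - 2) -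
      F1 m lam (lam.im * Real.log n)) atTop (𝓝 0) := by
  have hm2 : 2 ≤ m := by omega
  have hα := hlam.re_gt hm
  obtain ⟨e, a, b, he, heq⟩ := exists_permAvg_sizeFun hm hlam
  set lam' := starRingEnd ℂ lam with hlam'
  have hre' : lam'.re = lam.re := Complex.conj_re lam
  have hα' : 3 / 2 < lam'.re := by rwa [hre']
  have hr := mem_of_isSecondZero hm2 hlam
  have hr' := conj_mem_of_isSecondZero hm2 hlam
  rw [← hlam'] at hr'
  set w := 2 * lam.re - 2 with hw
  have r1 : (lam + lam - 1).re = w + 1 := by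
    simp only [Complex.sub_re, Complex.add_re, Complex.one_re]; rw [hw]; ring
  have r2 : (lam + lam' - 1).re = w + 1 := by
    simp only [Complex.sub_re, Complex.add_re, Complex.one_re]; rw [hre', hw]; ring
  have r3 : (lam' + lam' - 1).re = w + 1 := by
    simp only [Complex.sub_re, Complex.add_re, Complex.one_re]; rw [hre', hw]; ring
  set A := coeffA m lam with hA
  set A' := coeffA m lam' with hA'
  have t1 := (tollCov_qseq_isLittleO hm2 (s := lam) (t := lam) (a := w) (by linarith)
    (by linarith) (by rw [r1]; linarith) (by rw [r1]; ring)).const_mul_left (A ^ 2)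
  have t2 := (tollCov_qseq_isLittleO hm2 (s := lam) (t := lam') (a := w) (by linarith)
    (by linarith) (by rw [r2]; linarith) (by rw [r2]; ring)).const_mul_left (2 * A * A')
  have t3 := (tollCov_qseq_isLittleO hm2 (s := lam') (t := lam') (a := w) (by linarith)
    (by linarith) (by rw [r3]; linarith) (by rw [r3]; ring)).const_mul_left (A' ^ 2)
  obtain ⟨p, hp⟩ : ∃ p : ℕ → ℂ, p = fun n => A * qseq lam n + A' * qseq lam' n := ⟨_, rfl⟩
  have hpO : p =O[atTop] fun n : ℕ => (n : ℝ) ^ (lam.re - 1) := by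
    rw [hp]
    refine isBigO_two_terms _ _ (qseq_isBigO lam) ?_
    rw [← hre']; exact qseq_isBigO lam'
  have ha : 0 < lam.re - 1 := by linarith
  have haw : (lam.re - 1) + (lam.re - 1) = w := by rw [hw]; ring
  have u1 := isLittleO_tollCov hm2 ha ha he hpO
  have u2 := isLittleO_tollCov hm2 ha ha he he.isBigO
  rw [haw] at u1 u2
  have heq' : ∀ n, (permAvg n (sizeFun m) : ℂ) = (p n + e n) + (a * n + b) := by
    intro n; rw [heq n, hp]
  have h := tendsto_of_compMean_rec hm2 (ι := Fin 3)
    (κ := ![A ^ 2 * tollCoeff m lam lam, 2 * A * A' * tollCoeff m lam lam',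
      A' ^ 2 * tollCoeff m lam' lam'])
    (u := ![lam + lam - 1, lam + lam' - 1, lam' + lam' - 1]) (w := w) (by linarith)
    (fun k => by fin_cases k <;> [exact r1; exact r2; exact r3])
    (fun n hn => permCov_sizeFun_rec hm2 hn) (by
      refine ((((t1.add t2).add t3).add (u1.const_mul_left 2)).add u2).congr' ?_ EventuallyEq.rfl
      filter_upwards [eventually_ge_atTop (m - 1)] with n hn
      have hpp : tollCov m n p p = A ^ 2 * tollCov m n (qseq lam) (qseq lam) +
          2 * A * A' * tollCov m n (qseq lam) (qseq lam') +
          A' ^ 2 * tollCov m n (qseq lam') (qseq lam') := by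
        have hl : ∀ z, tollCov m n p z = A * tollCov m n (qseq lam) z +
            A' * tollCov m n (qseq lam') z := fun z => by
          rw [hp, tollCov_add_left, tollCov_const_mul_left, tollCov_const_mul_left]
        rw [hl, tollCov_comm _ p, tollCov_comm _ p, hl, hl, tollCov_comm (qseq lam') (qseq lam)]
        ring
      rw [tollCov_permAvg_eq hm2 hn heq' heq', tollCov_add_right, tollCov_add_left,
        tollCov_add_left, hpp, tollCov_comm p e, Fin.sum_univ_three]
      simp only [Matrix.cons_val]
      ring)
  refine tendsto_ofReal_sub (h.congr fun n => ?_)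
  rw [Complex.ofReal_div, F1_eq, Fin.sum_univ_three]
  congr 1
  simp only [Matrix.cons_val]
  have c1 := tollCoeff_mul_growthCoeff hm2 hr hr (by linarith) (by linarith)
    (by rw [r1]; linarith)
  have c2 := tollCoeff_mul_growthCoeff hm2 hr hr' (by linarith) (by linarith)
    (by rw [r2]; linarith)
  have c3 := tollCoeff_mul_growthCoeff hm2 hr' hr' (by linarith) (by linarith)
    (by rw [r3]; linarith)
  have i1 : (lam + lam - 1).im * Real.log n = 2 * (lam.im * Real.log n) := by simp; ring
  have i2 : (lam + lam' - 1).im * Real.log n = 0 := by simp [hlam']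
  have i3 : (lam' + lam' - 1).im * Real.log n = -(2 * (lam.im * Real.log n)) := by
    simp [hlam']; ring
  rw [i1, i2, i3, mul_assoc (A ^ 2), c1, mul_assoc (2 * A * A'), c2, mul_assoc (A' ^ 2), c3,
    ← hlam', ← hA, ← hA']
  have hc : starRingEnd ℂ (A ^ 2 * varCoeff m lam lam *
      Complex.exp (Complex.I * ((2 * (lam.im * Real.log n) : ℝ) : ℂ))) =
      A' ^ 2 * varCoeff m lam' lam' *
      Complex.exp (Complex.I * ((-(2 * (lam.im * Real.log n)) : ℝ) : ℂ)) := by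
    rw [map_mul, map_mul, map_pow, hA', hA, hlam', varCoeff_conj, coeffA_conj, ← Complex.exp_conj,
      map_mul, Complex.conj_ofReal, Complex.conj_I]
    push_cast
    ring_nf
  rw [hc]
  simp only [Complex.ofReal_zero, mul_zero, Complex.exp_zero, mul_one]
  ring

/-- The coefficient in the expansion of the covariance of the number of nodes and the key path
length that belongs to the root `s`. -/
noncomputable def covCoeff (m : ℕ) (s : ℂ) : ℂ :=
  (s + m - 1) / (((m : ℂ) - 1) * Complex.Gamma s) * (1 / (2 * (occ m : ℂ)) - 1 / (s + m - 1) *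
      ((s + m - 1) * Complex.digamma (s + m) - s * Complex.digamma (s + 1)
        - ((m : ℂ) - 1) * (1 - (Real.eulerMascheroniConstant : ℂ))))

theorem tollCoeffLog_mul_growthCoeff (hm : 3 ≤ m) {s : ℂ} (hs : s ∈ indicialRoots m)
    (hs0 : 0 < s.re) : tollCoeffLog m s * growthCoeff m (s + 1) = covCoeff m s := by
  have hm2 : 2 ≤ m := by omega
  rw [mem_indicialRoots hm2] at hs
  have hf : (m.factorial : ℂ) ≠ 0 := by exact_mod_cast m.factorial_ne_zero
  have hm1 : (m : ℂ) - 1 ≠ 0 := by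
    have : (m : ℂ) ≠ 1 := by exact_mod_cast (by omega : m ≠ 1)
    exact sub_ne_zero.2 this
  have hu0 : 0 < (s + 1).re := by simp; linarith
  have hs00 : s ≠ 0 := fun h => by rw [h] at hs0; simp at hs0
  have hsm : s + m - 1 ≠ 0 := by
    have := add_natCast_ne_zero hs0 (m - 1)
    rwa [Nat.cast_sub (by omega), Nat.cast_one, ← add_sub_assoc] at this
  have hP := risingProd_ne_zero (m := m) hu0
  have hM : m.factorial / risingProd m (s + 1) = s / (s + m - 1) := by
    have h := mul_risingProd_add_one hm2 s
    rw [hs] at h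
    rw [div_eq_div_iff hP hsm]
    linear_combination -h
  have hψ : Complex.digamma (s + m) = Complex.digamma (s + 1) + ell (s + 1) (m - 1) := by
    rw [← digamma_add_natCast hu0, Nat.cast_sub (by omega)]
    congr 1
    push_cast; ring
  have hl : 1 / (2 * (occ m : ℂ)) = ell 2 (m - 1) := by
    have h := ell_two hm
    have : 2 * (occ m : ℂ) ≠ 0 := fun h0 => by rw [h0, zero_mul] at h; exact zero_ne_one h
    rw [div_eq_iff this, mul_comm]; exact h.symm
  have hGs := Complex.Gamma_ne_zero_of_re_pos hs0
  have h1 : 1 - s / (s + m - 1) = (m - 1) / (s + m - 1) := by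
    field_simp; ring
  unfold tollCoeffLog growthCoeff covCoeff
  rw [hM, h1, hl, hψ, digamma_two, Complex.Gamma_add_one _ hs00]
  field_simp
  ring

theorem covCoeff_conj (m : ℕ) (s : ℂ) :
    covCoeff m (starRingEnd ℂ s) = starRingEnd ℂ (covCoeff m s) := by
  have hψ : ∀ z : ℂ, Complex.digamma (starRingEnd ℂ z) = starRingEnd ℂ (Complex.digamma z) := by
    intro z
    unfold Complex.digamma
    rw [logDeriv_apply, logDeriv_apply, map_div₀, ← Complex.Gamma_conj]
    congr 1
    have h := congrFun (deriv_conj_conj (f := Complex.Gamma)) (starRingEnd ℂ z)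
    simp only [Function.comp, Complex.conj_conj] at h
    rw [← h]
    congr 1
    funext w
    simp [Function.comp, Complex.Gamma_conj]
  unfold covCoeff
  have h1 : starRingEnd ℂ s + m = starRingEnd ℂ (s + m) := by simp
  have h2 : starRingEnd ℂ s + 1 = starRingEnd ℂ (s + 1) := by simp
  rw [h1, h2, Complex.Gamma_conj, hψ, hψ]
  simp [map_ofNat (starRingEnd ℂ) 2]

theorem F2_eq (m : ℕ) (lam : ℂ) (z : ℝ) : (F2 m lam z : ℂ) =
    2 * occ m * (coeffA m lam * covCoeff m lam * Complex.exp (Complex.I * z) +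
      starRingEnd ℂ (coeffA m lam * covCoeff m lam * Complex.exp (Complex.I * z))) := by
  rw [Complex.add_conj]
  unfold F2 covCoeff
  rw [show ∀ x y : ℝ, 2 * (x : ℂ) * ((2 * y : ℝ) : ℂ) = ((4 * x * y : ℝ) : ℂ) by
    intro x y; push_cast; ring]
  congr 3
  ring

/-- Only the two parameters λ + 1 and its conjugate occur, since K contributes a single leading term
2φ · dq 2; they form the conjugate pair of F₂. -/
theorem tendsto_permCov_sizeFun_keyFun (hm : 27 ≤ m) {lam : ℂ} (hlam : IsSecondZero m lam) :
    Tendsto (fun n : ℕ => permCov n (sizeFun m) (keyFun m) / (n : ℝ) ^ lam.re -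
      F2 m lam (lam.im * Real.log n)) atTop (𝓝 0) := by
  have hm2 : 2 ≤ m := by omega
  have hm3 : 3 ≤ m := by omega
  have hα := hlam.re_gt hm
  obtain ⟨e, a, b, he, heq⟩ := exists_permAvg_sizeFun hm hlam
  obtain ⟨e', a', b', hk, hkeq⟩ := exists_permAvg_keyFun hm3
  set lam' := starRingEnd ℂ lam with hlam'
  have hre' : lam'.re = lam.re := Complex.conj_re lam
  have hα' : 3 / 2 < lam'.re := by rwa [hre']
  have hr := mem_of_isSecondZero hm2 hlam
  have hr' := conj_mem_of_isSecondZero hm2 hlam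
  rw [← hlam'] at hr'
  set A := coeffA m lam with hA
  set A' := coeffA m lam' with hA'
  set o := 2 * (occ m : ℂ) with ho
  have t1 := (tollCov_qseq_dq_isLittleO hm2 hr (by linarith)).const_mul_left (o * A)
  have t2 := (tollCov_qseq_dq_isLittleO hm2 hr' (by linarith)).const_mul_left (o * A')
  rw [hre'] at t2
  obtain ⟨p, hp⟩ : ∃ p : ℕ → ℂ, p = fun n => A * qseq lam n + A' * qseq lam' n := ⟨_, rfl⟩
  have hpO : p =O[atTop] fun n : ℕ => (n : ℝ) ^ (lam.re - 1) := by
    rw [hp]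
    refine isBigO_two_terms _ _ (qseq_isBigO lam) ?_
    rw [← hre']; exact qseq_isBigO lam'
  have ha : 0 < lam.re - 1 := by linarith
  have u1 := (tollCov_dq_two_isLittleO hm2 ha (b := lam.re) (by ring) he).const_mul_left o
  have u2 := isLittleO_tollCov hm2 one_pos ha hk hpO
  have u3 := isLittleO_tollCov hm2 one_pos ha hk he.isBigO
  rw [show 1 + (lam.re - 1) = lam.re by ring] at u2 u3
  have heq' : ∀ n, (permAvg n (sizeFun m) : ℂ) = (p n + e n) + (a * n + b) := by
    intro n; rw [heq n, hp]
  have h := tendsto_of_compMean_rec hm2 (ι := Fin 2)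
    (κ := ![o * A * tollCoeffLog m lam, o * A' * tollCoeffLog m lam'])
    (u := ![lam + 1, lam' + 1]) (w := lam.re) (by linarith)
    (fun k => by fin_cases k <;> simp [hre'])
    (fun n hn => permCov_sizeFun_keyFun_rec hm2 hn) (by
      refine ((((t1.add t2).add u1).add u2).add u3).congr' ?_ EventuallyEq.rfl
      filter_upwards [eventually_ge_atTop (m - 1)] with n hn
      have hpp : tollCov m n p (dq 2) = A * tollCov m n (qseq lam) (dq 2) +
          A' * tollCov m n (qseq lam') (dq 2) := by
        rw [hp, tollCov_add_left, tollCov_const_mul_left, tollCov_const_mul_left]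
      rw [tollCov_permAvg_eq hm2 hn heq' hkeq, tollCov_add_right, tollCov_add_left,
        tollCov_add_left, tollCov_const_mul_right, tollCov_const_mul_right, hpp, tollCov_comm p e',
        tollCov_comm e e', Fin.sum_univ_two]
      simp only [Matrix.cons_val]
      ring)
  refine tendsto_ofReal_sub (h.congr fun n => ?_)
  rw [Complex.ofReal_div, F2_eq, Fin.sum_univ_two]
  congr 1
  simp only [Matrix.cons_val]
  have c1 := tollCoeffLog_mul_growthCoeff hm3 hr (by linarith)
  have c2 := tollCoeffLog_mul_growthCoeff hm3 hr' (by linarith)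
  have i1 : (lam + 1).im * Real.log n = lam.im * Real.log n := by simp
  have i2 : (lam' + 1).im * Real.log n = -(lam.im * Real.log n) := by simp [hlam']
  rw [i1, i2, mul_assoc (o * A), c1, mul_assoc (o * A'), c2, ← hA]
  have hc : starRingEnd ℂ (A * covCoeff m lam *
      Complex.exp (Complex.I * ((lam.im * Real.log n : ℝ) : ℂ))) =
      A' * covCoeff m lam' *
      Complex.exp (Complex.I * ((-(lam.im * Real.log n) : ℝ) : ℂ)) := by
    rw [map_mul, map_mul, hA', hA, hlam', covCoeff_conj, coeffA_conj,
      ← Complex.exp_conj, map_mul, Complex.conj_ofReal, Complex.conj_I]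
    push_cast
    ring_nf
  rw [hc]
  ring

end Oscillation

/-! ### Positivity of C_K and of F₁. -/

section Positivity

variable {m : ℕ}

theorem harm_succ (r m : ℕ) : harm r (m + 1) = harm r m + 1 / ((m : ℝ) + 1) ^ r := by
  unfold harm
  rw [Finset.sum_Icc_succ_top (by omega)]
  push_cast; rfl

theorem one_lt_harm_one (hm : 2 ≤ m) : 1 < harm 1 m := by
  induction m, hm using Nat.le_induction with
  | base => norm_num [harm, Finset.sum_Icc_succ_top]
  | succ k hk ih =>
    rw [harm_succ]
    have : 0 < 1 / ((k : ℝ) + 1) ^ 1 := by positivity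
    linarith

theorem occ_pos (hm : 2 ≤ m) : 0 < occ m := by
  have := one_lt_harm_one hm
  unfold occ
  apply one_div_pos.2
  linarith

/-- Since 1/(n+1)² ≤ 1/(n+1/2) - 1/(n+3/2), the right side decreases in `m`, to the limit π²/6. -/
theorem zeta_two_le (m : ℕ) : Real.pi ^ 2 / 6 ≤ harm 2 m + 1 / ((m : ℝ) + 1 / 2) := by
  have hanti : Antitone fun n : ℕ => harm 2 n + 1 / ((n : ℝ) + 1 / 2) := by
    refine antitone_nat_of_succ_le fun n => ?_
    rw [harm_succ]
    push_cast
    have e : 1 / ((n : ℝ) + 1 / 2) - 1 / ((n : ℝ) + 1 + 1 / 2) =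
        1 / (((n : ℝ) + 1 / 2) * ((n : ℝ) + 1 + 1 / 2)) := by
      field_simp
      ring
    have h : 1 / ((n : ℝ) + 1) ^ 2 ≤ 1 / (((n : ℝ) + 1 / 2) * ((n : ℝ) + 1 + 1 / 2)) := by
      apply one_div_le_one_div_of_le (by positivity)
      nlinarith
    linarith
  have h1 : Tendsto (fun n : ℕ => harm 2 n) atTop (𝓝 (Real.pi ^ 2 / 6)) := by
    refine ((hasSum_zeta_two.tendsto_sum_nat).comp (tendsto_add_atTop_nat 1)).congr fun n => ?_
    simp only [Function.comp]
    unfold harm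
    rw [Finset.range_eq_Ico, Finset.sum_eq_sum_Ico_succ_bot (by omega)]
    simp
    rfl
  have h2 : Tendsto (fun n : ℕ => 1 / ((n : ℝ) + 1 / 2)) atTop (𝓝 0) := by
    refine Tendsto.congr (fun n => (one_div _).symm) (tendsto_inv_atTop_zero.comp ?_)
    exact tendsto_atTop_add_const_right _ _ tendsto_natCast_atTop_atTop
  have h3 := h1.add h2
  rw [add_zero] at h3
  exact hanti.le_of_tendsto h3 m

/-- Multiplying `zeta_two_le` by m + 1 costs at most 8/7, since (m+1)/(m+1/2) ≤ 8/7. The claim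
follows because 2 · π²/6 > 16/5 > 2 + 8/7. -/
theorem constK_pos (hm : 3 ≤ m) : 0 < constK m := by
  have h1 := zeta_two_le m
  have hm' : (3 : ℝ) ≤ m := by exact_mod_cast hm
  have ho := occ_pos (m := m) (by omega)
  have hpi : 8 / 5 < Real.pi ^ 2 / 6 := by nlinarith [Real.pi_gt_d2]
  unfold constK
  refine mul_pos (by positivity) ?_
  rw [sub_pos, lt_div_iff₀ (by linarith)]
  have h2 : (m : ℝ) + 1 = ((m : ℝ) + 1 / 2) + 1 / 2 := by ring
  have h3 : ((m : ℝ) + 1) * (1 / ((m : ℝ) + 1 / 2)) ≤ 8 / 7 := by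
    rw [mul_one_div, div_le_div_iff₀ (by linarith) (by norm_num)]
    linarith
  have h4 := mul_le_mul_of_nonneg_left h1 (show (0 : ℝ) ≤ m + 1 by linarith)
  rw [mul_add] at h4
  linarith

theorem tollCov_self_nonneg {n : ℕ} (hm : 2 ≤ m) (hn : m - 1 ≤ n) (x : ℕ → ℝ) :
    0 ≤ tollCov m n x x := by
  have hc : (0 : ℝ) < n.choose (m - 1) := by exact_mod_cast Nat.choose_pos hn
  unfold tollCov compMean compAvg
  have h := sq_sum_le_card_mul_sum_sq (s := Finset.piAntidiag (Finset.univ : Finset (Fin m))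
    (n - (m - 1))) (f := fun c => ∑ i, x (c i))
  rw [card_comp hm hn] at h
  rw [sub_nonneg, div_mul_div_comm, div_le_div_iff₀ (by positivity) hc]
  simp only [← sq]
  nlinarith

theorem tollCov_sq_le {n : ℕ} (hm : 2 ≤ m) (hn : m - 1 ≤ n) (x y : ℕ → ℝ) :
    tollCov m n x y ^ 2 ≤ tollCov m n x x * tollCov m n y y := by
  have h : ∀ t : ℝ, 0 ≤ tollCov m n y y * (t * t) + 2 * tollCov m n x y * t +
      tollCov m n x x := by
    intro t
    have h1 := tollCov_self_nonneg hm hn (fun i => x i + t * y i)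
    rw [tollCov_add_left, tollCov_add_right, tollCov_add_right, tollCov_const_mul_left,
      tollCov_const_mul_left, tollCov_const_mul_right, tollCov_const_mul_right,
      tollCov_comm y x] at h1
    linarith
  have := discrim_le_zero h
  unfold discrim at this
  nlinarith

theorem permCov_self_nonneg (n : ℕ) (f : List ℕ → ℝ) : 0 ≤ permCov n f f := by
  rw [← variance_unifPerm]
  exact variance_nonneg _ _

theorem tollCov_le_permCov_sizeFun {n : ℕ} (hm : 2 ≤ m) (hn : m - 1 ≤ n) :
    tollCov m n (fun j => permAvg j (sizeFun m)) (fun j => permAvg j (sizeFun m)) ≤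
      permCov n (sizeFun m) (sizeFun m) := by
  rw [permCov_sizeFun_rec hm hn]
  have h := compMean_mono hm hn (x := fun _ => (0 : ℝ))
    (y := fun j => permCov j (sizeFun m) (sizeFun m)) fun j _ => permCov_self_nonneg j _
  rw [compMean_const hm hn, mul_zero] at h
  linarith

/-- Take the integers ⌈exp((z + 2πj)/β)⌉: rounding changes the logarithm by o(1), so β log n comes
arbitrarily close to every phase modulo 2π. -/
theorem exists_log_subseq {β : ℝ} (hβ : 0 < β) (z : ℝ) : ∃ k : ℕ → ℕ, Tendsto k atTop atTop ∧
    Tendsto (fun j : ℕ => β * Real.log (k j) - j * (2 * Real.pi)) atTop (𝓝 z) := by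
  set x : ℕ → ℝ := fun j => Real.exp ((z + j * (2 * Real.pi)) / β) with hx
  have hxt : Tendsto x atTop atTop := by
    refine Real.tendsto_exp_atTop.comp (Tendsto.atTop_div_const hβ ?_)
    exact tendsto_atTop_add_const_left _ _
      (tendsto_natCast_atTop_atTop.atTop_mul_const (by positivity))
  refine ⟨fun j => ⌈x j⌉₊, tendsto_nat_ceil_atTop.comp hxt, ?_⟩
  have h1 : Tendsto (fun j => Real.log ((⌈x j⌉₊ : ℝ) / x j)) atTop (𝓝 0) := by
    have h := (Real.continuousAt_log one_ne_zero).tendsto.comp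
      ((tendsto_nat_ceil_div_atTop (R := ℝ)).comp hxt)
    rw [Real.log_one] at h
    exact h
  have h2 := (h1.const_mul β).add_const z
  rw [mul_zero, zero_add] at h2
  refine h2.congr fun j => ?_
  have hx0 : 0 < x j := Real.exp_pos _
  have hc0 : (0 : ℝ) < ⌈x j⌉₊ := by exact_mod_cast Nat.ceil_pos.2 hx0
  rw [Real.log_div hc0.ne' hx0.ne', hx, Real.log_exp]
  field_simp
  ring

/-- Turns an asymptotic inequality along β log n into one for every real phase. -/
theorem nonneg_of_log_lower {β : ℝ} (hβ : 0 < β) {g : ℝ → ℝ} (hg : Continuous g)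
    (hper : Function.Periodic g (2 * Real.pi)) {ε : ℕ → ℝ} (hε : Tendsto ε atTop (𝓝 0))
    (h : ∀ᶠ n : ℕ in atTop, ε n ≤ g (β * Real.log n)) (z : ℝ) : 0 ≤ g z := by
  obtain ⟨k, hk, hkz⟩ := exists_log_subseq hβ z
  refine le_of_tendsto_of_tendsto (hε.comp hk) ((hg.tendsto z).comp hkz) ?_
  filter_upwards [hk.eventually h] with j hj
  simp only [Function.comp]
  rwa [hper.sub_nat_mul_eq]

theorem continuous_F1 (m : ℕ) (lam : ℂ) : Continuous (F1 m lam) := by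
  unfold F1
  fun_prop

theorem periodic_F1 (m : ℕ) (lam : ℂ) : Function.Periodic (F1 m lam) (2 * Real.pi) := by
  intro z
  unfold F1
  have : Complex.exp (2 * Complex.I * ((z + 2 * Real.pi : ℝ) : ℂ)) =
      Complex.exp (2 * Complex.I * z) := by
    push_cast
    rw [show 2 * Complex.I * ((z : ℂ) + 2 * Real.pi) = 2 * Complex.I * z +
      (2 : ℤ) * (2 * Real.pi * Complex.I) by push_cast; ring, Complex.exp_add,
      Complex.exp_int_mul_two_pi_mul_I, mul_one]
  rw [this]

/-- The first harmonic of the toll covariance of the number of nodes and `qseq t`. -/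
noncomputable def tollWave (m : ℕ) (lam : ℂ) (t : ℝ) (z : ℝ) : ℝ :=
  2 * (coeffA m lam * tollCoeff m lam t / Complex.Gamma (lam + t - 1) *
    Complex.exp (Complex.I * z)).re

theorem tollCoeff_conj (m : ℕ) (s : ℂ) (t : ℝ) :
    tollCoeff m (starRingEnd ℂ s) t = starRingEnd ℂ (tollCoeff m s t) := by
  unfold tollCoeff
  have h2 : starRingEnd ℂ s + (t : ℂ) - 1 = starRingEnd ℂ (s + t - 1) := by simp
  have h3 : starRingEnd ℂ (risingProd m t) = risingProd m t := by
    rw [← risingProd_conj, Complex.conj_ofReal]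
  have h4 : starRingEnd ℂ (Complex.Gamma t) = Complex.Gamma t := by
    rw [← Complex.Gamma_conj, Complex.conj_ofReal]
  rw [h2, Complex.Gamma_conj, Complex.Gamma_conj, risingProd_conj, risingProd_conj]
  simp [h3, h4]

theorem tendsto_tollCov_qreal (hm : 27 ≤ m) {lam : ℂ} (hlam : IsSecondZero m lam) {t : ℝ}
    (ht : 1 < t) :
    Tendsto (fun n : ℕ => tollCov m n (fun j => permAvg j (sizeFun m)) (qreal t) /
      (n : ℝ) ^ (lam.re + t - 2) - tollWave m lam t (lam.im * Real.log n)) atTop (𝓝 0) := by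
  have hm2 : 2 ≤ m := by omega
  have hα := hlam.re_gt hm
  obtain ⟨e, a, b, he, heq⟩ := exists_permAvg_sizeFun hm hlam
  set lam' := starRingEnd ℂ lam with hlam'
  have hre' : lam'.re = lam.re := Complex.conj_re lam
  set w := lam.re + t - 2 with hw
  set A := coeffA m lam with hA
  set A' := coeffA m lam' with hA'
  have r1 : (lam + (t : ℂ) - 1).re = w + 1 := by
    simp only [Complex.sub_re, Complex.add_re, Complex.one_re, Complex.ofReal_re]; rw [hw]; ring
  have r2 : (lam' + (t : ℂ) - 1).re = w + 1 := by
    simp only [Complex.sub_re, Complex.add_re, Complex.one_re, Complex.ofReal_re]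
    rw [hre', hw]; ring
  have htre : 0 < ((t : ℂ)).re := by rw [Complex.ofReal_re]; linarith
  have t1 := (tollCov_qseq_isLittleO hm2 (s := lam) (t := (t : ℂ)) (a := w) (by linarith) htre
    (by rw [r1]; linarith) (by rw [r1]; ring)).const_mul_left A
  have t2 := (tollCov_qseq_isLittleO hm2 (s := lam') (t := (t : ℂ)) (a := w) (by linarith) htre
    (by rw [r2]; linarith) (by rw [r2]; ring)).const_mul_left A'
  have hq : qseq (t : ℂ) =O[atTop] fun n : ℕ => (n : ℝ) ^ (t - 1) := by
    simpa using qseq_isBigO (t : ℂ)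
  have t3 := isLittleO_tollCov hm2 (a := lam.re - 1) (b := t - 1) (by linarith) (by linarith) he hq
  rw [show lam.re - 1 + (t - 1) = w by rw [hw]; ring] at t3
  have h1 : (fun n => ((tollCov m n (fun j => permAvg j (sizeFun m)) (qreal t) : ℝ) : ℂ) -
      (A * tollCoeff m lam t * qseq (lam + t - 1) n +
        A' * tollCoeff m lam' t * qseq (lam' + t - 1) n)) =o[atTop]
      fun n : ℕ => (n : ℝ) ^ w := by
    refine ((t1.add t2).add t3).congr' ?_ EventuallyEq.rfl
    filter_upwards [eventually_ge_atTop (m - 1)] with n hn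
    rw [← tollCov_ofReal]
    have hqr : (fun i => ((qreal t i : ℝ) : ℂ)) = qseq (t : ℂ) := by
      funext i; exact (qseq_ofReal t i).symm
    simp only [heq]
    rw [hqr, tollCov_add_left, tollCov_affine hm2 hn, tollCov_add_left, tollCov_add_left,
      tollCov_const_mul_left, tollCov_const_mul_left]
    ring
  have h2 : Tendsto (fun n : ℕ => ((((tollCov m n (fun j => permAvg j (sizeFun m)) (qreal t) : ℝ)
      : ℂ) - (A * tollCoeff m lam t * qseq (lam + t - 1) n +
        A' * tollCoeff m lam' t * qseq (lam' + t - 1) n))) / (((n : ℝ) ^ w : ℝ) : ℂ)) atTop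
      (𝓝 0) := by
    rw [tendsto_zero_iff_norm_tendsto_zero]
    refine h1.norm_left.tendsto_div_nhds_zero.congr fun n => ?_
    rw [norm_div, Complex.norm_real, Real.norm_of_nonneg (by positivity)]
  have h3 := ((tendsto_qseq_osc r1 (by linarith)).const_mul (A * tollCoeff m lam t))
  have h4 := ((tendsto_qseq_osc r2 (by linarith)).const_mul (A' * tollCoeff m lam' t))
  have h5 := (h2.add h3).add h4
  simp only [mul_zero, add_zero] at h5
  refine tendsto_ofReal_sub (h5.congr fun n => ?_)
  have i1 : (lam + (t : ℂ) - 1).im = lam.im := by simp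
  have i2 : (lam' + (t : ℂ) - 1).im = -lam.im := by simp [hlam']
  have hc : (tollWave m lam t (lam.im * Real.log n) : ℂ) =
      A * tollCoeff m lam t * (1 / Complex.Gamma (lam + t - 1) *
        Complex.exp (Complex.I * ((lam.im * Real.log n : ℝ) : ℂ))) +
      A' * tollCoeff m lam' t * (1 / Complex.Gamma (lam' + t - 1) *
        Complex.exp (Complex.I * ((-lam.im * Real.log n : ℝ) : ℂ))) := by
    have h6 : lam' + (t : ℂ) - 1 = starRingEnd ℂ (lam + t - 1) := by simp [hlam']
    unfold tollWave
    rw [← Complex.add_conj, ← hA, h6, Complex.Gamma_conj, hA', hlam', tollCoeff_conj, coeffA_conj,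
      map_mul, map_div₀, map_mul, ← Complex.exp_conj, map_mul, Complex.conj_ofReal,
      Complex.conj_I, ← hA]
    push_cast
    ring_nf
  rw [hc, Complex.ofReal_div, i1, i2]
  ring

theorem periodic_tollWave (m : ℕ) (lam : ℂ) (t : ℝ) :
    Function.Periodic (tollWave m lam t) (2 * Real.pi) := by
  intro z
  unfold tollWave
  have : Complex.exp (Complex.I * ((z + 2 * Real.pi : ℝ) : ℂ)) = Complex.exp (Complex.I * z) := by
    push_cast
    rw [mul_add, show Complex.I * (2 * (Real.pi : ℂ)) = 2 * Real.pi * Complex.I by ring,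
      Complex.exp_add, Complex.exp_two_pi_mul_I, mul_one]
  rw [this]

theorem abs_tollWave_le (m : ℕ) (lam : ℂ) (t z : ℝ) : |tollWave m lam t z| ≤
    2 * ‖coeffA m lam * tollCoeff m lam t / Complex.Gamma (lam + t - 1)‖ := by
  unfold tollWave
  rw [abs_mul, abs_two]
  refine mul_le_mul_of_nonneg_left ((Complex.abs_re_le_norm _).trans ?_) zero_le_two
  rw [norm_mul, mul_comm Complex.I, Complex.norm_exp_ofReal_mul_I, mul_one]

/-- Cauchy–Schwarz for the composition bounds the squared toll covariance of S with `qreal t` by Var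
S times a toll variance of order n^(2t-2). Dividing by the powers of `n` and passing to arbitrary
phases gives the inequality. -/
theorem exists_tollWave_sq_le (hm : 27 ≤ m) {lam : ℂ} (hlam : IsSecondZero m lam) {t : ℝ}
    (ht : 1 < t) : ∃ D : ℝ, ∀ z, tollWave m lam t z ^ 2 ≤ D * F1 m lam z := by
  have hm2 : 2 ≤ m := by omega
  have hα := hlam.re_gt hm
  have htre : 0 < ((t : ℂ)).re := by rw [Complex.ofReal_re]; linarith
  have hre : ((t : ℂ) + t - 1).re - 1 = 2 * t - 2 := by simp; ring
  have h1 := tollCov_qseq_isLittleO hm2 (s := (t : ℂ)) (t := (t : ℂ)) (a := 2 * t - 2) htre htre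
    (by linarith) hre
  have h2 : (fun n : ℕ => tollCov m n (qseq t) (qseq t)) =O[atTop]
      fun n : ℕ => (n : ℝ) ^ (2 * t - 2) := by
    have h3 : (fun n => tollCoeff m t t * qseq ((t : ℂ) + t - 1) n) =O[atTop]
        fun n : ℕ => (n : ℝ) ^ (2 * t - 2) := by
      rw [← hre]; exact (qseq_isBigO _).const_mul_left _
    simpa using h1.isBigO.add h3
  obtain ⟨D, hD, hDb⟩ := h2.exists_pos
  have a1 := tendsto_permCov_sizeFun hm hlam
  have b1 := tendsto_tollCov_qreal hm hlam ht
  set R : ℝ := 2 * ‖coeffA m lam * tollCoeff m lam t / Complex.Gamma (lam + t - 1)‖ with hR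
  set a : ℕ → ℝ := fun n : ℕ => permCov n (sizeFun m) (sizeFun m) / (n : ℝ) ^ (2 * lam.re - 2) -
      F1 m lam (lam.im * Real.log n) with ha
  set b : ℕ → ℝ := fun n : ℕ => tollCov m n (fun j => permAvg j (sizeFun m)) (qreal t) /
      (n : ℝ) ^ (lam.re + t - 2) - tollWave m lam t (lam.im * Real.log n) with hb
  refine ⟨D, fun z => ?_⟩
  rw [← sub_nonneg]
  refine nonneg_of_log_lower hlam.2.2.1 (g := fun z => D * F1 m lam z - tollWave m lam t z ^ 2)
    (ε := fun n => -(D * a n) - 2 * R * |b n|) ?_ ?_ ?_ ?_ z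
  · have := continuous_F1 m lam
    unfold tollWave
    fun_prop
  · intro x
    simp only [periodic_F1 m lam x, periodic_tollWave m lam t x]
  · have := (a1.const_mul D).neg.sub (b1.abs.const_mul (2 * R))
    simpa using this
  · filter_upwards [hDb.bound, eventually_ge_atTop (m - 1), eventually_gt_atTop 0] with n hn hmn hn0
    have hn0' : (0 : ℝ) < n := by exact_mod_cast hn0
    have hqr : (fun i => ((qreal t i : ℝ) : ℂ)) = qseq (t : ℂ) := by
      funext i; exact (qseq_ofReal t i).symm
    rw [← hqr, tollCov_ofReal, Complex.norm_real,
      Real.norm_of_nonneg (tollCov_self_nonneg hm2 hmn _), Real.norm_of_nonneg (by positivity)] at hn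
    have c1 := tollCov_sq_le hm2 hmn (fun j => permAvg j (sizeFun m)) (qreal t)
    have c2 := tollCov_le_permCov_sizeFun hm2 hmn
    have c3 := hn
    have hV := permCov_self_nonneg n (sizeFun m)
    have c4 : tollCov m n (fun j => permAvg j (sizeFun m)) (qreal t) ^ 2 ≤
        permCov n (sizeFun m) (sizeFun m) * (D * (n : ℝ) ^ (2 * t - 2)) :=
      c1.trans (mul_le_mul c2 c3 (tollCov_self_nonneg hm2 hmn _) hV)
    have e1 : ((n : ℝ) ^ (lam.re + t - 2)) ^ 2 =
        (n : ℝ) ^ (2 * lam.re - 2) * (n : ℝ) ^ (2 * t - 2) := by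
      rw [← Real.rpow_natCast, ← Real.rpow_mul hn0'.le, ← Real.rpow_add hn0']
      congr 1; push_cast; ring
    have hp1 : 0 < (n : ℝ) ^ (2 * lam.re - 2) := by positivity
    have hp2 : 0 < (n : ℝ) ^ (2 * t - 2) := by positivity
    have c5 : (tollCov m n (fun j => permAvg j (sizeFun m)) (qreal t) /
        (n : ℝ) ^ (lam.re + t - 2)) ^ 2 ≤
        D * (permCov n (sizeFun m) (sizeFun m) / (n : ℝ) ^ (2 * lam.re - 2)) := by
      rw [div_pow, e1, div_le_iff₀ (by positivity)]
      refine c4.trans (le_of_eq ?_)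
      field_simp
    have e2 : tollCov m n (fun j => permAvg j (sizeFun m)) (qreal t) /
        (n : ℝ) ^ (lam.re + t - 2) = b n + tollWave m lam t (lam.im * Real.log n) := by
      simp only [hb]; ring
    have e3 : permCov n (sizeFun m) (sizeFun m) / (n : ℝ) ^ (2 * lam.re - 2) =
        a n + F1 m lam (lam.im * Real.log n) := by
      simp only [ha]; ring
    rw [e2, e3] at c5
    have c6 := abs_tollWave_le m lam t (lam.im * Real.log n)
    rw [← hR] at c6
    have c7 : -(b n * tollWave m lam t (lam.im * Real.log n)) ≤ R * |b n| := by
      refine (neg_le_abs _).trans ?_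
      rw [abs_mul, mul_comm]
      exact mul_le_mul_of_nonneg_right c6 (abs_nonneg _)
    nlinarith [sq_nonneg (b n)]

theorem add_sub_one_ne_zero (hm : 2 ≤ m) {s : ℂ} (hs0 : 0 < s.re) : s + m - 1 ≠ 0 := by
  have := add_natCast_ne_zero hs0 (m - 1)
  rwa [Nat.cast_sub (by omega), Nat.cast_one, ← add_sub_assoc] at this

theorem factorial_div_risingProd_add_one (hm : 2 ≤ m) {s : ℂ} (hs0 : 0 < s.re) :
    m.factorial / risingProd m (s + 1) =
      m.factorial / risingProd m s * (s / (s + m - 1)) := by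
  have hs00 : s ≠ 0 := fun h => by rw [h] at hs0; simp at hs0
  have h := mul_risingProd_add_one hm s
  have h1 := add_sub_one_ne_zero hm hs0
  have h2 := risingProd_ne_zero (m := m) hs0
  have h3 := risingProd_ne_zero (m := m) (s := s + 1) (by simp; linarith)
  rw [div_mul_div_comm, div_eq_div_iff h3 (mul_ne_zero h2 h1)]
  linear_combination (-(m.factorial : ℂ)) * h

/-- The leading coefficients of the toll covariances with `qseq 3` and `qseq 4` share a factor. -/
theorem tollCoeff_three_four (hm : 3 ≤ m) {s : ℂ} (hs : s ∈ indicialRoots m) (hs0 : 0 < s.re) :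
    tollCoeff m s (3 : ℝ) / Complex.Gamma (s + (3 : ℝ) - 1) = (m - 1) / (2 * (m + 1)) * (s + m + 1) *
      ((s - 1) * (s - 2) / (Complex.Gamma s * ((s + m - 1) * (s + m) * (s + m + 1)))) ∧
    tollCoeff m s (4 : ℝ) / Complex.Gamma (s + (4 : ℝ) - 1) =
      ((m + 4) * (m - 1) / (6 * (m + 1) * (m + 2)) * s + (m - 1) / (m + 2)) *
      ((s - 1) * (s - 2) / (Complex.Gamma s * ((s + m - 1) * (s + m) * (s + m + 1)))) := by
  have hm2 : 2 ≤ m := by omega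
  have hf : (m.factorial : ℂ) ≠ 0 := by exact_mod_cast m.factorial_ne_zero
  have re1 : 0 < (s + 1).re := by simp; linarith
  have re2 : 0 < (s + 2).re := by simp; linarith
  have hs00 : s ≠ 0 := fun h => by rw [h] at hs0; simp at hs0
  have hs1 : s + 1 ≠ 0 := by simpa using add_natCast_ne_zero hs0 1
  have hs2 : s + 2 ≠ 0 := by simpa using add_natCast_ne_zero hs0 2
  have hm1 : (m : ℂ) + 1 ≠ 0 := by exact_mod_cast (by omega : m + 1 ≠ 0)
  have hmm2 : (m : ℂ) + 2 ≠ 0 := by exact_mod_cast (by omega : m + 2 ≠ 0)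
  have d0 := add_sub_one_ne_zero hm2 hs0
  have d1 : s + m ≠ 0 := add_natCast_ne_zero hs0 m
  have d2 : s + m + 1 ≠ 0 := by
    have := add_natCast_ne_zero hs0 (m + 1)
    rwa [Nat.cast_add, Nat.cast_one, ← add_assoc] at this
  have hG := Complex.Gamma_ne_zero_of_re_pos hs0
  have p0 : m.factorial / risingProd m s = 1 := by
    rw [(mem_indicialRoots hm2).1 hs, div_self hf]
  have p1 := factorial_div_risingProd_add_one hm2 hs0
  have p2 := factorial_div_risingProd_add_one hm2 re1
  have p3 := factorial_div_risingProd_add_one hm2 re2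
  have q2 := factorial_div_risingProd_add_one hm2 (s := 2) (by norm_num)
  have q3 := factorial_div_risingProd_add_one hm2 (s := 3) (by norm_num)
  rw [(mem_indicialRoots hm2).1 (two_mem_indicialRoots hm2), div_self hf,
    show (2 : ℂ) + 1 = 3 by norm_num, one_mul, show 2 + (m : ℂ) - 1 = m + 1 by ring] at q2
  rw [show (3 : ℂ) + 1 = 4 by norm_num, show 3 + (m : ℂ) - 1 = m + 2 by ring, q2] at q3
  rw [p0, one_mul] at p1
  rw [p1, show s + 1 + 1 = s + 2 by ring, show s + 1 + m - 1 = s + m by ring] at p2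
  rw [p2, show s + 2 + 1 = s + 3 by ring, show s + 2 + m - 1 = s + m + 1 by ring] at p3
  have g1 := Complex.Gamma_add_one s hs00
  have g2 := Complex.Gamma_add_one (s + 1) hs1
  have g3 := Complex.Gamma_add_one (s + 2) hs2
  rw [show s + 1 + 1 = s + 2 by ring, g1] at g2
  rw [show s + 2 + 1 = s + 3 by ring, g2] at g3
  have G3 : Complex.Gamma 3 = 2 := by simp
  have G4 : Complex.Gamma 4 = 6 := by
    have := Complex.Gamma_nat_eq_factorial 3
    rw [show ((3 : ℕ) : ℂ) + 1 = 4 by norm_num] at this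
    rw [this]; norm_num [Nat.factorial]
  constructor
  · push_cast
    rw [tollCoeff, show s + 3 - 1 = s + 2 by ring, p0, p2, q2, g2, G3]
    field_simp
    ring
  · push_cast
    rw [tollCoeff, show s + 4 - 1 = s + 3 by ring, p0, p3, q3, g3, G4]
    field_simp
    ring

/-- Nonnegativity is inherited from the variance. At a zero of F₁ the waves for t = 3 and t = 4
would both vanish, which two independent linear conditions on one complex number exclude. -/
theorem F1_pos (hm : 27 ≤ m) {lam : ℂ} (hlam : IsSecondZero m lam) (z : ℝ) :
    0 < F1 m lam z := by
  have hm2 : 2 ≤ m := by omega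
  have hm3 : 3 ≤ m := by omega
  have hα := hlam.re_gt hm
  have hs := mem_of_isSecondZero hm2 hlam
  have hs0 : 0 < lam.re := by linarith
  obtain ⟨D3, h3⟩ := exists_tollWave_sq_le hm hlam (t := 3) (by norm_num)
  obtain ⟨D4, h4⟩ := exists_tollWave_sq_le hm hlam (t := 4) (by norm_num)
  have hF : 0 ≤ F1 m lam z := by
    refine nonneg_of_log_lower hlam.2.2.1 (continuous_F1 m lam) (periodic_F1 m lam)
      (ε := fun n => -(permCov n (sizeFun m) (sizeFun m) / (n : ℝ) ^ (2 * lam.re - 2) -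
        F1 m lam (lam.im * Real.log n))) ?_ ?_ z
    · simpa using (tendsto_permCov_sizeFun hm hlam).neg
    · refine Eventually.of_forall fun n => ?_
      have : 0 ≤ permCov n (sizeFun m) (sizeFun m) / (n : ℝ) ^ (2 * lam.re - 2) :=
        div_nonneg (permCov_self_nonneg _ _) (by positivity)
      linarith
  refine hF.lt_of_ne fun h0 => ?_
  have w3 := h3 z
  have w4 := h4 z
  rw [← h0, mul_zero] at w3 w4
  have w3' : tollWave m lam 3 z = 0 := by
    exact pow_eq_zero_iff (two_ne_zero) |>.1 (le_antisymm w3 (sq_nonneg _))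
  have w4' : tollWave m lam 4 z = 0 := by
    exact pow_eq_zero_iff (two_ne_zero) |>.1 (le_antisymm w4 (sq_nonneg _))
  obtain ⟨c3, c4⟩ := tollCoeff_three_four hm3 hs hs0
  -- The nonzero factor common to both waves; each wave is then a real combination of Re W and
  -- Re(Wλ).
  set W := coeffA m lam * ((lam - 1) * (lam - 2) / (Complex.Gamma lam *
    ((lam + m - 1) * (lam + m) * (lam + m + 1)))) * Complex.exp (Complex.I * z) with hW
  have hW0 : W ≠ 0 := by
    have h1 : lam ≠ 0 := fun h => by rw [h] at hs0; simp at hs0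
    have h2 : lam - 1 ≠ 0 := fun h => by
      rw [sub_eq_zero.1 h] at hα; norm_num at hα
    have h3 : lam - 2 ≠ 0 := sub_ne_zero.2 hlam.2.1
    have h4 := ell_ne_zero_of_root hm3 ((mem_indicialRoots hm2).1 hs)
    have h5 := Complex.Gamma_ne_zero_of_re_pos hs0
    have h6 := add_sub_one_ne_zero hm2 hs0
    have d1 : lam + m ≠ 0 := add_natCast_ne_zero hs0 m
    have d2 : lam + m + 1 ≠ 0 := by
      have := add_natCast_ne_zero hs0 (m + 1)
      rwa [Nat.cast_add, Nat.cast_one, ← add_assoc] at this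
    rw [hW, coeffA_eq]
    refine mul_ne_zero (mul_ne_zero (one_div_ne_zero (mul_ne_zero (mul_ne_zero h1 h2) h4))
      (div_ne_zero (mul_ne_zero h2 h3) (mul_ne_zero h5 (mul_ne_zero (mul_ne_zero h6 d1) d2))))
      (Complex.exp_ne_zero _)
  have hm' : (27 : ℝ) ≤ m := by exact_mod_cast hm
  unfold tollWave at w3' w4'
  rw [mul_div_assoc, c3, show coeffA m lam * ((m - 1) / (2 * (m + 1)) * (lam + m + 1) *
      ((lam - 1) * (lam - 2) / (Complex.Gamma lam * ((lam + m - 1) * (lam + m) * (lam + m + 1))))) *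
      Complex.exp (Complex.I * z) =
      (((m - 1) / (2 * (m + 1)) : ℝ) : ℂ) * (W * lam + ((m + 1 : ℝ) : ℂ) * W) by
        rw [hW]; push_cast; ring,
    Complex.re_ofReal_mul, Complex.add_re, Complex.re_ofReal_mul] at w3'
  rw [mul_div_assoc, c4, show coeffA m lam * (((m + 4) * (m - 1) / (6 * (m + 1) * (m + 2)) * lam +
      (m - 1) / (m + 2)) *
      ((lam - 1) * (lam - 2) / (Complex.Gamma lam * ((lam + m - 1) * (lam + m) * (lam + m + 1))))) *
      Complex.exp (Complex.I * z) =
      (((m + 4) * (m - 1) / (6 * (m + 1) * (m + 2)) : ℝ) : ℂ) * (W * lam) +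
        (((m - 1) / (m + 2) : ℝ) : ℂ) * W by
        rw [hW]; push_cast; ring,
    Complex.add_re, Complex.re_ofReal_mul, Complex.re_ofReal_mul] at w4'
  set X := (W * lam).re with hX
  have k1 : X = -((m + 1) * W.re) := by
    have : ((m : ℝ) - 1) / (2 * (m + 1)) ≠ 0 := by
      apply div_ne_zero <;> linarith
    have h := mul_eq_zero.1 ((mul_eq_zero.1 w3').resolve_left two_ne_zero)
    have := h.resolve_left this
    linarith
  have k2 : ((m : ℝ) + 4) * (m - 1) / (6 * (m + 1) * (m + 2)) * X + (m - 1) / (m + 2) * W.re = 0 :=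
    (mul_eq_zero.1 w4').resolve_left two_ne_zero
  -- Eliminating Re(Wλ) leaves a nonzero multiple of (m - 1)(2 - m) Re W. Then Re(Wλ) = -Im W · Im λ
  -- gives Im W = 0 as well.
  have k3 : W.re = 0 := by
    rw [k1] at k2
    have hm1 : (m : ℝ) + 1 ≠ 0 := by positivity
    have hmm2 : (m : ℝ) + 2 ≠ 0 := by positivity
    field_simp at k2
    have : ((m : ℝ) - 1) * (2 - m) ≠ 0 := by
      apply mul_ne_zero <;> linarith
    refine (mul_eq_zero.1 (show (((m : ℝ) - 1) * (2 - m)) * W.re = 0 by linarith)).resolve_left this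
  have k4 : W.im = 0 := by
    rw [k3, mul_zero, neg_zero, hX, Complex.mul_re, k3, zero_mul, zero_sub, neg_eq_zero] at k1
    exact (mul_eq_zero.1 k1).resolve_right hlam.2.2.1.ne'
  exact hW0 (Complex.ext k3 k4)

end Positivity

/-! ### A linear lower bound for Var S. -/

section LinearLowerBound

variable {m : ℕ}

/-- Comparison with the test sequence n + 2 - E · qreal (1/2) n, which from some index on is at most
its own average. The subtracted null sequence makes it nonpositive for n < n₁, where `V` may vanish,
and `C` covers the finitely many indices between. -/
theorem exists_linear_lower (hm : 2 ≤ m) {V : ℕ → ℝ} (hV : ∀ n, 0 ≤ V n)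
    (hrec : ∀ n, m - 1 ≤ n → compMean m n V ≤ V n) {n₁ : ℕ} (hpos : ∀ n, n₁ ≤ n → 0 < V n) :
    ∃ c > 0, ∀ᶠ n : ℕ in atTop, c * n ≤ V n := by
  have hq : ∀ n, 0 < qreal (1 / 2) n := qreal_pos (by norm_num)
  have hq0 : Tendsto (qreal (1 / 2)) atTop (𝓝 0) := by
    refine (isBigO_qreal (s := 1 / 2) (by norm_num)).trans_tendsto ?_
    have h := (tendsto_rpow_neg_atTop (show (0 : ℝ) < 1 / 2 by norm_num)).comp
      (tendsto_natCast_atTop_atTop (R := ℝ))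
    refine h.congr fun n => ?_
    simp only [Function.comp]
    norm_num
  set M := m.factorial / risingReal m (1 / 2) with hM
  have hM0 : 0 < M := div_pos (by positivity) (risingReal_pos m (by norm_num))
  set E := ∑ i ∈ Finset.range n₁, ((i : ℝ) + 2) / qreal (1 / 2) i with hE
  have hE0 : 0 ≤ E := Finset.sum_nonneg fun i _ => div_nonneg (by positivity) (hq i).le
  have h1 : ∀ᶠ n in atTop, E * M * qreal (1 / 2) n < 1 ∧ E * qreal (1 / 2) n < 1 := by
    have t1 := hq0.const_mul (E * M)
    have t2 := hq0.const_mul E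
    rw [mul_zero] at t1 t2
    exact (t1.eventually (gt_mem_nhds one_pos)).and (t2.eventually (gt_mem_nhds one_pos))
  rw [eventually_atTop] at h1
  obtain ⟨N, hN⟩ := h1
  set N' := max N (max n₁ (m - 1)) with hN'
  set C := 1 + ∑ i ∈ Finset.Ico n₁ N', ((i : ℝ) + 2) / V i with hC
  have hsum : 0 ≤ ∑ i ∈ Finset.Ico n₁ N', ((i : ℝ) + 2) / V i :=
    Finset.sum_nonneg fun i _ => div_nonneg (by positivity) (hV i)
  have hC0 : 0 < C := by linarith
  have key : ∀ n : ℕ, (n : ℝ) + 1 + 1 - E * qreal (1 / 2) n ≤ C * V n := by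
    intro n
    induction n using Nat.strong_induction_on with
    | _ n ih =>
      rcases lt_or_ge n n₁ with h | h
      · have h2 : ((n : ℝ) + 2) / qreal (1 / 2) n ≤ E :=
          Finset.single_le_sum (f := fun i : ℕ => ((i : ℝ) + 2) / qreal (1 / 2) i)
            (fun i _ => div_nonneg (by positivity) (hq i).le) (Finset.mem_range.2 h)
        rw [div_le_iff₀ (hq n)] at h2
        have := mul_nonneg hC0.le (hV n)
        linarith
      · rcases lt_or_ge n N' with h' | h'
        · have h2 : ((n : ℝ) + 2) / V n ≤ ∑ i ∈ Finset.Ico n₁ N', ((i : ℝ) + 2) / V i :=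
            Finset.single_le_sum (f := fun i : ℕ => ((i : ℝ) + 2) / V i)
              (fun i _ => div_nonneg (by positivity) (hV i)) (Finset.mem_Ico.2 ⟨h, h'⟩)
          have h3 : ((n : ℝ) + 2) / V n ≤ C := by linarith
          rw [div_le_iff₀ (hpos n h)] at h3
          have := mul_nonneg hE0 (hq n).le
          linarith
        · have hmn : m - 1 ≤ n := (le_max_right _ _).trans ((le_max_right _ _).trans h')
          obtain ⟨h4, -⟩ := hN n ((le_max_left _ _).trans h')
          have h5 := compMean_mono hm hmn ih
          have e1 : compMean m n (fun j => (j : ℝ) + 1 + 1 - E * qreal (1 / 2) j) =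
              ((n : ℝ) - (m - 1)) + m + m - E * (M * qreal (1 / 2) n) := by
            have e2 : compMean m n (fun j => (j : ℝ) + 1 + 1 - E * qreal (1 / 2) j) =
                compMean m n (fun j => (j : ℝ)) + compMean m n (fun _ => (1 : ℝ)) +
                  compMean m n (fun _ => (1 : ℝ)) - E * compMean m n (qreal (1 / 2)) := by
              simp only [compMean, Finset.sum_sub_distrib, Finset.sum_add_distrib,
                ← Finset.mul_sum, compAvg_sub, compAvg_add, compAvg_const_mul]
            rw [e2, compMean_natCast hm hmn, compMean_const hm hmn,
              compMean_qreal hm hmn (by norm_num), Nat.cast_sub hmn, Nat.cast_sub (by omega)]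
            push_cast
            ring
          have e3 : compMean m n (fun j => C * V j) = C * compMean m n V := by
            simp only [compMean, ← Finset.mul_sum, compAvg_const_mul]
          rw [e1, e3] at h5
          have h6 := mul_le_mul_of_nonneg_left (hrec n hmn) hC0.le
          have h7 : (2 : ℝ) ≤ m := by exact_mod_cast hm
          have h8 := mul_nonneg hE0 (hq n).le
          linarith
  refine ⟨1 / C, one_div_pos.2 hC0, ?_⟩
  rw [eventually_atTop]
  refine ⟨N, fun n hn => ?_⟩
  have h2 := (hN n hn).2
  have h3 := key n
  rw [one_div_mul_eq_div, div_le_iff₀ hC0]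
  linarith

theorem tollCov_self_eq {n : ℕ} (hm : 2 ≤ m) (hn : m - 1 ≤ n) (x : ℕ → ℝ) :
    tollCov m n x x = compAvg m n (fun c => (∑ i, x (c i) - compMean m n x) ^ 2) := by
  have h : (fun c : Fin m → ℕ => (∑ i, x (c i) - compMean m n x) ^ 2) = fun c =>
      (∑ i, x (c i)) * (∑ i, x (c i)) - (2 * compMean m n x) * (∑ i, x (c i)) +
        compMean m n x ^ 2 := by
    funext c; ring
  rw [h, compAvg_add, compAvg_sub, compAvg_const_mul, compAvg_const hm hn]
  unfold tollCov
  have : compAvg m n (fun c => ∑ i, x (c i)) = compMean m n x := rfl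
  rw [this]
  ring

theorem le_compAvg_of_mem {n : ℕ} {F : (Fin m → ℕ) → ℝ} (hF : ∀ c, 0 ≤ F c) {c : Fin m → ℕ}
    (hc : c ∈ Finset.piAntidiag (Finset.univ : Finset (Fin m)) (n - (m - 1))) :
    F c / n.choose (m - 1) ≤ compAvg m n F :=
  div_le_div_of_nonneg_right (Finset.single_le_sum (f := F) (fun i _ => hF i) hc)
    (Nat.cast_nonneg _)

theorem permAvg_sizeFun_of_lt {n : ℕ} (h0 : n ≠ 0) (hn : n < m) : permAvg n (sizeFun m) = 1 := by
  rw [permAvg_congr (g := fun _ => 1) fun σ => ?_, permAvg_const]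
  have hl := valueList_length σ
  refine sizeFun_short _ (fun h => h0 ?_) (by omega)
  rw [h] at hl; exact hl.symm

/-- With m + 1 keys two remain below the root. They occupy one node if they fall into the same
subtree and two otherwise, so the number of nodes is not constant. -/
theorem permCov_sizeFun_pos_base (hm : 3 ≤ m) :
    0 < permCov (m + 1) (sizeFun m) (sizeFun m) := by
  classical
  have hm2 : 2 ≤ m := by omega
  have hmn : m - 1 ≤ m + 1 := by omega
  refine lt_of_lt_of_le ?_ (tollCov_le_permCov_sizeFun hm2 hmn)
  set s : ℕ → ℝ := fun j => permAvg j (sizeFun m) with hs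
  have s0 : s 0 = 0 := by
    simp only [hs]
    rw [permAvg_sizeFun_short (by omega), if_pos rfl]
  have s1 : s 1 = 1 := permAvg_sizeFun_of_lt one_ne_zero (by omega)
  have s2 : s 2 = 1 := permAvg_sizeFun_of_lt two_ne_zero (by omega)
  have hch : (0 : ℝ) < (m + 1).choose (m - 1) := by exact_mod_cast Nat.choose_pos hmn
  let i0 : Fin m := ⟨0, by omega⟩
  let i1 : Fin m := ⟨1, by omega⟩
  have h01 : i0 ≠ i1 := by simp [i0, i1]
  have hsub : m + 1 - (m - 1) = 2 := by omega
  set c1 : Fin m → ℕ := Pi.single i0 2 with hc1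
  set c2 : Fin m → ℕ := Pi.single i0 1 + Pi.single i1 1 with hc2
  have m1 : c1 ∈ Finset.piAntidiag (Finset.univ : Finset (Fin m)) (m + 1 - (m - 1)) := by
    rw [Finset.mem_piAntidiag, hsub]
    exact ⟨by simp [hc1], fun i _ => Finset.mem_univ i⟩
  have m2 : c2 ∈ Finset.piAntidiag (Finset.univ : Finset (Fin m)) (m + 1 - (m - 1)) := by
    rw [Finset.mem_piAntidiag, hsub]
    exact ⟨by simp [hc2, Finset.sum_add_distrib], fun i _ => Finset.mem_univ i⟩
  have f1 : ∑ i, s (c1 i) = 1 := by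
    rw [Finset.sum_eq_single i0 (fun b _ hb => by simp [hc1, Pi.single_eq_of_ne hb, s0])
      (fun h => absurd (Finset.mem_univ _) h)]
    simp [hc1, s2]
  have f2 : ∑ i, s (c2 i) = 2 := by
    have e : ∀ i, s (c2 i) = (if i = i0 then 1 else 0) + (if i = i1 then 1 else 0) := by
      intro i
      by_cases h0 : i = i0
      · subst h0
        simp [hc2, s1, h01]
      · by_cases h1 : i = i1
        · subst h1
          simp [hc2, s1, h0]
        · simp [hc2, s0, h0, h1]
    rw [Finset.sum_congr rfl fun i _ => e i, Finset.sum_add_distrib]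
    simp
    norm_num
  rw [tollCov_self_eq hm2 hmn]
  set μ := compMean m (m + 1) s with hμ
  have b1 := le_compAvg_of_mem (F := fun c => (∑ i, s (c i) - μ) ^ 2) (fun c => sq_nonneg _) m1
  have b2 := le_compAvg_of_mem (F := fun c => (∑ i, s (c i) - μ) ^ 2) (fun c => sq_nonneg _) m2
  rw [f1] at b1
  rw [f2] at b2
  by_contra hneg
  push Not at hneg
  have z1 : (1 - μ) ^ 2 ≤ 0 := by
    have := (div_le_iff₀ hch).1 (b1.trans hneg); linarith
  have z2 : (2 - μ) ^ 2 ≤ 0 := by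
    have := (div_le_iff₀ hch).1 (b2.trans hneg); linarith
  nlinarith [sq_nonneg (1 - μ), sq_nonneg (2 - μ)]

theorem compMean_permCov_sizeFun_le (hm : 2 ≤ m) {n : ℕ} (hn : m - 1 ≤ n) :
    compMean m n (fun j => permCov j (sizeFun m) (sizeFun m)) ≤
      permCov n (sizeFun m) (sizeFun m) := by
  rw [permCov_sizeFun_rec hm hn]
  have := tollCov_self_nonneg hm hn (fun j => permAvg j (sizeFun m))
  linarith

/-- With positive probability one subtree has m + 1 keys, and its variance passes to the whole tree;
this needs n ≥ (m - 1) + (m + 1). -/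
theorem permCov_sizeFun_pos (hm : 3 ≤ m) {n : ℕ} (hn : 2 * m ≤ n) :
    0 < permCov n (sizeFun m) (sizeFun m) := by
  classical
  have hm2 : 2 ≤ m := by omega
  have hmn : m - 1 ≤ n := by omega
  refine lt_of_lt_of_le ?_ (compMean_permCov_sizeFun_le hm2 hmn)
  have hch : (0 : ℝ) < n.choose (m - 1) := by exact_mod_cast Nat.choose_pos hmn
  let i0 : Fin m := ⟨0, by omega⟩
  let i1 : Fin m := ⟨1, by omega⟩
  have h01 : i0 ≠ i1 := by simp [i0, i1]
  set c : Fin m → ℕ := Pi.single i0 (m + 1) + Pi.single i1 (n - (m - 1) - (m + 1)) with hc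
  have hmem : c ∈ Finset.piAntidiag (Finset.univ : Finset (Fin m)) (n - (m - 1)) := by
    rw [Finset.mem_piAntidiag]
    refine ⟨?_, fun i _ => Finset.mem_univ i⟩
    simp only [hc, Pi.add_apply, Finset.sum_add_distrib, Finset.sum_pi_single', Finset.mem_univ,
      if_true]
    omega
  have hc0 : c i0 = m + 1 := by simp [hc, Pi.single_eq_of_ne h01]
  refine lt_of_lt_of_le ?_ (le_compAvg_of_mem
    (F := fun c => ∑ i, permCov (c i) (sizeFun m) (sizeFun m))
    (fun c => Finset.sum_nonneg fun i _ => permCov_self_nonneg _ _) hmem)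
  refine div_pos (lt_of_lt_of_le (permCov_sizeFun_pos_base hm) ?_) hch
  have h1 := Finset.single_le_sum (f := fun i => permCov (c i) (sizeFun m) (sizeFun m))
    (fun i _ => permCov_self_nonneg _ _) (Finset.mem_univ i0)
  rwa [hc0] at h1

/-- The variance of the number of nodes grows at least linearly. -/
theorem exists_permCov_sizeFun_lower (hm : 3 ≤ m) :
    ∃ c > 0, ∀ᶠ n : ℕ in atTop, c * n ≤ permCov n (sizeFun m) (sizeFun m) :=
  exists_linear_lower (by omega) (fun n => permCov_self_nonneg n _)
    (fun _ hn => compMean_permCov_sizeFun_le (by omega) hn) fun _ hn => permCov_sizeFun_pos hm hn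

end LinearLowerBound

/-! ### The variance of N - φK. -/

section Gap

variable {m : ℕ}

theorem permCov_comm (n : ℕ) (f g : List ℕ → ℝ) : permCov n f g = permCov n g f := by
  unfold permCov
  simp only [mul_comm]

theorem permCov_add_left (n : ℕ) (f g h : List ℕ → ℝ) :
    permCov n (fun l => f l + g l) h = permCov n f h + permCov n g h := by
  simp only [permCov, add_mul, permAvg_add]
  ring

theorem permCov_const_mul_left (n : ℕ) (a : ℝ) (f g : List ℕ → ℝ) :
    permCov n (fun l => a * f l) g = a * permCov n f g := by
  simp only [permCov, mul_assoc, permAvg_const_mul]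
  ring

theorem permCov_combo (n : ℕ) (a b : ℝ) (f g : List ℕ → ℝ) :
    permCov n (fun l => a * f l + b * g l) (fun l => a * f l + b * g l) =
      a ^ 2 * permCov n f f + 2 * a * b * permCov n f g + b ^ 2 * permCov n g g := by
  have h : ∀ h', permCov n (fun l => a * f l + b * g l) h' =
      a * permCov n f h' + b * permCov n g h' := fun h' => by
    rw [permCov_add_left, permCov_const_mul_left, permCov_const_mul_left]
  rw [h, permCov_comm n f, permCov_comm n g, h, h, permCov_comm n g f]
  ring

theorem permCov_sq_le (n : ℕ) (f g : List ℕ → ℝ) :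
    permCov n f g ^ 2 ≤ permCov n f f * permCov n g g := by
  have h : ∀ t : ℝ, 0 ≤ permCov n g g * (t * t) + 2 * permCov n f g * t + permCov n f f := by
    intro t
    have h1 := permCov_self_nonneg n (fun l => 1 * f l + t * g l)
    rw [permCov_combo] at h1
    linarith
  have := discrim_le_zero h
  unfold discrim at this
  nlinarith

theorem permCov_gapPart (n : ℕ) : permCov n (gapPart m) (gapPart m) =
    permCov n (fun l => 1 * gapFun m l + 1 * sizeFun m l)
      (fun l => 1 * gapFun m l + 1 * sizeFun m l) := by
  set Q : List ℕ → ℝ := fun l => 1 * gapFun m l + 1 * sizeFun m l with hQ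
  have h1 : ∀ σ : Equiv.Perm (Fin n), gapPart m (valueList σ) = Q (valueList σ) - occ m * n := by
    intro σ
    simp only [gapPart, hQ, valueList_length]
    ring
  have h2 : permAvg n (gapPart m) = permAvg n Q - occ m * n := by
    rw [permAvg_congr (g := fun l => Q l - occ m * n) h1, permAvg_sub, permAvg_const]
  have h3 : permAvg n (fun l => gapPart m l * gapPart m l) =
      permAvg n (fun l => Q l * Q l) - 2 * (occ m * n) * permAvg n Q + (occ m * n) ^ 2 := by
    rw [permAvg_congr (g := fun l => (Q l * Q l - 2 * (occ m * n) * Q l) + (occ m * n) ^ 2)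
      (fun σ => by rw [h1]; ring), permAvg_add, permAvg_sub, permAvg_const_mul, permAvg_const]
  unfold permCov
  rw [h2, h3]
  ring

/-- The covariance is split by the nonnegative variance of ε · gap - size, so the coefficient of the
gap variance stays arbitrarily close to 1. -/
theorem permCov_gapPart_le (n : ℕ) {ε : ℝ} (hε : 0 < ε) :
    permCov n (gapPart m) (gapPart m) ≤ (1 + ε) * permCov n (gapFun m) (gapFun m) +
      (1 + 1 / ε) * permCov n (sizeFun m) (sizeFun m) := by
  rw [permCov_gapPart, permCov_combo]
  have h1 := permCov_self_nonneg n (fun l => ε * gapFun m l + (-1) * sizeFun m l)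
  rw [permCov_combo] at h1
  have h2 : 2 * permCov n (gapFun m) (sizeFun m) ≤ ε * permCov n (gapFun m) (gapFun m) +
      1 / ε * permCov n (sizeFun m) (sizeFun m) := by
    have h3 : 0 ≤ (ε ^ 2 * permCov n (gapFun m) (gapFun m) +
        2 * ε * -1 * permCov n (gapFun m) (sizeFun m) +
        (-1) ^ 2 * permCov n (sizeFun m) (sizeFun m)) / ε := div_nonneg h1 hε.le
    have h4 : (ε ^ 2 * permCov n (gapFun m) (gapFun m) +
        2 * ε * -1 * permCov n (gapFun m) (sizeFun m) +
        (-1) ^ 2 * permCov n (sizeFun m) (sizeFun m)) / ε = ε * permCov n (gapFun m) (gapFun m) +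
      1 / ε * permCov n (sizeFun m) (sizeFun m) - 2 * permCov n (gapFun m) (sizeFun m) := by
      field_simp
      ring
    linarith
  linarith

theorem permCov_gapFun_rec (hm : 2 ≤ m) {n : ℕ} (hn : m - 1 ≤ n) :
    permCov n (gapFun m) (gapFun m) = compMean m n (fun j => permCov j (gapPart m) (gapPart m)) +
      tollCov m n (fun j => permAvg j (gapPart m)) (fun j => permAvg j (gapPart m)) :=
  permCov_rec hm hn _ _ _ _ (orderInv_gapPart hm) (orderInv_gapPart hm) 0 0
    (fun σ => gapFun_rec hm _ (by rwa [valueList_length]) (valueList_nodup σ))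
    (fun σ => gapFun_rec hm _ (by rwa [valueList_length]) (valueList_nodup σ))

theorem isLittleO_ofReal {x : ℕ → ℝ} {g : ℕ → ℝ} (h : x =o[atTop] g) :
    (fun n => (x n : ℂ)) =o[atTop] g :=
  IsLittleO.of_norm_left (h.norm_left.congr_left fun n => by rw [Complex.norm_real])

theorem isLittleO_of_ofReal {x : ℕ → ℝ} {g : ℕ → ℝ} (h : (fun n => (x n : ℂ)) =o[atTop] g) :
    x =o[atTop] g :=
  IsLittleO.of_norm_left (h.norm_left.congr_left fun n => by rw [Complex.norm_real])

theorem isLittleO_permCov_sizeFun (hm : 3 ≤ m) :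
    (fun n => permCov n (sizeFun m) (sizeFun m)) =o[atTop] fun n : ℕ => (n : ℝ) ^ (2 : ℝ) := by
  rw [isLittleO_iff_tendsto' (by
    filter_upwards [eventually_gt_atTop 0] with n hn h0
    exact absurd h0 (Real.rpow_pos_of_pos (by exact_mod_cast hn) _).ne')]
  exact tendsto_permCov_sizeFun_div_sq hm

/-- The node path length deviates little from a multiple of the key path length. -/
theorem isLittleO_permCov_gapFun (hm : 3 ≤ m) :
    (fun n => permCov n (gapFun m) (gapFun m)) =o[atTop] fun n : ℕ => (n : ℝ) ^ (2 : ℝ) := by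
  have hm2 : 2 ≤ m := by omega
  have hf : (0 : ℝ) < m.factorial := by positivity
  have hP : (0 : ℝ) < risingReal m (5 / 2) := risingReal_pos m (by norm_num)
  -- With this κ > 1 the factor κ exactly cancels the eigenvalue at 5/2, while at 3, the parameter
  -- of n², there is still contraction. This leaves room for 1 + ε.
  set κ := risingReal m (5 / 2) / m.factorial with hκ
  have hκ1 : 1 < κ := by
    rw [hκ, one_lt_div hf, ← risingReal_two hm2]
    exact risingReal_lt hm2 (by norm_num) (by norm_num)
  set ε := κ - 1 with hε
  have hε0 : 0 < ε := by linarith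
  obtain ⟨e, a, b, he, heq⟩ := exists_permAvg_gapFun hm
  have hT : (fun n => tollCov m n (fun j => permAvg j (gapPart m))
      (fun j => permAvg j (gapPart m))) =o[atTop] fun n : ℕ => (n : ℝ) ^ (2 : ℝ) := by
    have he2 := he.add (isLittleO_sum_roots hm2 (coeffA m))
    have h := isLittleO_tollCov hm2 one_pos one_pos he2 he2.isBigO
    rw [show (1 : ℝ) + 1 = 2 by norm_num] at h
    refine isLittleO_of_ofReal (h.congr' ?_ EventuallyEq.rfl)
    have hx : ∀ n, (permAvg n (gapPart m) : ℂ) =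
        (e n + ∑ z ∈ (indicialRoots m).erase 2, coeffA m z * qseq z n) +
          (a * n + (b + ((occ m : ℂ) - 1 / ((m : ℂ) - 1)))) := by
      intro n
      rw [permAvg_gapPart]
      push_cast
      rw [heq, permAvg_sizeFun_split hm]
      ring
    filter_upwards [eventually_ge_atTop (m - 1)] with n hn
    exact (tollCov_permAvg_eq hm2 hn hx hx).symm
  have hS : (fun n => compMean m n (fun j => permCov j (sizeFun m) (sizeFun m))) =o[atTop]
      fun n : ℕ => (n : ℝ) ^ (2 : ℝ) := by
    have h := isLittleO_compMean hm2 two_pos (isLittleO_ofReal (isLittleO_permCov_sizeFun hm))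
    refine isLittleO_of_ofReal (h.congr_left fun n => ?_)
    rw [compMean_ofReal]
  refine isLittleO_of_compMean_le hm2 (κ := κ) (w' := 3 / 2) (b := fun n =>
    (1 + 1 / ε) * compMean m n (fun j => permCov j (sizeFun m) (sizeFun m)) +
      tollCov m n (fun j => permAvg j (gapPart m)) (fun j => permAvg j (gapPart m)))
    (by linarith) (by norm_num) (by norm_num) ?_ ?_ ((hS.const_mul_left _).add hT)
  · rw [show (3 / 2 : ℝ) + 1 = 5 / 2 by norm_num, hκ]
    apply le_of_eq
    field_simp
  · intro n hn
    have h1 := compMean_mono hm2 hn (fun j _ => permCov_gapPart_le (m := m) j hε0)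
    have h2 : compMean m n (fun j => (1 + ε) * permCov j (gapFun m) (gapFun m) +
        (1 + 1 / ε) * permCov j (sizeFun m) (sizeFun m)) =
        κ * compMean m n (fun j => permCov j (gapFun m) (gapFun m)) +
        (1 + 1 / ε) * compMean m n (fun j => permCov j (sizeFun m) (sizeFun m)) := by
      simp only [compMean, Finset.sum_add_distrib, ← Finset.mul_sum, compAvg_add,
        compAvg_const_mul]
      rw [hε]; ring
    simp only [abs_of_nonneg (permCov_self_nonneg _ _)]
    rw [permCov_gapFun_rec hm2 hn]
    linarith

end Gap

/-! ### Passage to correlation coefficients. -/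

section Correlation

variable {m : ℕ}

theorem tendsto_div_sub_div {a b F G : ℕ → ℝ} {B g : ℝ} (hg : 0 < g) (hF : ∀ n, |F n| ≤ B)
    (hG : ∀ n, g ≤ G n) (ha : Tendsto (fun n => a n - F n) atTop (𝓝 0))
    (hb : Tendsto (fun n => b n - G n) atTop (𝓝 0)) :
    Tendsto (fun n => a n / b n - F n / G n) atTop (𝓝 0) := by
  have hlim : Tendsto (fun n => |a n - F n| * (2 / g) + B * |b n - G n| * (2 / g ^ 2)) atTop
      (𝓝 0) := by
    have := (ha.abs.mul_const (2 / g)).add ((hb.abs.const_mul B).mul_const (2 / g ^ 2))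
    simpa using this
  refine squeeze_zero_norm' ?_ hlim
  have hev := hb.abs.eventually (gt_mem_nhds (show |(0 : ℝ)| < g / 2 by rw [abs_zero]; linarith))
  filter_upwards [hev] with n hn
  have hGn := hG n
  have hbn : g / 2 < b n := by
    have := neg_abs_le (b n - G n)
    linarith
  have hb0 : 0 < b n := by linarith
  have hG0 : 0 < G n := by linarith
  have hB : 0 ≤ B := (abs_nonneg _).trans (hF n)
  have e : a n / b n - F n / G n =
      (a n - F n) * (1 / b n) - F n * (b n - G n) * (1 / (b n * G n)) := by
    field_simp
    ring
  have h1 : 1 / b n ≤ 2 / g := by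
    rw [div_le_div_iff₀ hb0 hg]; linarith
  have h2 : 1 / (b n * G n) ≤ 2 / g ^ 2 := by
    rw [div_le_div_iff₀ (by positivity) (by positivity)]
    nlinarith
  rw [e, Real.norm_eq_abs]
  refine (abs_sub _ _).trans (add_le_add ?_ ?_)
  · rw [abs_mul, abs_of_pos (one_div_pos.2 hb0)]
    exact mul_le_mul_of_nonneg_left h1 (abs_nonneg _)
  · rw [abs_mul, abs_mul, abs_of_pos (one_div_pos.2 (mul_pos hb0 hG0))]
    exact mul_le_mul (mul_le_mul_of_nonneg_right (hF n) (abs_nonneg _)) h2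
      (by positivity) (by positivity)

/-- Uses |√x - √y| ≤ √|x - y|, so no lower bound on `y` is needed. -/
theorem tendsto_sqrt_sub_sqrt {x y : ℕ → ℝ} (hy : ∀ n, 0 ≤ y n)
    (h : Tendsto (fun n => x n - y n) atTop (𝓝 0)) :
    Tendsto (fun n => √(x n) - √(y n)) atTop (𝓝 0) := by
  have h1 : Tendsto (fun n => √|x n - y n|) atTop (𝓝 0) := by
    have := (Real.continuous_sqrt.tendsto _).comp h.abs
    rw [abs_zero, Real.sqrt_zero] at this
    exact this
  refine squeeze_zero_norm (fun n => ?_) h1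
  rw [Real.norm_eq_abs]
  refine abs_le.2 ⟨?_, ?_⟩
  · have h2 : y n ≤ (√(x n) + √|x n - y n|) ^ 2 := by
      have h3 := Real.sq_sqrt (abs_nonneg (x n - y n))
      have h4 := neg_abs_le (x n - y n)
      have h5 := mul_nonneg (Real.sqrt_nonneg (x n)) (Real.sqrt_nonneg |x n - y n|)
      rcases le_total 0 (x n) with hx | hx
      · have := Real.sq_sqrt hx
        nlinarith
      · rw [Real.sqrt_eq_zero_of_nonpos hx, zero_add, h3]
        have := hy n
        linarith
    have := Real.sqrt_le_sqrt h2
    rw [Real.sqrt_sq (by positivity)] at this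
    linarith
  · have h2 : x n ≤ (√(y n) + √|x n - y n|) ^ 2 := by
      have h3 := Real.sq_sqrt (abs_nonneg (x n - y n))
      have h4 := le_abs_self (x n - y n)
      have h5 := mul_nonneg (Real.sqrt_nonneg (y n)) (Real.sqrt_nonneg |x n - y n|)
      have := Real.sq_sqrt (hy n)
      nlinarith
    have := Real.sqrt_le_sqrt h2
    rw [Real.sqrt_sq (by positivity)] at this
    linarith

/-- The correlation coefficient of two list functionals of a uniform permutation. -/
noncomputable def permCorr (n : ℕ) (f g : List ℕ → ℝ) : ℝ :=
  permCov n f g / (√(permCov n f f) * √(permCov n g g))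

theorem abs_permCov_le (n : ℕ) (f g : List ℕ → ℝ) :
    |permCov n f g| ≤ √(permCov n f f) * √(permCov n g g) := by
  rw [← Real.sqrt_mul (permCov_self_nonneg n f), ← Real.sqrt_sq_eq_abs]
  exact Real.sqrt_le_sqrt (permCov_sq_le n f g)

theorem nodeFun_eq (m : ℕ) :
    nodeFun m = fun l => occ m * keyFun m l + 1 * gapFun m l := by
  funext l
  unfold gapFun
  ring

theorem tendsto_permCov_gapFun (hm : 3 ≤ m) :
    Tendsto (fun n : ℕ => permCov n (gapFun m) (gapFun m) / (n : ℝ) ^ (2 : ℝ)) atTop (𝓝 0) :=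
  (isLittleO_permCov_gapFun hm).tendsto_div_nhds_zero

/-- N = φK + gap, and by Cauchy–Schwarz the mixed covariance is o(n²) along with the gap variance.
-/
theorem tendsto_permCov_nodeFun (hm : 3 ≤ m) :
    Tendsto (fun n : ℕ => permCov n (nodeFun m) (nodeFun m) / (n : ℝ) ^ (2 : ℝ)) atTop
      (𝓝 (occ m ^ 2 * constK m)) := by
  have hK := tendsto_permCov_keyFun hm
  have hW := tendsto_permCov_gapFun hm
  have hKW : Tendsto (fun n : ℕ => permCov n (keyFun m) (gapFun m) / (n : ℝ) ^ (2 : ℝ)) atTop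
      (𝓝 0) := by
    have h1 := (Real.continuous_sqrt.tendsto _).comp (hK.mul hW)
    rw [mul_zero, Real.sqrt_zero] at h1
    refine squeeze_zero_norm (fun n => ?_) h1
    simp only [Function.comp]
    have hp : 0 ≤ (n : ℝ) ^ (2 : ℝ) := by positivity
    rw [norm_div, Real.norm_eq_abs, Real.norm_of_nonneg hp, div_mul_div_comm,
      Real.sqrt_div (mul_nonneg (permCov_self_nonneg _ _) (permCov_self_nonneg _ _)),
      Real.sqrt_mul_self hp, Real.sqrt_mul (permCov_self_nonneg _ _)]
    exact div_le_div_of_nonneg_right (abs_permCov_le _ _ _) hp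
  have h := ((hK.const_mul (occ m ^ 2)).add (hKW.const_mul (2 * occ m))).add hW
  rw [mul_zero, add_zero, add_zero] at h
  refine h.congr fun n => ?_
  rw [nodeFun_eq, permCov_combo]
  ring

theorem eventually_permCov_keyFun_pos (hm : 3 ≤ m) :
    ∀ᶠ n : ℕ in atTop, 0 < permCov n (keyFun m) (keyFun m) := by
  filter_upwards [(tendsto_permCov_keyFun hm).eventually (lt_mem_nhds (constK_pos hm))] with n hn
  exact (div_pos_iff_of_pos_right (by
    by_contra h
    have h0 : (n : ℝ) ^ (2 : ℝ) = 0 := le_antisymm (not_lt.1 h) (by positivity)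
    rw [h0, div_zero] at hn
    exact lt_irrefl _ hn)).1 hn

theorem eventually_permCov_nodeFun_pos (hm : 3 ≤ m) :
    ∀ᶠ n : ℕ in atTop, 0 < permCov n (nodeFun m) (nodeFun m) := by
  have h0 : 0 < occ m ^ 2 * constK m :=
    mul_pos (pow_pos (occ_pos (by omega)) 2) (constK_pos hm)
  filter_upwards [(tendsto_permCov_nodeFun hm).eventually (lt_mem_nhds h0)] with n hn
  exact (div_pos_iff_of_pos_right (by
    by_contra h
    have h0 : (n : ℝ) ^ (2 : ℝ) = 0 := le_antisymm (not_lt.1 h) (by positivity)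
    rw [h0, div_zero] at hn
    exact lt_irrefl _ hn)).1 hn

theorem eventually_permCov_sizeFun_pos (hm : 3 ≤ m) :
    ∀ᶠ n : ℕ in atTop, 0 < permCov n (sizeFun m) (sizeFun m) := by
  filter_upwards [eventually_ge_atTop (2 * m)] with n hn
  exact permCov_sizeFun_pos hm hn

/-- Replacing the node path length by the key path length hardly changes the correlation with the
number of nodes. -/
theorem tendsto_permCorr_sub (hm : 3 ≤ m) :
    Tendsto (fun n => permCorr n (sizeFun m) (nodeFun m) - permCorr n (sizeFun m) (keyFun m))
      atTop (𝓝 0) := by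
  have hφ := occ_pos (m := m) (by omega)
  have hCK := constK_pos hm
  have hK := tendsto_permCov_keyFun hm
  have hN := tendsto_permCov_nodeFun hm
  have hW := tendsto_permCov_gapFun hm
  have hN0 : occ m ^ 2 * constK m ≠ 0 := (mul_pos (pow_pos hφ 2) hCK).ne'
  have r1 : Tendsto (fun n => √(permCov n (keyFun m) (keyFun m) /
      permCov n (nodeFun m) (nodeFun m))) atTop (𝓝 (1 / occ m)) := by
    have h1 := (Real.continuous_sqrt.tendsto _).comp (hK.div hN hN0)
    have e : constK m / (occ m ^ 2 * constK m) = (1 / occ m) ^ 2 := by field_simp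
    rw [e, Real.sqrt_sq (by positivity)] at h1
    refine h1.congr' ?_
    filter_upwards [eventually_gt_atTop 0] with n hn
    have : (n : ℝ) ^ (2 : ℝ) ≠ 0 := by positivity
    simp only [Function.comp, Pi.div_apply]
    rw [div_div_div_cancel_right₀ this]
  have r2 : Tendsto (fun n => √(permCov n (gapFun m) (gapFun m) /
      permCov n (nodeFun m) (nodeFun m))) atTop (𝓝 0) := by
    have h1 := (Real.continuous_sqrt.tendsto _).comp (hW.div hN hN0)
    rw [zero_div, Real.sqrt_zero] at h1
    refine h1.congr' ?_
    filter_upwards [eventually_gt_atTop 0] with n hn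
    have : (n : ℝ) ^ (2 : ℝ) ≠ 0 := by positivity
    simp only [Function.comp, Pi.div_apply]
    rw [div_div_div_cancel_right₀ this]
  have hlim : Tendsto (fun n => |occ m * √(permCov n (keyFun m) (keyFun m) /
      permCov n (nodeFun m) (nodeFun m)) - 1| + √(permCov n (gapFun m) (gapFun m) /
      permCov n (nodeFun m) (nodeFun m))) atTop (𝓝 0) := by
    have h := (((r1.const_mul (occ m)).sub_const 1).abs).add r2
    rw [mul_one_div_cancel hφ.ne', sub_self, abs_zero, add_zero] at h
    exact h
  refine squeeze_zero_norm' ?_ hlim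
  filter_upwards [eventually_permCov_keyFun_pos hm, eventually_permCov_nodeFun_pos hm,
    eventually_permCov_sizeFun_pos hm] with n hk hn hs
  have hcov : permCov n (sizeFun m) (nodeFun m) = occ m * permCov n (sizeFun m) (keyFun m) +
      permCov n (sizeFun m) (gapFun m) := by
    rw [permCov_comm, nodeFun_eq, permCov_add_left, permCov_const_mul_left,
      permCov_const_mul_left, permCov_comm n (keyFun m), permCov_comm n (gapFun m), one_mul]
  have a1 := abs_permCov_le n (sizeFun m) (keyFun m)
  have a2 := abs_permCov_le n (sizeFun m) (gapFun m)
  rw [Real.sqrt_div hk.le, Real.sqrt_div (permCov_self_nonneg _ _)]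
  unfold permCorr
  rw [hcov]
  have sk := Real.sqrt_pos.2 hk
  have sn := Real.sqrt_pos.2 hn
  have ss := Real.sqrt_pos.2 hs
  set k := √(permCov n (keyFun m) (keyFun m))
  set v := √(permCov n (nodeFun m) (nodeFun m))
  set s := √(permCov n (sizeFun m) (sizeFun m))
  set w := √(permCov n (gapFun m) (gapFun m))
  set x := permCov n (sizeFun m) (keyFun m)
  set y := permCov n (sizeFun m) (gapFun m)
  -- The first summand is a correlation, bounded by 1, times a factor tending to 0; the second is at
  -- most w/v by Cauchy–Schwarz.
  have e : (occ m * x + y) / (s * v) - x / (s * k) =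
      x / (s * k) * (occ m * (k / v) - 1) + y / (s * v) := by
    field_simp
    ring
  rw [e, Real.norm_eq_abs]
  refine (abs_add_le _ _).trans (add_le_add ?_ ?_)
  · rw [abs_mul]
    refine mul_le_of_le_one_left (abs_nonneg _) ?_
    rw [abs_div, abs_of_pos (mul_pos ss sk)]
    exact (div_le_one (mul_pos ss sk)).2 a1
  · rw [abs_div, abs_of_pos (mul_pos ss sn), div_le_div_iff₀ (mul_pos ss sn) sn]
    have := mul_le_mul_of_nonneg_right a2 sn.le
    linarith

/-- The covariance is o(n^(3/2)), while the standard deviations are at least of order n^(1/2) for S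
and n for K. -/
theorem tendsto_permCorr_small (hm : 3 ≤ m) (hm' : m ≤ 26) :
    Tendsto (fun n => permCorr n (sizeFun m) (keyFun m)) atTop (𝓝 0) := by
  have hCK := constK_pos hm
  have hK := tendsto_permCov_keyFun hm
  have hSK := tendsto_permCov_sizeFun_keyFun_small hm hm'
  obtain ⟨c, hc, hcn⟩ := exists_permCov_sizeFun_lower hm
  have hlim : Tendsto (fun n : ℕ => |permCov n (sizeFun m) (keyFun m) / (n : ℝ) ^ (3 / 2 : ℝ)| /
      (√c * √(permCov n (keyFun m) (keyFun m) / (n : ℝ) ^ (2 : ℝ)))) atTop (𝓝 0) := by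
    have h := hSK.abs.div (((Real.continuous_sqrt.tendsto _).comp hK).const_mul √c)
      (mul_pos (Real.sqrt_pos.2 hc) (Real.sqrt_pos.2 hCK)).ne'
    rw [abs_zero, zero_div] at h
    exact h
  refine squeeze_zero_norm' ?_ hlim
  filter_upwards [eventually_permCov_keyFun_pos hm, eventually_permCov_sizeFun_pos hm, hcn,
    eventually_gt_atTop 0] with n hk hs hcs hn
  have hn0 : (0 : ℝ) < n := by exact_mod_cast hn
  have sk := Real.sqrt_pos.2 hk
  have ss := Real.sqrt_pos.2 hs
  have h1 : √(c * n) ≤ √(permCov n (sizeFun m) (sizeFun m)) := Real.sqrt_le_sqrt hcs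
  rw [Real.sqrt_mul hc.le] at h1
  have e1 : √((n : ℝ) ^ (2 : ℝ)) = n := by
    rw [Real.rpow_two, Real.sqrt_sq hn0.le]
  have e2 : (n : ℝ) ^ (3 / 2 : ℝ) = √n * n := by
    rw [Real.sqrt_eq_rpow, ← Real.rpow_add_one hn0.ne']
    norm_num
  have sn : 0 < √(n : ℝ) := Real.sqrt_pos.2 hn0
  have sc : 0 < √c := Real.sqrt_pos.2 hc
  unfold permCorr
  rw [Real.norm_eq_abs, abs_div, abs_of_pos (mul_pos ss sk), abs_div,
    abs_of_pos (show 0 < (n : ℝ) ^ (3 / 2 : ℝ) by positivity), Real.sqrt_div hk.le, e1, e2]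
  have e3 : |permCov n (sizeFun m) (keyFun m)| / (√n * n) /
      (√c * (√(permCov n (keyFun m) (keyFun m)) / n)) = |permCov n (sizeFun m) (keyFun m)| /
      ((√c * √n) * √(permCov n (keyFun m) (keyFun m))) := by
    field_simp
  rw [e3]
  exact div_le_div_of_nonneg_left (abs_nonneg _) (by positivity)
    (mul_le_mul_of_nonneg_right h1 sk.le)

theorem continuous_F2 (m : ℕ) (lam : ℂ) : Continuous (F2 m lam) := by
  unfold F2
  fun_prop

theorem periodic_F2 (m : ℕ) (lam : ℂ) : Function.Periodic (F2 m lam) (2 * Real.pi) := by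
  intro z
  unfold F2
  have : Complex.exp (Complex.I * ((z + 2 * Real.pi : ℝ) : ℂ)) = Complex.exp (Complex.I * z) := by
    push_cast
    rw [mul_add, show Complex.I * (2 * (Real.pi : ℂ)) = 2 * Real.pi * Complex.I by ring,
      Complex.exp_add, Complex.exp_two_pi_mul_I, mul_one]
  rw [this]

theorem exists_bound_of_periodic {f : ℝ → ℝ} (hf : Continuous f)
    (hp : Function.Periodic f (2 * Real.pi)) : ∃ B, ∀ z, |f z| ≤ B := by
  obtain ⟨x, -, hx⟩ := (isCompact_Icc (a := (0 : ℝ)) (b := 2 * Real.pi)).exists_isMaxOn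
    (Set.nonempty_Icc.2 Real.two_pi_pos.le) (hf.abs.continuousOn)
  refine ⟨|f x|, fun z => ?_⟩
  obtain ⟨y, hy, hyz⟩ := hp.exists_mem_Ico₀ Real.two_pi_pos z
  rw [hyz]
  exact hx (Set.Ico_subset_Icc_self hy)

theorem exists_lower_of_periodic {f : ℝ → ℝ} (hf : Continuous f)
    (hp : Function.Periodic f (2 * Real.pi)) (h0 : ∀ z, 0 < f z) : ∃ c > 0, ∀ z, c ≤ f z := by
  obtain ⟨x, -, hx⟩ := (isCompact_Icc (a := (0 : ℝ)) (b := 2 * Real.pi)).exists_isMinOn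
    (Set.nonempty_Icc.2 Real.two_pi_pos.le) (hf.continuousOn)
  refine ⟨f x, h0 x, fun z => ?_⟩
  obtain ⟨y, hy, hyz⟩ := hp.exists_mem_Ico₀ Real.two_pi_pos z
  rw [hyz]
  exact hx (Set.Ico_subset_Icc_self hy)

/-- F₁ is continuous, periodic and positive, hence bounded away from 0; this permits dividing the
asymptotic relations. The powers cancel because 2 + (2α - 2) = 2α. -/
theorem tendsto_permCorr_large (hm : 27 ≤ m) {lam : ℂ} (hlam : IsSecondZero m lam) :
    Tendsto (fun n : ℕ => permCorr n (sizeFun m) (keyFun m) - F2 m lam (lam.im * Real.log n) /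
      √(constK m * F1 m lam (lam.im * Real.log n))) atTop (𝓝 0) := by
  have hm3 : 3 ≤ m := by omega
  have hCK := constK_pos hm3
  have hK := tendsto_permCov_keyFun hm3
  have hS := tendsto_permCov_sizeFun hm hlam
  have hSK := tendsto_permCov_sizeFun_keyFun hm hlam
  obtain ⟨B1, hB1⟩ := exists_bound_of_periodic (continuous_F1 m lam) (periodic_F1 m lam)
  obtain ⟨B2, hB2⟩ := exists_bound_of_periodic (continuous_F2 m lam) (periodic_F2 m lam)
  obtain ⟨c, hc, hc1⟩ := exists_lower_of_periodic (continuous_F1 m lam) (periodic_F1 m lam)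
    (F1_pos hm hlam)
  have h1 : Tendsto (fun n : ℕ => permCov n (keyFun m) (keyFun m) / (n : ℝ) ^ (2 : ℝ) *
      (permCov n (sizeFun m) (sizeFun m) / (n : ℝ) ^ (2 * lam.re - 2)) -
      constK m * F1 m lam (lam.im * Real.log n)) atTop (𝓝 0) := by
    have h2 : Tendsto (fun n : ℕ => (permCov n (keyFun m) (keyFun m) / (n : ℝ) ^ (2 : ℝ) -
        constK m) * F1 m lam (lam.im * Real.log n)) atTop (𝓝 0) := by
      have h3 := (hK.sub_const (constK m)).abs.mul_const B1
      rw [sub_self, abs_zero, zero_mul] at h3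
      refine squeeze_zero_norm (fun n => ?_) h3
      rw [norm_mul]
      exact mul_le_mul_of_nonneg_left (hB1 _) (norm_nonneg _)
    have h4 := (hK.mul hS).add h2
    rw [mul_zero, add_zero] at h4
    refine h4.congr fun n => ?_
    ring
  have h5 := tendsto_sqrt_sub_sqrt (fun n => (mul_pos hCK (F1_pos hm hlam _)).le) h1
  have h6 := tendsto_div_sub_div (g := √(constK m * c)) (Real.sqrt_pos.2 (mul_pos hCK hc))
    (fun n : ℕ => hB2 (lam.im * Real.log n))
    (fun n : ℕ => Real.sqrt_le_sqrt (mul_le_mul_of_nonneg_left (hc1 (lam.im * Real.log n)) hCK.le))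
    hSK h5
  refine h6.congr' ?_
  filter_upwards [eventually_gt_atTop 0] with n hn
  have hn0 : (0 : ℝ) < n := by exact_mod_cast hn
  congr 1
  unfold permCorr
  have e1 : (n : ℝ) ^ (2 : ℝ) * (n : ℝ) ^ (2 * lam.re - 2) = ((n : ℝ) ^ lam.re) ^ 2 := by
    rw [← Real.rpow_add hn0, ← Real.rpow_natCast, ← Real.rpow_mul hn0.le]
    congr 1; push_cast; ring
  have hp : 0 < (n : ℝ) ^ lam.re := by positivity
  rw [div_mul_div_comm, e1, Real.sqrt_div (mul_nonneg (permCov_self_nonneg _ _)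
    (permCov_self_nonneg _ _)), Real.sqrt_sq hp.le, Real.sqrt_mul (permCov_self_nonneg _ _),
    div_div_div_cancel_right₀ hp.ne', mul_comm (√(permCov n (keyFun m) (keyFun m)))]

theorem var_spaceReq (m n : ℕ) : Var[spaceReq m n; unifPerm n] =
    permCov n (sizeFun m) (sizeFun m) := variance_unifPerm n (sizeFun m)

theorem var_keyPathLength (m n : ℕ) : Var[keyPathLength m n; unifPerm n] =
    permCov n (keyFun m) (keyFun m) := variance_unifPerm n (keyFun m)

theorem var_nodePathLength (m n : ℕ) : Var[nodePathLength m n; unifPerm n] =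
    permCov n (nodeFun m) (nodeFun m) := variance_unifPerm n (nodeFun m)

theorem corrCoeff_spaceReq_keyPathLength (m n : ℕ) :
    corrCoeff (unifPerm n) (spaceReq m n) (keyPathLength m n) =
      permCorr n (sizeFun m) (keyFun m) := by
  unfold corrCoeff permCorr
  rw [var_spaceReq, var_keyPathLength]
  congr 1
  exact covariance_unifPerm n (sizeFun m) (keyFun m)

theorem corrCoeff_spaceReq_nodePathLength (m n : ℕ) :
    corrCoeff (unifPerm n) (spaceReq m n) (nodePathLength m n) =
      permCorr n (sizeFun m) (nodeFun m) := by
  unfold corrCoeff permCorr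
  rw [var_spaceReq, var_nodePathLength]
  congr 1
  exact covariance_unifPerm n (sizeFun m) (nodeFun m)

end Correlation

theorem corollary2p4 (m : ℕ) (hm : 3 ≤ m) :
    (m ≤ 26 →
      (∀ᶠ n : ℕ in atTop,
        0 < Var[spaceReq m n; unifPerm n] ∧ 0 < Var[nodePathLength m n; unifPerm n]) ∧
      Tendsto (fun n : ℕ => corrCoeff (unifPerm n) (spaceReq m n) (nodePathLength m n))
        atTop (𝓝 0)) ∧
    (27 ≤ m →
      (∀ᶠ n : ℕ in atTop,
        0 < Var[spaceReq m n; unifPerm n] ∧ 0 < Var[nodePathLength m n; unifPerm n] ∧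
          0 < Var[keyPathLength m n; unifPerm n]) ∧
      0 < constK m ∧
      (∃! lam : ℂ, IsSecondZero m lam) ∧
      ∀ lam : ℂ, IsSecondZero m lam →
        (∀ z : ℝ, 0 < F1 m lam z) ∧
        Tendsto (fun n : ℕ =>
          corrCoeff (unifPerm n) (spaceReq m n) (nodePathLength m n)
            - corrCoeff (unifPerm n) (spaceReq m n) (keyPathLength m n)) atTop (𝓝 0) ∧
        Tendsto (fun n : ℕ =>
          corrCoeff (unifPerm n) (spaceReq m n) (keyPathLength m n)
            - F2 m lam (lam.im * Real.log n) /
                √(constK m * F1 m lam (lam.im * Real.log n))) atTop (𝓝 0)) := by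
  have hdiff := tendsto_permCorr_sub hm
  have hS := eventually_permCov_sizeFun_pos hm
  have hN := eventually_permCov_nodeFun_pos hm
  have hK := eventually_permCov_keyFun_pos hm
  simp only [corrCoeff_spaceReq_keyPathLength, corrCoeff_spaceReq_nodePathLength, var_spaceReq,
    var_keyPathLength, var_nodePathLength]
  refine ⟨fun hm26 => ⟨hS.and hN, ?_⟩, fun hm27 => ⟨hS.and (hN.and hK), constK_pos hm,
    existsUnique_isSecondZero hm27, fun lam hlam =>
      ⟨F1_pos hm27 hlam, hdiff, tendsto_permCorr_large hm27 hlam⟩⟩⟩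
  have h := hdiff.add (tendsto_permCorr_small hm hm26)
  rw [add_zero] at h
  exact h.congr fun n => by ring
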